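/- Let $(\theta_j)_{j\ge1}$, $(\kappa_j)_{j\ge1}$ be sequences of non-negative reals, with $(\kappa_j)$ non-arithmetic (no integer $j_0>1$ divides every $j$ with $\kappa_j\ne0$) and $\kappa_j>0$ for some $j\ge2$. Put $$g_\theta(z)=\sum_{j\ge1}\frac{\theta_j}{j}z^j,\qquad g_\kappa(z)=\sum_{j\ge1}\frac{\kappa_j}{j}z^j,\qquad G_N(z)=g_\theta(z)+N g_\kappa(z),$$ $$H_N=\frac1{N!}\sum_{\sigma\in S_N}\prod_{j=1}^N(\theta_j+N\kappa_j)^{C_j(\sigma)},$$ where $C_j(\sigma)$ is the number of cycles of length $j$ of $\sigma$. For a function $g$ write $g^{\{n\}}(z)=z^n\,\frac{d^n g}{dz^n}(z)$ and $g^{\{n\}}(R)=\lim_{r\uparrow R}g^{\{n\}}(r)$ (for $g_\theta,g_\kappa$ this is $+\infty$ if the limit diverges); let $[z^N]F(z)$ be the $N$-th Taylor coefficient of $F$ at $0$. For $R,\eta>0$ and $\varphi\in(0,\pi/2)$ let $$\varDelta_0=\{z\in\mathbb C:\ |z|<|R(1+\eta e^{i\varphi})|,\ z\ne R,\ |\arg(z-R)|>\varphi\}.$$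 Assume that $g_\kappa$ has radius of convergence $R\in(0,\infty)$ and extends holomorphically to $\varDelta_0$, that $g_\theta$ extends holomorphically to $\varDelta_0$ and is regular (analytic) at $R$, and that $g_\kappa^{\{1\}}(R)<1$. Assume further that there is a non-integer $s>1$ such that $g_\kappa^{\{n\}}(R)<\infty$ for all integers $0\le n<s$ and $g_\kappa^{\{n\}}(R)=\infty$ for all integers $n>s$, and that, for some real $a_s\ne0$ and some $\delta>0$, as $z\to R$, $z\in\varDelta_0$, $$g_\kappa(z)=\sum_{0\le n<s}\frac{(-1)^n g_\kappa^{\{n\}}(R)}{n!}(1-z/R)^n+a_s(1-z/R)^s+O\bigl(|1-z/R|^{s+\delta}\bigr).$$ **(A)** Let $f\colon\varDelta_0\to\mathbb C$ be holomorphic and such that, for some $\beta>0$, $c_\beta>0$ and $\delta'>0$, as $z\to R$, $z\in\varDelta_0$, $$f(z)=1+\sum_{1\le n<\beta}\frac{(-1)^n f^{\{n\}}(R)}{n!}(1-z/R)^n+c_\beta(1-z/R)^\beta+O\bigl(|1-z/R|^{\beta+\delta'}\bigr).$$ Write $d(v)=1-v\,g_\kappa^{\{1\}}(R)$. Then, for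 any $0<v_1<1<v_2<1/g_\kappa^{\{1\}}(R)$, as $N\to\infty$: (i) If $\beta>s-1$, then, uniformly in $v\in[v_1,v_2]$, $$[z^N]\bigl[f(z)e^{vG_N(z)}\bigr]\sim\frac{e^{vG_N(R)}\,v\,a_s\,\{N d(v)\}^{-s}}{R^N\,\Gamma(-s)\,d(v)}.$$ (ii) If $\beta$ is non-integer and $\beta<s-1$, then, uniformly in $v\in[v_1,v_2]$, $$[z^N]\bigl[f(z)e^{vG_N(z)}\bigr]\sim\frac{e^{vG_N(R)}\,c_\beta\,\{N d(v)\}^{-\beta-1}}{R^N\,\Gamma(-\beta)}.$$ (iii) If $\beta=s-1$, put $B(v)=\dfrac{c_\beta}{\Gamma(1-s)}+\dfrac{v\,a_s}{\Gamma(-s)\,d(v)}$. Then, with $o(1)$ uniform in $v\in[v_1,v_2]$, $$[z^N]\bigl[f(z)e^{vG_N(z)}\bigr]=\frac{e^{vG_N(R)}\,\{N d(v)\}^{-s}}{R^N}\,\bigl(B(v)+o(1)\bigr).$$ Consequently $$[z^N]\bigl[f(z)e^{vG_N(z)}\bigr]\sim\frac{e^{vG_N(R)}\,\{N d(v)\}^{-s}}{R^N}\,B(v)$$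 uniformly on every compact subset of $[v_1,v_2]$ on which $B$ has no zero. **(B)** In particular, $$H_N\sim\frac{e^{G_N(R)}\,a_s\,\{N(1-g_\kappa^{\{1\}}(R))\}^{-s}}{R^N\,\Gamma(-s)\,(1-g_\kappa^{\{1\}}(R))},\qquad N\to\infty.$$ -/

import Mathlib

open Filter Topology Asymptotics

noncomputable section

namespace SurrogateSpatial

/-- The `j`-th coefficient `a_j / j` of the generating function `g_a(z) = ∑_{j ≥ 1} (a_j / j) z^j`.
For `j = 0` this is `0`, whatever the unused entry `a 0` is. -/
def genCoeff (a : ℕ → ℝ) (j : ℕ) : ℝ := a j / j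

/-- The generating function `g_a(r) = ∑_{j ≥ 1} (a_j / j) r^j` at real arguments. -/
def genFun (a : ℕ → ℝ) (r : ℝ) : ℝ := ∑' j : ℕ, genCoeff a j * r ^ j

/-- The modified derivative `g^{n}(z) = z^n (d/dz)^n g(z)` (over `ℝ` or `ℂ`). -/
def modDeriv {𝕜 : Type*} [NontriviallyNormedField 𝕜] (n : ℕ) (g : 𝕜 → 𝕜) (z : 𝕜) : 𝕜 :=
  z ^ n * iteratedDeriv n g z

/-- `g_a^{n}(R) = lim_{r ↑ R} g_a^{n}(r) ∈ [0, ∞]`, taken in the extended reals.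
(For `a_j ≥ 0` and a series converging on `[0, R)` the function under the limit is monotone,
so that the limit exists, and it is `⊤` exactly when the limit diverges in `ℝ`.) -/
def boundaryDeriv (a : ℕ → ℝ) (n : ℕ) (R : ℝ) : EReal :=
  limUnder (𝓝[<] R) (fun r : ℝ => ((modDeriv n (genFun a) r : ℝ) : EReal))

/-- `f^{n}(R) = lim_{r ↑ R} f^{n}(r)` for a complex function `f`. -/
def boundaryDerivC (f : ℂ → ℂ) (n : ℕ) (R : ℝ) : ℂ :=
  limUnder (𝓝[<] R) (fun r : ℝ => modDeriv n f (r : ℂ))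

/-- The domain `Δ₀(R, η, φ)`: the disk of radius `|R (1 + η e^{iφ})|` without the closed sector
`|arg (z - R)| ≤ φ` with vertex `R`. -/
def Delta0 (R η φ : ℝ) : Set ℂ :=
  {z : ℂ | ‖z‖ < ‖(R : ℂ) * (1 + η * Complex.exp (φ * Complex.I))‖ ∧ z ≠ (R : ℂ) ∧
    φ < |Complex.arg (z - R)|}

/-- The sequence `(κ_j)_{j ≥ 1}` is non-arithmetic and non-degenerate. -/
def NonArithmetic (κ : ℕ → ℝ) : Prop :=
  (¬ ∃ j₀ : ℕ, 1 < j₀ ∧ ∀ j : ℕ, 1 ≤ j → κ j ≠ 0 → j₀ ∣ j) ∧ ∃ j : ℕ, 2 ≤ j ∧ 0 < κ j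

/-- The Taylor coefficient `[z^N] F(z)` at the origin. -/
def coeffAt (N : ℕ) (F : ℂ → ℂ) : ℂ := iteratedDeriv N F 0 / (Nat.factorial N : ℂ)

/-- The number `C_j(σ)` of cycles of length `j` of the permutation `σ` (fixed points are cycles of
length `1`). -/
def cycleCount {N : ℕ} (σ : Equiv.Perm (Fin N)) (j : ℕ) : ℕ := σ.partition.parts.count j

/-- `H_N = (1 / N!) ∑_{σ ∈ S_N} ∏_{j=1}^N (θ_j + N κ_j)^{C_j(σ)}`. -/
def H (θ κ : ℕ → ℝ) (N : ℕ) : ℝ :=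
  (∑ σ : Equiv.Perm (Fin N), ∏ j ∈ Finset.Icc 1 N, (θ j + N * κ j) ^ cycleCount σ j) /
    (Nat.factorial N : ℝ)

/-- `G_N(R) = g_θ(R) + N g_κ(R)`. -/
def GBoundary (θ κ : ℕ → ℝ) (R : ℝ) (N : ℕ) : ℝ :=
  (boundaryDeriv θ 0 R).toReal + N * (boundaryDeriv κ 0 R).toReal

/-- `A_N(v) ∼ B_N(v)` as `N → ∞`, uniformly in `v ∈ K`. -/
def UnifEquiv (K : Set ℝ) (A : ℕ → ℝ → ℂ) (B : ℕ → ℝ → ℝ) : Prop :=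
  ∀ ε : ℝ, 0 < ε → ∀ᶠ N : ℕ in atTop, ∀ v ∈ K, ‖A N v - (B N v : ℂ)‖ ≤ ε * |B N v|

end SurrogateSpatial

end

/-! In the coordinate `z = R e^ζ`, Cauchy's formula writes the coefficient, up to the factor `e^{v
G_N(R)} R^{-N}`, as the integral over one vertical period of `f e^{v (g_θ - g_θ(R))} e^{N (v (g_κ -
g_κ(R)) - ζ)}`. To first order at `ζ = 0` the exponent is `-N d(v) ζ` with `d(v) > 0`: there is no
saddle point, and the integrand decays to the right of the imaginary axis. The contour is therefore
pushed to the right as far as `Δ₀` allows, around the singularity at `0`. It becomes two legs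
leaving `0` in the directions `e^{±iψ}` with `φ < ψ < π/2`, continued by vertical segments up to
height `±π`; the horizontal edges cancel by periodicity (`eq_legs_add_outer`).

The vertical segments contribute an exponentially small amount. Away from `0` this holds because
non-arithmeticity makes `Re g_κ` strictly smaller than `g_κ(R)` on the rest of the circle
(`re_lt_of_nonArithmetic`). This gap closes at `0`, and there the convergence of the derivative of
`g_κ` inside a wedge takes over (`exists_re_exponent_le`).

On the legs, `f` and `g_κ` are compared with their regular parts `p` and `Q`, polynomials in `1 -
e^ζ`. The comparison integrand is holomorphic in a full disc, so its two legs close up to a chord in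
`Re ζ > 0`, where it is exponentially small: regular terms contribute nothing. What remains is
driven by `f - p`, of order `(-ζ)^(q-1)`, and by `N v (g_κ - Q)`, of order `N (-ζ)^q`. Rescaling by
`N` and dominated convergence (`tendsto_leg`) lead to Hankel's loop integral (`rayIntegral_sub`),
hence to `N^{-q}` times `c₁ d^{-q} / Γ(1-q) + v a₁ d^{-q-1} / Γ(-q)`. Taking `q = min(s, β + 1)`,
with the coefficient of the weaker singularity set to zero, covers the three cases at once.

Uniformity in `v` comes from taking limits jointly in `(N, v)` and using compactness. For `H_N`, the
cycle index obeys the same recursion as the Taylor coefficients of an exponential (`H_eq_coeffAt`),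
so that `f = 1`, `v = 1` applies. -/

namespace SurrogateSpatial

open MeasureTheory

/-! ### Segment integrals, contour deformation, and Cauchy's formula in the exponential coordinate.
-/

/-- The integral of `F` along the segment from `a` to `b`. -/
noncomputable def segInt (F : ℂ → ℂ) (a b : ℂ) : ℂ :=
  ∫ t in (0 : ℝ)..1, F (a + t * (b - a)) * (b - a)

theorem add_mul_sub_mem_of_convex {U : Set ℂ} (hU : Convex ℝ U) {a b : ℂ} (ha : a ∈ U)
    (hb : b ∈ U) {t : ℝ} (ht : t ∈ Set.Icc (0 : ℝ) 1) : a + t * (b - a) ∈ U := by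
  have := hU.add_smul_sub_mem ha hb ht
  simpa using this

theorem segInt_eq_sub {U : Set ℂ} (hU : Convex ℝ U) {F Φ : ℂ → ℂ}
    (hF : ContinuousOn F U) (hΦ : ∀ z ∈ U, HasDerivAt Φ (F z) z) {a b : ℂ}
    (ha : a ∈ U) (hb : b ∈ U) : segInt F a b = Φ b - Φ a := by
  have hmaps : Set.MapsTo (fun t : ℝ => a + t * (b - a)) (Set.uIcc (0 : ℝ) 1) U := by
    intro t ht
    rw [Set.uIcc_of_le zero_le_one] at ht
    exact add_mul_sub_mem_of_convex hU ha hb ht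
  have hd : ∀ t ∈ Set.uIcc (0 : ℝ) 1,
      HasDerivAt (fun t : ℝ => Φ (a + t * (b - a))) (F (a + t * (b - a)) * (b - a)) t := by
    intro t ht
    have h1 : HasDerivAt (fun t : ℝ => a + (t : ℂ) * (b - a)) (b - a) t := by
      simpa using ((Complex.ofRealCLM.hasDerivAt (x := t)).mul_const (b - a)).const_add a
    exact (hΦ _ (hmaps ht)).comp t h1
  have hcont : ContinuousOn (fun t : ℝ => F (a + t * (b - a)) * (b - a)) (Set.uIcc (0 : ℝ) 1) :=
    (hF.comp (by fun_prop) hmaps).mul continuousOn_const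
  rw [segInt, intervalIntegral.integral_eq_sub_of_hasDerivAt hd hcont.intervalIntegrable]
  simp

theorem exists_primitive {U : Set ℂ} (hU : Convex ℝ U) (hUo : IsOpen U) {F : ℂ → ℂ}
    (hF : DifferentiableOn ℂ F U) : ∃ Φ : ℂ → ℂ, ∀ z ∈ U, HasDerivAt Φ (F z) z := by
  obtain ⟨Φ, hΦ⟩ := hU.exists_forall_hasDerivWithinAt hF
  exact ⟨Φ, fun z hz => (hΦ z hz).hasDerivAt (hUo.mem_nhds hz)⟩

/-- Both sides telescope through a primitive. This triangle form of Cauchy's theorem is the only one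
that the deformations need. -/
theorem segInt_add {U : Set ℂ} (hU : Convex ℝ U) (hUo : IsOpen U) {F : ℂ → ℂ}
    (hF : DifferentiableOn ℂ F U) {a b c : ℂ} (ha : a ∈ U) (hb : b ∈ U) (hc : c ∈ U) :
    segInt F a b + segInt F b c = segInt F a c := by
  obtain ⟨Φ, hΦ⟩ := exists_primitive hU hUo hF
  rw [segInt_eq_sub hU hF.continuousOn hΦ ha hb, segInt_eq_sub hU hF.continuousOn hΦ hb hc,
    segInt_eq_sub hU hF.continuousOn hΦ ha hc]
  ring

theorem segInt_shift (F : ℂ → ℂ) (a b w : ℂ) :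
    segInt (fun z => F (z + w)) a b = segInt F (a + w) (b + w) := by
  simp only [segInt]
  congr 1
  ext t
  rw [show a + ↑t * (b - a) + w = a + w + ↑t * (b + w - (a + w)) by ring]
  ring

theorem norm_segInt_le {F : ℂ → ℂ} {a b : ℂ} {M : ℝ}
    (h : ∀ t ∈ Set.Icc (0 : ℝ) 1, ‖F (a + t * (b - a))‖ ≤ M) :
    ‖segInt F a b‖ ≤ M * ‖b - a‖ := by
  have : ∀ t ∈ Set.uIoc (0 : ℝ) 1, ‖F (a + t * (b - a)) * (b - a)‖ ≤ M * ‖b - a‖ := by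
    intro t ht
    rw [Set.uIoc_of_le zero_le_one] at ht
    rw [norm_mul]
    gcongr
    exact h t ⟨ht.1.le, ht.2⟩
  simpa [segInt] using intervalIntegral.norm_integral_le_of_norm_le_const this

/-- Translating the segment by `-ε` and letting `ε ↓ 0`, for a function that is continuous on
the open segment and bounded near it. -/
theorem tendsto_segInt_sub {F : ℂ → ℂ} {D : Set ℂ} (hD : IsOpen D) (hF : ContinuousOn F D)
    {a b : ℂ} {ε₀ M : ℝ} (hε₀ : 0 < ε₀)
    (hmem : ∀ t ∈ Set.Ioc (0 : ℝ) 1, a + t * (b - a) ∈ D)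
    (hmem' : ∀ ε ∈ Set.Ioo 0 ε₀, ∀ t ∈ Set.Icc (0 : ℝ) 1, a - (ε : ℝ) + t * (b - a) ∈ D)
    (hM : ∀ ε ∈ Set.Ioo 0 ε₀, ∀ t ∈ Set.Icc (0 : ℝ) 1, ‖F (a - (ε : ℝ) + t * (b - a))‖ ≤ M) :
    Tendsto (fun ε : ℝ => segInt F (a - ε) (b - ε)) (𝓝[>] 0) (𝓝 (segInt F a b)) := by
  have hev : ∀ᶠ ε : ℝ in 𝓝[>] 0, ε ∈ Set.Ioo 0 ε₀ := Ioo_mem_nhdsGT hε₀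
  have key : ∀ ε : ℝ, segInt F (a - ε) (b - ε)
      = ∫ t in (0 : ℝ)..1, F (a - (ε : ℝ) + t * (b - a)) * (b - a) := by
    intro ε; simp [segInt]
  simp only [key]
  refine intervalIntegral.tendsto_integral_filter_of_dominated_convergence
    (fun _ => M * ‖b - a‖) ?_ ?_ (by simp) ?_
  · filter_upwards [hev] with ε hε
    rw [Set.uIoc_of_le zero_le_one]
    have : ContinuousOn (fun t : ℝ => F (a - (ε : ℝ) + t * (b - a)) * (b - a))
        (Set.Ioc (0 : ℝ) 1) := by
      refine (hF.comp (by fun_prop) fun t ht => hmem' ε hε t ⟨ht.1.le, ht.2⟩).mul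
        continuousOn_const
    exact this.aestronglyMeasurable measurableSet_Ioc
  · filter_upwards [hev] with ε hε
    refine ae_of_all _ fun t ht => ?_
    rw [Set.uIoc_of_le zero_le_one] at ht
    rw [norm_mul]
    gcongr
    exact hM ε hε t ⟨ht.1.le, ht.2⟩
  · refine ae_of_all _ fun t ht => ?_
    rw [Set.uIoc_of_le zero_le_one] at ht
    have hc : ContinuousAt F (a + t * (b - a)) := hF.continuousAt (hD.mem_nhds (hmem t ht))
    have h1 : Tendsto (fun ε : ℝ => a - (ε : ℂ) + t * (b - a)) (𝓝[>] 0)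
        (𝓝 (a + t * (b - a))) := by
      have : Continuous fun ε : ℝ => a - (ε : ℂ) + t * (b - a) := by fun_prop
      have h2 := this.tendsto 0
      simp only [Complex.ofReal_zero, sub_zero] at h2
      exact h2.mono_left nhdsWithin_le_nhds
    exact (hc.tendsto.comp h1).mul_const _

/-- Version of `tendsto_segInt_sub` for a closed segment inside the open set. -/
theorem tendsto_segInt_sub_of_segment_subset {F : ℂ → ℂ} {D : Set ℂ} (hD : IsOpen D)
    (hF : ContinuousOn F D) {a b : ℂ} (hmem : ∀ t ∈ Set.Icc (0 : ℝ) 1, a + t * (b - a) ∈ D) :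
    Tendsto (fun ε : ℝ => segInt F (a - ε) (b - ε)) (𝓝[>] 0) (𝓝 (segInt F a b)) := by
  have hK : IsCompact ((fun t : ℝ => a + t * (b - a)) '' Set.Icc (0 : ℝ) 1) :=
    isCompact_Icc.image (by fun_prop)
  obtain ⟨ε₀, hε₀, hsub⟩ := hK.exists_cthickening_subset_open hD
    (by rintro _ ⟨t, ht, rfl⟩; exact hmem t ht)
  have hmem' : ∀ ε ∈ Set.Ioo 0 ε₀, ∀ t ∈ Set.Icc (0 : ℝ) 1, a - (ε : ℝ) + t * (b - a) ∈
      Metric.cthickening ε₀ ((fun t : ℝ => a + t * (b - a)) '' Set.Icc (0 : ℝ) 1) := by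
    intro ε hε t ht
    refine Metric.mem_cthickening_of_dist_le _ (a + t * (b - a)) _ _ ⟨t, ht, rfl⟩ ?_
    rw [dist_eq_norm, show a - (ε : ℂ) + t * (b - a) - (a + t * (b - a)) = -(ε : ℂ) by ring,
      norm_neg, Complex.norm_real, Real.norm_of_nonneg hε.1.le]
    exact hε.2.le
  obtain ⟨M, hM⟩ := hK.cthickening.exists_bound_of_continuousOn (hF.mono hsub)
  exact tendsto_segInt_sub hD hF hε₀ (fun t ht => hmem t ⟨ht.1.le, ht.2⟩)
    (fun ε hε t ht => hsub (hmem' ε hε t ht)) (fun ε hε t ht => hM _ (hmem' ε hε t ht))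

/-- Deformation of the vertical segment `[-ε - iπ, -ε + iπ]`, for a `2πi`-periodic holomorphic
function, into two legs starting at the boundary point `0`, followed by two outer segments. -/
theorem eq_legs_add_outer {F : ℂ → ℂ} {D Up Lo : Set ℂ} (hD : IsOpen D)
    (hF : DifferentiableOn ℂ F D) (hper : ∀ z, F (z + 2 * Real.pi * Complex.I) = F z)
    (hUp : Convex ℝ Up) (hUpo : IsOpen Up) (hUpD : Up ⊆ D)
    (hLo : Convex ℝ Lo) (hLoo : IsOpen Lo) (hLoD : Lo ⊆ D)
    (hleft : {z : ℂ | z.re < 0} ⊆ D)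
    {p q : ℂ} {ρ ε₀ M : ℝ} {C : ℂ} (hε₀ : 0 < ε₀)
    (hup : ∀ ε ∈ Set.Ioo 0 ε₀, -(ε : ℂ) ∈ Up ∧ p - ε ∈ Up ∧ ρ + Real.pi * Complex.I - ε ∈ Up ∧
      Real.pi * Complex.I - ε ∈ Up)
    (hlo : ∀ ε ∈ Set.Ioo 0 ε₀, -(ε : ℂ) ∈ Lo ∧ q - ε ∈ Lo ∧ ρ - Real.pi * Complex.I - ε ∈ Lo ∧
      -(Real.pi * Complex.I) - ε ∈ Lo)
    (hp : ∀ t ∈ Set.Ioc (0 : ℝ) 1, t * p ∈ D) (hq : ∀ t ∈ Set.Ioc (0 : ℝ) 1, t * q ∈ D)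
    (hpM : ∀ ε ∈ Set.Ioo 0 ε₀, ∀ t ∈ Set.Icc (0 : ℝ) 1, ‖F (-(ε : ℝ) + t * p)‖ ≤ M)
    (hqM : ∀ ε ∈ Set.Ioo 0 ε₀, ∀ t ∈ Set.Icc (0 : ℝ) 1, ‖F (-(ε : ℝ) + t * q)‖ ≤ M)
    (hpv : ∀ t ∈ Set.Icc (0 : ℝ) 1, p + t * (ρ + Real.pi * Complex.I - p) ∈ D)
    (hqv : ∀ t ∈ Set.Icc (0 : ℝ) 1, q + t * (ρ - Real.pi * Complex.I - q) ∈ D)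
    (hC : ∀ ε ∈ Set.Ioo 0 ε₀,
      segInt F (-ε - Real.pi * Complex.I) (-ε + Real.pi * Complex.I) = C) :
    C = segInt F 0 p + segInt F p (ρ + Real.pi * Complex.I) -
      (segInt F 0 q + segInt F q (ρ - Real.pi * Complex.I)) := by
  have hev : ∀ᶠ ε : ℝ in 𝓝[>] 0, ε ∈ Set.Ioo 0 ε₀ := Ioo_mem_nhdsGT hε₀
  have hleftc : Convex ℝ {z : ℂ | z.re < 0} := by
    have := (convex_Iio (0 : ℝ)).linear_preimage Complex.reLm
    exact this
  have hlefto : IsOpen {z : ℂ | z.re < 0} := isOpen_lt Complex.continuous_re continuous_const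
  -- The shift by `-ε` moves every vertex into an open convex set where `F` is holomorphic. The
  -- point `0` itself is only a boundary point of `D`, so the legs that start there are reached in
  -- the limit.
  have hconst : ∀ ε ∈ Set.Ioo 0 ε₀, segInt F (0 - ε) (p - ε) +
      segInt F (p - ε) (ρ + Real.pi * Complex.I - ε) -
      (segInt F (0 - ε) (q - ε) + segInt F (q - ε) (ρ - Real.pi * Complex.I - ε)) = C := by
    intro ε hε
    obtain ⟨u1, u2, u3, u4⟩ := hup ε hε
    obtain ⟨l1, l2, l3, l4⟩ := hlo ε hε
    have hU := hF.mono hUpD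
    have hL := hF.mono hLoD
    have a1 := segInt_add hUp hUpo hU u1 u2 u3
    have a2 := segInt_add hUp hUpo hU u1 u3 u4
    have b1 := segInt_add hLo hLoo hL l1 l2 l3
    have b2 := segInt_add hLo hLoo hL l1 l3 l4
    have m0 : -(ε : ℂ) ∈ {z : ℂ | z.re < 0} := by simpa using hε.1
    have m1 : Real.pi * Complex.I - (ε : ℂ) ∈ {z : ℂ | z.re < 0} := by simpa using hε.1
    have m2 : -(Real.pi * Complex.I) - (ε : ℂ) ∈ {z : ℂ | z.re < 0} := by simpa using hε.1
    have c1 := segInt_add hleftc hlefto (hF.mono hleft) m2 m0 m1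
    -- A degenerate triangle gives the reversal of a segment.
    have c2 := segInt_add hleftc hlefto (hF.mono hleft) m0 m2 m0
    have c3 : segInt F (-(ε : ℂ)) (-(ε : ℂ)) = 0 := by simp [segInt]
    -- The horizontal edges at heights `±π` differ by one period, so their contributions cancel.
    have d : segInt F (ρ + Real.pi * Complex.I - ε) (Real.pi * Complex.I - ε)
        = segInt F (ρ - Real.pi * Complex.I - ε) (-(Real.pi * Complex.I) - ε) := by
      have := segInt_shift F (ρ - Real.pi * Complex.I - ε) (-(Real.pi * Complex.I) - ε)
        (2 * Real.pi * Complex.I)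
      simp only [hper] at this
      rw [this]
      congr 1 <;> ring
    have e := hC ε hε
    rw [show -(ε : ℂ) - Real.pi * Complex.I = -(Real.pi * Complex.I) - ε by ring,
      show -(ε : ℂ) + Real.pi * Complex.I = Real.pi * Complex.I - ε by ring] at e
    rw [zero_sub]
    linear_combination e + a1 + a2 - b1 - b2 + c1 - c2 - d - c3
  have hlim : Tendsto (fun ε : ℝ => segInt F (0 - ε) (p - ε) +
      segInt F (p - ε) (ρ + Real.pi * Complex.I - ε) -
      (segInt F (0 - ε) (q - ε) + segInt F (q - ε) (ρ - Real.pi * Complex.I - ε))) (𝓝[>] 0)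
      (𝓝 (segInt F 0 p + segInt F p (ρ + Real.pi * Complex.I) -
      (segInt F 0 q + segInt F q (ρ - Real.pi * Complex.I)))) := by
    refine Tendsto.sub (Tendsto.add ?_ ?_) (Tendsto.add ?_ ?_)
    · refine tendsto_segInt_sub hD hF.continuousOn hε₀ (M := M) (by simpa using hp) ?_
        (by simpa using hpM)
      intro ε hε t ht
      obtain ⟨u1, u2, -, -⟩ := hup ε hε
      have := add_mul_sub_mem_of_convex hUp u1 u2 ht
      refine hUpD ?_
      convert this using 1
      ring
    · exact tendsto_segInt_sub_of_segment_subset hD hF.continuousOn hpv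
    · refine tendsto_segInt_sub hD hF.continuousOn hε₀ (M := M) (by simpa using hq) ?_
        (by simpa using hqM)
      intro ε hε t ht
      obtain ⟨u1, u2, -, -⟩ := hlo ε hε
      have := add_mul_sub_mem_of_convex hLo u1 u2 ht
      refine hLoD ?_
      convert this using 1
      ring
    · exact tendsto_segInt_sub_of_segment_subset hD hF.continuousOn hqv
  have hlim' := tendsto_const_nhds (x := C) (f := 𝓝[>] (0 : ℝ))
  refine tendsto_nhds_unique hlim' (hlim.congr' ?_)
  filter_upwards [hev] with ε hε
  exact hconst ε hε

/-- Cauchy's coefficient formula in the exponential coordinate `z = R e^ζ`. -/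
theorem segInt_exp_eq_coeffAt {F : ℂ → ℂ} {R : ℝ} (hR : 0 < R)
    (hF : DifferentiableOn ℂ F (Metric.ball 0 R)) (N : ℕ) {ε : ℝ} (hε : 0 < ε) :
    segInt (fun ζ => F (R * Complex.exp ζ) * Complex.exp (-(N * ζ)))
      (-ε - Real.pi * Complex.I) (-ε + Real.pi * Complex.I) =
    2 * Real.pi * Complex.I * (R : ℂ) ^ N * coeffAt N F := by
  -- The vertical segment at abscissa `-ε` is the circle of this radius, which lies inside the disc
  -- of radius `R`.
  set r : ℝ := R * Real.exp (-ε) with hr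
  have hr0 : 0 < r := by positivity
  have hrR : r < R := by
    have : Real.exp (-ε) < 1 := by simpa using hε
    rw [hr]; nlinarith
  have hsub : Metric.closedBall (0 : ℂ) r ⊆ Metric.ball 0 R := Metric.closedBall_subset_ball hrR
  lift r to NNReal using hr0.le with r'
  have hps := DifferentiableOn.hasFPowerSeriesOnBall (hF.mono hsub) (by exact_mod_cast hr0)
  have hcoef : coeffAt N F =
      (2 * Real.pi * Complex.I)⁻¹ * ∮ z in C(0, r'), (1 / (z - 0)) ^ N * ((z - 0)⁻¹ * F z) := by
    have h1 := hps.factorial_smul 1 N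
    rw [cauchyPowerSeries_apply] at h1
    rw [coeffAt, iteratedDeriv_eq_iteratedFDeriv, ← h1]
    have : (N.factorial : ℂ) ≠ 0 := by exact_mod_cast N.factorial_ne_zero
    simp only [nsmul_eq_mul, smul_eq_mul]
    field_simp
  -- The circle integral runs over `[0, 2π]` and the segment over `[-π, π]`; periodicity of `g`
  -- reconciles the two.
  set g : ℝ → ℂ := fun x => F (R * Complex.exp (-ε + x * Complex.I)) *
    Complex.exp (-(N * (-ε + x * Complex.I))) * Complex.I with hg
  have hgper : Function.Periodic g (2 * Real.pi) := by
    intro x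
    have h1 : Complex.exp (-ε + ((x + 2 * Real.pi : ℝ) : ℂ) * Complex.I) =
        Complex.exp (-ε + x * Complex.I) := by
      rw [Complex.exp_eq_exp_iff_exists_int]
      exact ⟨1, by push_cast; ring⟩
    have h2 : Complex.exp (-(N * (-ε + ((x + 2 * Real.pi : ℝ) : ℂ) * Complex.I))) =
        Complex.exp (-(N * (-ε + x * Complex.I))) := by
      rw [Complex.exp_eq_exp_iff_exists_int]
      exact ⟨-N, by push_cast; ring⟩
    simp only [hg, h1, h2]
  have hseg : segInt (fun ζ => F (R * Complex.exp ζ) * Complex.exp (-(N * ζ)))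
      (-ε - Real.pi * Complex.I) (-ε + Real.pi * Complex.I) =
      ∫ x in (0 : ℝ)..2 * Real.pi, g x := by
    have h1 := intervalIntegral.smul_integral_comp_mul_add (a := 0) (b := 1) g (2 * Real.pi)
      (-Real.pi)
    have h2 := hgper.intervalIntegral_add_eq (-Real.pi) 0
    rw [show 2 * Real.pi * 0 + -Real.pi = -Real.pi by ring,
      show 2 * Real.pi * 1 + -Real.pi = -Real.pi + 2 * Real.pi by ring, h2, zero_add] at h1
    rw [← h1, segInt, ← intervalIntegral.integral_smul]
    congr 1
    ext t
    have : -(ε : ℂ) - Real.pi * Complex.I +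
        t * (-(ε : ℂ) + Real.pi * Complex.I - (-(ε : ℂ) - Real.pi * Complex.I)) =
        -ε + ((2 * Real.pi * t + -Real.pi : ℝ) : ℂ) * Complex.I := by push_cast; ring
    simp only [this, hg, Complex.real_smul]
    push_cast
    ring
  have hcirc : ∮ z in C(0, r'), (1 / (z - 0)) ^ N * ((z - 0)⁻¹ * F z) =
      ((R : ℂ) ^ N)⁻¹ * ∫ x in (0 : ℝ)..2 * Real.pi, g x := by
    rw [circleIntegral, ← intervalIntegral.integral_const_mul]
    congr 1
    ext x
    have hz : circleMap 0 r' x = R * Complex.exp (-ε + x * Complex.I) := by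
      rw [circleMap, Complex.exp_add, hr]
      push_cast
      ring
    have hRne : (R : ℂ) ≠ 0 := by exact_mod_cast hR.ne'
    have he := Complex.exp_ne_zero (-ε + x * Complex.I)
    rw [deriv_circleMap, hz]
    simp only [hg, Complex.exp_neg ((N : ℂ) * _), Complex.exp_nat_mul, smul_eq_mul, sub_zero,
      one_div, inv_pow, mul_pow]
    field_simp
  rw [hseg, hcoef, hcirc]
  have hRne : (R : ℂ) ≠ 0 := by exact_mod_cast hR.ne'
  have hpi : (Real.pi : ℂ) ≠ 0 := by exact_mod_cast Real.pi_ne_zero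
  field_simp

/-! ### Gamma integrals on rotated rays and Hankel's loop. -/

theorem continuousOn_rpow_mul_exp (s : ℝ) (r : ℂ) :
    ContinuousOn (fun t : ℝ => ((t ^ s : ℝ) : ℂ) * Complex.exp (-(r * t))) (Set.Ioi 0) := by
  refine ContinuousOn.mul ?_ (by fun_prop)
  exact Complex.continuous_ofReal.comp_continuousOn
    (continuousOn_id.rpow_const fun t ht => Or.inl (ne_of_gt ht))

theorem integrableOn_rpow_mul_exp {s κ : ℝ} (hs : -1 < s) (hκ : 0 < κ) :
    IntegrableOn (fun t : ℝ => t ^ s * Real.exp (-(κ * t))) (Set.Ioi 0) := by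
  have := integrableOn_rpow_mul_exp_neg_mul_rpow (p := 1) hs one_pos hκ
  simpa using this

theorem norm_rpow_mul_exp {s : ℝ} (r : ℂ) {t : ℝ} (ht : 0 < t) :
    ‖((t ^ s : ℝ) : ℂ) * Complex.exp (-(r * t))‖ = t ^ s * Real.exp (-(r.re * t)) := by
  rw [norm_mul, Complex.norm_real, Real.norm_of_nonneg (by positivity), Complex.norm_exp]
  simp

/-- A positive factor leaves the argument unchanged, so no branch correction arises. -/
theorem ofReal_mul_cpow {d : ℝ} (hd : 0 < d) {z : ℂ} (hz : z ≠ 0) (y : ℂ) :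
    ((d : ℂ) * z) ^ y = (d : ℂ) ^ y * z ^ y := by
  have hd' : (d : ℂ) ≠ 0 := by exact_mod_cast hd.ne'
  rw [Complex.cpow_def_of_ne_zero (mul_ne_zero hd' hz), Complex.cpow_def_of_ne_zero hd',
    Complex.cpow_def_of_ne_zero hz, Complex.log_ofReal_mul hd hz, Complex.ofReal_log hd.le,
    add_mul, Complex.exp_add]

theorem differentiableAt_integral_rpow_mul_exp {s : ℝ} (hs : -1 < s) {r₀ : ℂ} (hr : 0 < r₀.re) :
    DifferentiableAt ℂ
      (fun r : ℂ => ∫ t in Set.Ioi (0 : ℝ), ((t ^ s : ℝ) : ℂ) * Complex.exp (-(r * t))) r₀ := by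
  -- On this ball the real part stays above half its central value, which yields an integrable bound
  -- uniform in `r`.
  have hball : ∀ r ∈ Metric.ball r₀ (r₀.re / 2), r₀.re / 2 < r.re := by
    intro r hr'
    have h1 := Complex.abs_re_le_norm (r - r₀)
    rw [Metric.mem_ball, dist_eq_norm] at hr'
    rw [Complex.sub_re] at h1
    have := abs_lt.1 (h1.trans_lt hr')
    linarith [this.1]
  refine (hasDerivAt_integral_of_dominated_loc_of_deriv_le
    (μ := volume.restrict (Set.Ioi (0 : ℝ)))
    (F := fun (r : ℂ) (t : ℝ) => ((t ^ s : ℝ) : ℂ) * Complex.exp (-(r * t)))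
    (F' := fun (r : ℂ) (t : ℝ) => ((t ^ s : ℝ) : ℂ) * (Complex.exp (-(r * t)) * (-t)))
    (bound := fun t : ℝ => t ^ (s + 1) * Real.exp (-(r₀.re / 2 * t)))
    (Metric.ball_mem_nhds r₀ (half_pos hr)) ?_ ?_ ?_ ?_ ?_ ?_).2.differentiableAt
  · exact Eventually.of_forall fun r =>
      (continuousOn_rpow_mul_exp s r).aestronglyMeasurable measurableSet_Ioi
  · refine Integrable.mono' (integrableOn_rpow_mul_exp hs hr)
      ((continuousOn_rpow_mul_exp s r₀).aestronglyMeasurable measurableSet_Ioi) ?_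
    refine (ae_restrict_iff' measurableSet_Ioi).2 (ae_of_all _ fun t ht => ?_)
    exact (norm_rpow_mul_exp r₀ ht).le
  · have : ContinuousOn (fun t : ℝ => ((t ^ s : ℝ) : ℂ) * Complex.exp (-(r₀ * t)) * (-t))
        (Set.Ioi 0) := (continuousOn_rpow_mul_exp s r₀).mul (by fun_prop)
    simp only [← mul_assoc]
    exact this.aestronglyMeasurable measurableSet_Ioi
  · refine (ae_restrict_iff' measurableSet_Ioi).2 (ae_of_all _ fun t ht r hr' => ?_)
    have ht : 0 < t := ht
    rw [← mul_assoc, norm_mul, norm_rpow_mul_exp r ht, norm_neg, Complex.norm_real,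
      Real.norm_of_nonneg ht.le, Real.rpow_add_one ht.ne']
    have := hball r hr'
    calc t ^ s * Real.exp (-(r.re * t)) * t = t ^ s * t * Real.exp (-(r.re * t)) := by ring
      _ ≤ _ := by gcongr
  · exact integrableOn_rpow_mul_exp (by linarith) (half_pos hr)
  · refine ae_of_all _ fun t r _ => ?_
    have h1 : HasDerivAt (fun r : ℂ => -(r * t)) (-(t : ℂ)) r := by
      simpa using ((hasDerivAt_id' r).mul_const (t : ℂ)).fun_neg
    exact (h1.cexp).const_mul _

/-- The Gamma integral along a rotated ray. -/
theorem integral_rpow_mul_exp {s : ℝ} (hs : -1 < s) {r : ℂ} (hr : 0 < r.re) :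
    ∫ t in Set.Ioi (0 : ℝ), ((t ^ s : ℝ) : ℂ) * Complex.exp (-(r * t)) =
      r ^ (-((s : ℂ) + 1)) * Real.Gamma (s + 1) := by
  have hopen : IsOpen {r : ℂ | 0 < r.re} := isOpen_lt continuous_const Complex.continuous_re
  have hconv : Convex ℝ {r : ℂ | 0 < r.re} :=
    (convex_Ioi (0 : ℝ)).linear_preimage Complex.reLm
  have hA : AnalyticOnNhd ℂ
      (fun r : ℂ => ∫ t in Set.Ioi (0 : ℝ), ((t ^ s : ℝ) : ℂ) * Complex.exp (-(r * t)))
      {r : ℂ | 0 < r.re} :=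
    DifferentiableOn.analyticOnNhd (fun r hr =>
      (differentiableAt_integral_rpow_mul_exp hs hr).differentiableWithinAt) hopen
  have hB : AnalyticOnNhd ℂ (fun r : ℂ => r ^ (-((s : ℂ) + 1)) * Real.Gamma (s + 1))
      {r : ℂ | 0 < r.re} := by
    refine DifferentiableOn.analyticOnNhd (fun r hr => ?_) hopen
    have : DifferentiableAt ℂ (fun r : ℂ => r ^ (-((s : ℂ) + 1))) r :=
      differentiableAt_id.cpow_const (Or.inl hr)
    exact (this.mul_const _).differentiableWithinAt
  have hreal : ∀ x : ℝ, 0 < x →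
      ∫ t in Set.Ioi (0 : ℝ), ((t ^ s : ℝ) : ℂ) * Complex.exp (-((x : ℂ) * t)) =
      (x : ℂ) ^ (-((s : ℂ) + 1)) * Real.Gamma (s + 1) := by
    intro x hx
    have h := Complex.integral_cpow_mul_exp_neg_mul_Ioi (a := (s : ℂ) + 1) (r := x)
      (by simpa using by linarith) hx
    rw [← Complex.Gamma_ofReal, Complex.cpow_neg, ← Complex.inv_cpow _ _
      (by rw [Complex.arg_ofReal_of_nonneg hx.le]; exact Real.pi_pos.ne)]
    push_cast
    rw [one_div] at h
    rw [← h]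
    refine setIntegral_congr_fun measurableSet_Ioi fun t ht => ?_
    have ht : 0 < t := ht
    simp only [add_sub_cancel_right]
    rw [Complex.ofReal_cpow ht.le]
  -- Real points accumulating at `1` suffice for the identity theorem on the half plane.
  have hfreq : ∃ᶠ z : ℂ in 𝓝[≠] (1 : ℂ),
      ∫ t in Set.Ioi (0 : ℝ), ((t ^ s : ℝ) : ℂ) * Complex.exp (-(z * t)) =
      z ^ (-((s : ℂ) + 1)) * Real.Gamma (s + 1) := by
    have ht : Tendsto (fun x : ℝ => (x : ℂ)) (𝓝[>] 1) (𝓝[≠] (1 : ℂ)) := by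
      refine tendsto_nhdsWithin_iff.2 ⟨?_, ?_⟩
      · exact (by simpa using Complex.continuous_ofReal.tendsto 1 :
          Tendsto (fun x : ℝ => (x : ℂ)) (𝓝 1) (𝓝 1)).mono_left nhdsWithin_le_nhds
      · filter_upwards [self_mem_nhdsWithin] with x hx
        have : (1 : ℝ) < x := hx
        simpa using by exact_mod_cast this.ne'
    refine ht.frequently (Eventually.frequently ?_)
    filter_upwards [self_mem_nhdsWithin] with x hx
    exact hreal x (zero_lt_one.trans hx)
  exact hA.eqOn_of_preconnected_of_frequently_eq hB hconv.isPreconnected (by simp) hfreq hr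

/-- The contribution of the ray with direction `e` to Hankel's loop integral. -/
noncomputable def rayIntegral (s d : ℝ) (e : ℂ) : ℂ :=
  ∫ t in Set.Ioi (0 : ℝ), e * ((-e) ^ (s : ℂ) * ((t ^ s : ℝ) : ℂ)) * Complex.exp (-((d * e) * t))

/-- The factors `e`, `(-e)^s` and `(d e)^(-s-1)` combine so that only the difference `ω - ψ` of the
arguments of `-e` and `e` survives. The value is thus independent of the opening angle. -/
theorem rayIntegral_exp {s d ψ ω : ℝ} (hs : -1 < s) (hd : 0 < d) (hψ : |ψ| < Real.pi / 2)
    (hω : ω ∈ Set.Ioc (-Real.pi) Real.pi)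
    (hψω : -Complex.exp (ψ * Complex.I) = Complex.exp (ω * Complex.I)) :
    rayIntegral s d (Complex.exp (ψ * Complex.I)) =
      Complex.exp (s * (ω - ψ) * Complex.I) * ((d ^ (-s - 1) : ℝ) : ℂ) * Real.Gamma (s + 1) := by
  have hcos : 0 < Real.cos ψ := Real.cos_pos_of_mem_Ioo (abs_lt.1 hψ)
  have hre : 0 < ((d : ℂ) * Complex.exp (ψ * Complex.I)).re := by
    rw [Complex.re_ofReal_mul, Complex.exp_ofReal_mul_I_re]
    positivity
  have hpow : ∀ (x : ℝ) (y : ℂ), x ∈ Set.Ioc (-Real.pi) Real.pi →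
      Complex.exp (x * Complex.I) ^ y = Complex.exp (x * Complex.I * y) := by
    intro x y hx
    rw [Complex.cpow_def_of_ne_zero (Complex.exp_ne_zero _), Complex.log_exp] <;> simpa using
      by first | exact hx.1 | exact hx.2
  have hψ' : ψ ∈ Set.Ioc (-Real.pi) Real.pi := by
    have := abs_lt.1 hψ
    constructor <;> linarith [Real.pi_pos, this.1, this.2]
  have h1 : rayIntegral s d (Complex.exp (ψ * Complex.I)) =
      Complex.exp (ψ * Complex.I) * (-Complex.exp (ψ * Complex.I)) ^ (s : ℂ) *
      ∫ t in Set.Ioi (0 : ℝ), ((t ^ s : ℝ) : ℂ) *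
        Complex.exp (-((d * Complex.exp (ψ * Complex.I)) * t)) := by
    rw [rayIntegral, ← integral_const_mul]
    congr 1
    ext t
    ring
  rw [h1, integral_rpow_mul_exp hs hre, hψω, hpow _ _ hω,
    ofReal_mul_cpow hd (Complex.exp_ne_zero _), hpow _ _ hψ', Complex.ofReal_cpow hd.le]
  have : Complex.exp (s * (ω - ψ) * Complex.I) = Complex.exp (ψ * Complex.I) *
      Complex.exp (ω * Complex.I * s) * Complex.exp (ψ * Complex.I * -((s : ℂ) + 1)) := by
    rw [← Complex.exp_add, ← Complex.exp_add]
    ring_nf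
  rw [this]
  push_cast
  ring_nf

/-- Hankel's formula: the two rays carry the phases `e^{∓iπs}`, whose difference is a multiple of
`sin (πs)`, and the reflection formula converts it into `1 / Γ(-s)`. -/
theorem rayIntegral_sub {s d ψ : ℝ} (hs : 0 < s) (hd : 0 < d) (hψ0 : 0 < ψ)
    (hψ : ψ < Real.pi / 2) :
    rayIntegral s d (Complex.exp (ψ * Complex.I)) -
      rayIntegral s d (Complex.exp ((-ψ : ℝ) * Complex.I)) =
      2 * Real.pi * Complex.I * ((d ^ (-s - 1) / Real.Gamma (-s) : ℝ) : ℂ) := by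
  have hpi := Real.pi_pos
  have hψ1 : |ψ| < Real.pi / 2 := by rwa [abs_of_pos hψ0]
  have hψ2 : |-ψ| < Real.pi / 2 := by rwa [abs_neg]
  have e1 : -Complex.exp (ψ * Complex.I) = Complex.exp ((ψ - Real.pi : ℝ) * Complex.I) := by
    push_cast
    rw [sub_mul, Complex.exp_sub, Complex.exp_pi_mul_I]
    ring
  have e2 : -Complex.exp ((-ψ : ℝ) * Complex.I) =
      Complex.exp ((-ψ + Real.pi : ℝ) * Complex.I) := by
    push_cast
    rw [add_mul, Complex.exp_add, Complex.exp_pi_mul_I]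
    ring
  rw [rayIntegral_exp (by linarith) hd hψ1 ⟨by linarith, by linarith⟩ e1,
    rayIntegral_exp (by linarith) hd hψ2 ⟨by linarith, by linarith⟩ e2]
  -- For integer `s` the sine vanishes and `Real.Gamma (-s)` takes the default value `0` at its
  -- pole, so the identity needs no exception.
  have hG : (Real.Gamma (-s))⁻¹ = -Real.sin (Real.pi * s) * Real.Gamma (s + 1) / Real.pi := by
    have h1 := Real.Gamma_mul_Gamma_one_sub (-s)
    have hGp : Real.Gamma (s + 1) ≠ 0 := (Real.Gamma_pos_of_pos (by linarith)).ne'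
    rw [show 1 - -s = s + 1 by ring, show Real.pi * -s = -(Real.pi * s) by ring, Real.sin_neg] at h1
    rw [eq_div_iff hGp |>.2 h1]
    rcases eq_or_ne (Real.sin (Real.pi * s)) 0 with h0 | h0
    · simp [h0]
    · field_simp
  have h3 : Complex.exp (s * ((ψ - Real.pi : ℝ) - ψ) * Complex.I) -
      Complex.exp (s * ((-ψ + Real.pi : ℝ) - (-ψ : ℝ)) * Complex.I) =
      -2 * Complex.I * Complex.sin (Real.pi * s) := by
    rw [Complex.sin]
    push_cast
    rw [show (s : ℂ) * (ψ - Real.pi - ψ) * Complex.I = -(Real.pi * s) * Complex.I by ring,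
      show (s : ℂ) * (-ψ + Real.pi - -ψ) * Complex.I = (Real.pi * s) * Complex.I by ring]
    ring_nf
    rw [Complex.I_sq]
    ring
  have hpi' : (Real.pi : ℂ) ≠ 0 := by exact_mod_cast hpi.ne'
  rw [div_eq_mul_inv, hG]
  push_cast at h3 ⊢
  rw [← sub_mul, ← sub_mul, h3]
  field_simp

/-! ### The normalised integrand and its asymptotics along one leg. -/

/-- The integrand `f e^{v (T - T(0))} e^{N (v (G - b) - ζ)}` of the coefficient integral, normalised
at the boundary point `0` of the exponential coordinate. -/
noncomputable def kern (f T G : ℂ → ℂ) (b : ℂ) (N : ℕ) (v : ℝ) (ζ : ℂ) : ℂ :=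
  f ζ * Complex.exp (v * (T ζ - T 0)) * Complex.exp (N * (v * (G ζ - b) - ζ))

/-- The difference is split into a perturbation `f - p` of the prefactor and a perturbation `G - Q`
of the exponent; each produces one of the two terms of the limit. -/
theorem kern_sub (f p T G Q : ℂ → ℂ) (b : ℂ) (N : ℕ) (v : ℝ) (ζ : ℂ) :
    kern f T G b N v ζ - kern p T Q b N v ζ =
      Complex.exp (v * (T ζ - T 0)) * Complex.exp (N * (v * (Q ζ - b) - ζ)) *
        ((f ζ - p ζ) * Complex.exp (N * (v * (G ζ - Q ζ))) +
          p ζ * (Complex.exp (N * (v * (G ζ - Q ζ))) - 1)) := by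
  have : Complex.exp (N * (v * (G ζ - b) - ζ)) =
      Complex.exp (N * (v * (Q ζ - b) - ζ)) * Complex.exp (N * (v * (G ζ - Q ζ))) := by
    rw [← Complex.exp_add]; ring_nf
  rw [kern, kern, this]
  ring

/-- Stretching the leg by `N` costs one power of `N` as Jacobian and puts all the integrals on a
fixed half line, ready for dominated convergence. -/
theorem rpow_mul_segInt (h : ℂ → ℂ) (e : ℂ) {L : ℝ} (hL : 0 < L) (q : ℝ) {N : ℕ} (hN : 0 < N) :
    (((N : ℝ) ^ q : ℝ) : ℂ) * segInt h 0 (L * e) =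
      ∫ t in Set.Ioi (0 : ℝ), (Set.Ioc 0 (L * N)).indicator
        (fun t : ℝ => (((N : ℝ) ^ (q - 1) : ℝ) : ℂ) * h (((t / N : ℝ) : ℂ) * e) * e) t := by
  have hN' : (0 : ℝ) < N := by exact_mod_cast hN
  have hLN : 0 < L * N := by positivity
  have h1 := intervalIntegral.smul_integral_comp_mul_left (a := 0) (b := 1)
    (fun t : ℝ => (((N : ℝ) ^ (q - 1) : ℝ) : ℂ) * h (((t / N : ℝ) : ℂ) * e) * e) (L * N)
  rw [mul_zero, mul_one, intervalIntegral.integral_of_le hLN.le] at h1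
  rw [setIntegral_indicator measurableSet_Ioc, Set.inter_eq_self_of_subset_right
    Set.Ioc_subset_Ioi_self, ← h1, segInt, ← intervalIntegral.integral_const_mul,
    ← intervalIntegral.integral_smul]
  congr 1
  ext t
  have h2 : (0 : ℂ) + t * (L * e - 0) = ((L * N * t / N : ℝ) : ℂ) * e := by
    rw [show L * N * t / N = L * t by field_simp]
    push_cast
    ring
  rw [h2, Complex.real_smul, Real.rpow_sub_one hN'.ne']
  have : (N : ℂ) ≠ 0 := by exact_mod_cast hN.ne'
  push_cast
  field_simp
  ring

theorem integrableOn_ray {s d : ℝ} {e : ℂ} (hs : -1 < s) (hd : 0 < d) (he : 0 < e.re) :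
    IntegrableOn (fun t : ℝ => e * ((-e) ^ (s : ℂ) * ((t ^ s : ℝ) : ℂ)) *
      Complex.exp (-((d * e) * t))) (Set.Ioi 0) := by
  have hre : 0 < ((d : ℂ) * e).re := by rw [Complex.re_ofReal_mul]; positivity
  have : IntegrableOn (fun t : ℝ => ((t ^ s : ℝ) : ℂ) * Complex.exp (-((d * e) * t)))
      (Set.Ioi 0) := by
    refine Integrable.mono' (integrableOn_rpow_mul_exp hs hre)
      ((continuousOn_rpow_mul_exp s _).aestronglyMeasurable measurableSet_Ioi) ?_
    refine (ae_restrict_iff' measurableSet_Ioi).2 (ae_of_all _ fun t ht => ?_)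
    exact (norm_rpow_mul_exp _ ht).le
  refine (this.const_mul (e * (-e) ^ (s : ℂ))).congr (ae_of_all _ fun t => ?_)
  ring

theorem norm_exp_sub_one_le_norm_mul_exp (z : ℂ) :
    ‖Complex.exp z - 1‖ ≤ ‖z‖ * Real.exp ‖z‖ := by
  simpa using Complex.norm_exp_sub_sum_le_norm_mul_exp z 1

section Leg

variable {ι : Type*} {l : Filter ι} {N : ι → ℕ} {v : ι → ℝ} {vs v₂ L M κ q b₁ : ℝ}
  {a₁ c₁ : ℂ} {e : ℂ} {f p T G Q : ℂ → ℂ}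

theorem tendsto_div_natCast_nhdsGT (hN : Tendsto N l atTop) {t : ℝ} (ht : 0 < t) :
    Tendsto (fun i => t / (N i : ℝ)) l (𝓝[>] 0) := by
  refine tendsto_nhdsWithin_iff.2 ⟨?_, ?_⟩
  · exact (tendsto_natCast_atTop_atTop.comp hN).const_div_atTop t
  · filter_upwards [hN.eventually_gt_atTop 0] with i hi
    have : (0 : ℝ) < N i := by exact_mod_cast hi
    exact div_pos ht this

theorem tendsto_rpow_mul_of_tendsto_div {g : ℝ → ℂ} {r : ℝ} {A : ℂ} (hN : Tendsto N l atTop)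
    (hg : Tendsto (fun t : ℝ => g t / ((t ^ r : ℝ) : ℂ)) (𝓝[>] 0) (𝓝 A)) {t : ℝ} (ht : 0 < t) :
    Tendsto (fun i => (((N i : ℝ) ^ r : ℝ) : ℂ) * g (t / N i)) l (𝓝 (A * ((t ^ r : ℝ) : ℂ))) := by
  have h1 := (hg.comp (tendsto_div_natCast_nhdsGT hN ht)).mul_const ((t ^ r : ℝ) : ℂ)
  refine h1.congr' ?_
  filter_upwards [hN.eventually_gt_atTop 0] with i hi
  have hi' : (0 : ℝ) < N i := by exact_mod_cast hi
  have h2 : ((N i : ℝ) ^ r : ℝ) ≠ 0 := (Real.rpow_pos_of_pos hi' r).ne'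
  have h3 : (t ^ r : ℝ) ≠ 0 := (Real.rpow_pos_of_pos ht r).ne'
  have h2' : (((N i : ℝ) ^ r : ℝ) : ℂ) ≠ 0 := by exact_mod_cast h2
  have h3' : ((t ^ r : ℝ) : ℂ) ≠ 0 := by exact_mod_cast h3
  simp only [Function.comp]
  rw [Real.div_rpow ht.le hi'.le]
  push_cast
  field_simp

/-- Pointwise limit of the rescaled difference of integrands on a leg. -/
theorem tendsto_kern_sub_pointwise (hN : Tendsto N l atTop) (hv : Tendsto v l (𝓝 vs)) (hq : 1 < q)
    (hfp : Tendsto (fun t : ℝ => (f (t * e) - p (t * e)) / ((t ^ (q - 1) : ℝ) : ℂ)) (𝓝[>] 0)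
      (𝓝 (c₁ * (-e) ^ ((q - 1 : ℝ) : ℂ))))
    (hGQ : Tendsto (fun t : ℝ => (G (t * e) - Q (t * e)) / ((t ^ q : ℝ) : ℂ)) (𝓝[>] 0)
      (𝓝 (a₁ * (-e) ^ (q : ℂ))))
    (hT : Tendsto (fun t : ℝ => T (t * e)) (𝓝[>] 0) (𝓝 (T 0)))
    (hp : Tendsto (fun t : ℝ => p (t * e)) (𝓝[>] 0) (𝓝 1))
    (hQ : HasDerivAt Q b₁ 0) {t : ℝ} (ht : 0 < t) :
    Tendsto (fun i => (((N i : ℝ) ^ (q - 1) : ℝ) : ℂ) *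
        (kern f T G (Q 0) (N i) (v i) (((t / N i : ℝ) : ℂ) * e) -
          kern p T Q (Q 0) (N i) (v i) (((t / N i : ℝ) : ℂ) * e)) * e) l
      (𝓝 (c₁ * (e * ((-e) ^ ((q - 1 : ℝ) : ℂ) * ((t ^ (q - 1) : ℝ) : ℂ)) *
          Complex.exp (-((((1 - vs * b₁ : ℝ) : ℂ) * e) * t))) +
        vs * a₁ * (e * ((-e) ^ (q : ℂ) * ((t ^ q : ℝ) : ℂ)) *
          Complex.exp (-((((1 - vs * b₁ : ℝ) : ℂ) * e) * t))))) := by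
  have hx := tendsto_div_natCast_nhdsGT hN ht
  have hvC : Tendsto (fun i => (v i : ℂ)) l (𝓝 vs) :=
    (Complex.continuous_ofReal.tendsto vs).comp hv
  have l1 : Tendsto (fun i => Complex.exp (v i * (T (((t / N i : ℝ) : ℂ) * e) - T 0))) l
      (𝓝 1) := by
    have h := hvC.mul ((hT.comp hx).sub_const (T 0))
    rw [sub_self, mul_zero] at h
    simpa using h.cexp
  have hx' : Tendsto (fun i => (((t / N i : ℝ) : ℂ) * e)) l (𝓝 0) := by
    have h1 : Tendsto (fun i => t / (N i : ℝ)) l (𝓝 0) := hx.mono_right nhdsWithin_le_nhds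
    have h2 := ((Complex.continuous_ofReal.tendsto 0).comp h1).mul_const e
    simpa using h2
  have hNQ : Tendsto (fun i => (N i : ℂ) * (Q (((t / N i : ℝ) : ℂ) * e) - Q 0)) l
      (𝓝 (b₁ * (t * e))) := by
    -- The slope `dslope` is continuous at `0`, which replaces a difference quotient without
    -- requiring a nonzero displacement.
    have h1 : Tendsto (fun i => dslope Q 0 (((t / N i : ℝ) : ℂ) * e)) l (𝓝 b₁) := by
      have h := (continuousAt_dslope_same.2 hQ.differentiableAt).tendsto.comp hx'
      rwa [dslope_same, hQ.deriv] at h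
    refine (h1.mul_const (t * e)).congr' ?_
    filter_upwards [hN.eventually_gt_atTop 0] with i hi
    have hi' : (N i : ℂ) ≠ 0 := by exact_mod_cast hi.ne'
    have h2 := sub_smul_dslope Q 0 (((t / N i : ℝ) : ℂ) * e)
    rw [sub_zero, smul_eq_mul] at h2
    rw [← h2]
    push_cast
    field_simp
  have l2 : Tendsto (fun i => Complex.exp (N i * (v i * (Q (((t / N i : ℝ) : ℂ) * e) - Q 0) -
      ((t / N i : ℝ) : ℂ) * e))) l (𝓝 (Complex.exp (-((((1 - vs * b₁ : ℝ) : ℂ) * e) * t)))) := by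
    have h := (hvC.mul hNQ).sub_const (t * e)
    rw [show (vs : ℂ) * (b₁ * (t * e)) - t * e = -((((1 - vs * b₁ : ℝ) : ℂ) * e) * t) by
      push_cast; ring] at h
    refine (h.cexp).congr' ?_
    filter_upwards [hN.eventually_gt_atTop 0] with i hi
    have hi' : (N i : ℂ) ≠ 0 := by exact_mod_cast hi.ne'
    congr 1
    push_cast
    field_simp
  have lE := tendsto_rpow_mul_of_tendsto_div (g := fun t => G (t * e) - Q (t * e)) hN hGQ ht
  -- `N (G - Q)` is `N^(1-q)` times a convergent quantity, and `q > 1`.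
  have lNE : Tendsto (fun i => (N i : ℂ) * (v i * (G (((t / N i : ℝ) : ℂ) * e) -
      Q (((t / N i : ℝ) : ℂ) * e)))) l (𝓝 0) := by
    have h1 : Tendsto (fun i => (((N i : ℝ) ^ (-(q - 1)) : ℝ) : ℂ)) l (𝓝 0) := by
      have := (tendsto_rpow_neg_atTop (by linarith : 0 < q - 1)).comp
        (tendsto_natCast_atTop_atTop.comp hN)
      simpa [Function.comp_def] using (Complex.continuous_ofReal.tendsto 0).comp this
    have h2 := (h1.mul (hvC.mul lE))
    rw [zero_mul] at h2
    refine h2.congr' ?_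
    filter_upwards [hN.eventually_gt_atTop 0] with i hi
    have hi' : (0 : ℝ) < N i := by exact_mod_cast hi
    have h3 : (((N i : ℝ) ^ (-(q - 1)) : ℝ) : ℂ) * (((N i : ℝ) ^ q : ℝ) : ℂ) = N i := by
      rw [← Complex.ofReal_mul, ← Real.rpow_add hi']
      simp
    linear_combination (v i * (G (((t / N i : ℝ) : ℂ) * e) - Q (((t / N i : ℝ) : ℂ) * e))) * h3
  have l3 : Tendsto (fun i => Complex.exp ((N i : ℂ) * (v i * (G (((t / N i : ℝ) : ℂ) * e) -
      Q (((t / N i : ℝ) : ℂ) * e))))) l (𝓝 1) := by simpa using lNE.cexp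
  -- Since `e^w - 1` behaves like `w`, the factor `N` inside `w` completes `N^(q-1)` to `N^q`, the
  -- scale on which `G - Q` has a limit.
  have l4 : Tendsto (fun i => (((N i : ℝ) ^ (q - 1) : ℝ) : ℂ) *
      (Complex.exp ((N i : ℂ) * (v i * (G (((t / N i : ℝ) : ℂ) * e) -
      Q (((t / N i : ℝ) : ℂ) * e)))) - 1)) l (𝓝 (vs * (a₁ * (-e) ^ (q : ℂ) * ((t ^ q : ℝ) : ℂ)))) := by
    have h1 := (continuousAt_dslope_same.2
      (Complex.differentiableAt_exp (x := 0))).tendsto.comp lNE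
    rw [dslope_same, Complex.deriv_exp, Complex.exp_zero] at h1
    have h2 := (hvC.mul lE).mul h1
    rw [mul_one] at h2
    refine h2.congr' ?_
    filter_upwards [hN.eventually_gt_atTop 0] with i hi
    have hi' : (0 : ℝ) < N i := by exact_mod_cast hi
    have h3 := sub_smul_dslope Complex.exp 0 ((N i : ℂ) * (v i * (G (((t / N i : ℝ) : ℂ) * e) -
      Q (((t / N i : ℝ) : ℂ) * e))))
    rw [sub_zero, smul_eq_mul, Complex.exp_zero] at h3
    have h4 : (((N i : ℝ) ^ q : ℝ) : ℂ) = (((N i : ℝ) ^ (q - 1) : ℝ) : ℂ) * N i := by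
      rw [Real.rpow_sub_one hi'.ne']
      have : (N i : ℂ) ≠ 0 := by exact_mod_cast hi.ne'
      push_cast
      field_simp
    simp only [Function.comp]
    rw [← h3, h4]
    ring
  have lf := tendsto_rpow_mul_of_tendsto_div (g := fun t => f (t * e) - p (t * e)) hN hfp ht
  have lp := hp.comp hx
  have total := ((l1.mul l2).mul ((lf.mul l3).add (lp.mul l4))).mul_const e
  refine (total.congr fun i => ?_).trans_eq ?_
  · rw [kern_sub]
    simp only [Function.comp]
    ring
  · congr 1
    ring

/-- Asymptotics of the integral along one leg, by dominated convergence. -/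
theorem tendsto_leg [l.IsCountablyGenerated] (hN : Tendsto N l atTop) (hv : Tendsto v l (𝓝 vs))
    (hv₂ : ∀ᶠ i in l, v i ∈ Set.Icc 0 v₂) (hq : 1 < q) (hL : 0 < L) (hκ : 0 < κ)
    (hM : 0 ≤ M) (he1 : ‖e‖ = 1) (he : 0 < e.re) (hd : 0 < 1 - vs * b₁)
    (hcf : ContinuousOn (fun t : ℝ => f (t * e)) (Set.Ioc 0 L))
    (hcp : ContinuousOn (fun t : ℝ => p (t * e)) (Set.Ioc 0 L))
    (hcT : ContinuousOn (fun t : ℝ => T (t * e)) (Set.Ioc 0 L))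
    (hcG : ContinuousOn (fun t : ℝ => G (t * e)) (Set.Ioc 0 L))
    (hcQ : ContinuousOn (fun t : ℝ => Q (t * e)) (Set.Ioc 0 L))
    (hfpM : ∀ t ∈ Set.Ioc 0 L, ‖f (t * e) - p (t * e)‖ ≤ M * t ^ (q - 1))
    (hGQM : ∀ t ∈ Set.Ioc 0 L, ‖G (t * e) - Q (t * e)‖ ≤ M * t ^ q)
    (hTM : ∀ t ∈ Set.Ioc 0 L, ‖T (t * e) - T 0‖ ≤ M)
    (hpM : ∀ t ∈ Set.Ioc 0 L, ‖p (t * e)‖ ≤ M)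
    (hexp : ∀ᶠ i in l, ∀ t ∈ Set.Ioc 0 L, (v i * (Q (t * e) - Q 0) - t * e).re +
      v i * ‖G (t * e) - Q (t * e)‖ ≤ -(κ * t))
    (hfp : Tendsto (fun t : ℝ => (f (t * e) - p (t * e)) / ((t ^ (q - 1) : ℝ) : ℂ)) (𝓝[>] 0)
      (𝓝 (c₁ * (-e) ^ ((q - 1 : ℝ) : ℂ))))
    (hGQ : Tendsto (fun t : ℝ => (G (t * e) - Q (t * e)) / ((t ^ q : ℝ) : ℂ)) (𝓝[>] 0)
      (𝓝 (a₁ * (-e) ^ (q : ℂ))))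
    (hT : Tendsto (fun t : ℝ => T (t * e)) (𝓝[>] 0) (𝓝 (T 0)))
    (hp : Tendsto (fun t : ℝ => p (t * e)) (𝓝[>] 0) (𝓝 1))
    (hQ : HasDerivAt Q b₁ 0) :
    Tendsto (fun i => (((N i : ℝ) ^ q : ℝ) : ℂ) *
        segInt (fun ζ => kern f T G (Q 0) (N i) (v i) ζ - kern p T Q (Q 0) (N i) (v i) ζ) 0
          (L * e)) l
      (𝓝 (c₁ * rayIntegral (q - 1) (1 - vs * b₁) e +
        vs * a₁ * rayIntegral q (1 - vs * b₁) e)) := by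
  have hlimint : c₁ * rayIntegral (q - 1) (1 - vs * b₁) e +
      vs * a₁ * rayIntegral q (1 - vs * b₁) e = ∫ t in Set.Ioi (0 : ℝ),
        (c₁ * (e * ((-e) ^ ((q - 1 : ℝ) : ℂ) * ((t ^ (q - 1) : ℝ) : ℂ)) *
          Complex.exp (-((((1 - vs * b₁ : ℝ) : ℂ) * e) * t))) +
        vs * a₁ * (e * ((-e) ^ (q : ℂ) * ((t ^ q : ℝ) : ℂ)) *
          Complex.exp (-((((1 - vs * b₁ : ℝ) : ℂ) * e) * t)))) := by
    rw [integral_add, integral_const_mul, integral_const_mul, rayIntegral, rayIntegral]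
    · exact (integrableOn_ray (by linarith) hd he).const_mul _
    · exact (integrableOn_ray (by linarith) hd he).const_mul _
  rw [hlimint]
  set S : ι → ℝ → ℂ := fun i => (Set.Ioc 0 (L * N i)).indicator (fun t : ℝ =>
    (((N i : ℝ) ^ (q - 1) : ℝ) : ℂ) *
      (kern f T G (Q 0) (N i) (v i) (((t / N i : ℝ) : ℂ) * e) -
        kern p T Q (Q 0) (N i) (v i) (((t / N i : ℝ) : ℂ) * e)) * e) with hS
  have hmain : Tendsto (fun i => ∫ t in Set.Ioi (0 : ℝ), S i t) l (𝓝 (∫ t in Set.Ioi (0 : ℝ),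
        (c₁ * (e * ((-e) ^ ((q - 1 : ℝ) : ℂ) * ((t ^ (q - 1) : ℝ) : ℂ)) *
          Complex.exp (-((((1 - vs * b₁ : ℝ) : ℂ) * e) * t))) +
        vs * a₁ * (e * ((-e) ^ (q : ℂ) * ((t ^ q : ℝ) : ℂ)) *
          Complex.exp (-((((1 - vs * b₁ : ℝ) : ℂ) * e) * t)))))) := by
    -- The two powers of `t` come from `f - p` and from `G - Q`. By `hexp` the decay `e^{-κt}`
    -- remains after the growth `e^{N v ‖G - Q‖}` has been absorbed.
    refine tendsto_integral_filter_of_dominated_convergence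
      (fun t => Real.exp (v₂ * M) * M * (t ^ (q - 1) * Real.exp (-(κ * t))) +
        Real.exp (v₂ * M) * (M * v₂ * M) * (t ^ q * Real.exp (-(κ * t)))) ?_ ?_ ?_ ?_
    · filter_upwards [hN.eventually_gt_atTop 0] with i hi
      have hi' : (0 : ℝ) < N i := by exact_mod_cast hi
      have hmaps : Set.MapsTo (fun t : ℝ => t / N i) (Set.Ioc 0 (L * N i)) (Set.Ioc 0 L) :=
        fun t ht => ⟨div_pos ht.1 hi', (div_le_iff₀ hi').2 ht.2⟩
      have hdc : ContinuousOn (fun t : ℝ => t / (N i : ℝ)) (Set.Ioc 0 (L * N i)) := by fun_prop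
      have cf := hcf.comp hdc hmaps
      have cp := hcp.comp hdc hmaps
      have cT := hcT.comp hdc hmaps
      have cG := hcG.comp hdc hmaps
      have cQ := hcQ.comp hdc hmaps
      simp only [Function.comp_def] at cf cp cT cG cQ
      have hcz : ContinuousOn (fun t : ℝ => ((t / N i : ℝ) : ℂ) * e) (Set.Ioc 0 (L * N i)) := by
        fun_prop
      have hcont : ContinuousOn (fun t : ℝ => (((N i : ℝ) ^ (q - 1) : ℝ) : ℂ) *
          (kern f T G (Q 0) (N i) (v i) (((t / N i : ℝ) : ℂ) * e) -
            kern p T Q (Q 0) (N i) (v i) (((t / N i : ℝ) : ℂ) * e)) * e)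
          (Set.Ioc 0 (L * N i)) := by
        have hk {f G : ℂ → ℂ} {b : ℂ}
            (cf : ContinuousOn (fun t : ℝ => f (((t / N i : ℝ) : ℂ) * e)) (Set.Ioc 0 (L * N i)))
            (cG : ContinuousOn (fun t : ℝ => G (((t / N i : ℝ) : ℂ) * e)) (Set.Ioc 0 (L * N i))) :
            ContinuousOn (fun t : ℝ => kern f T G b (N i) (v i) (((t / N i : ℝ) : ℂ) * e))
              (Set.Ioc 0 (L * N i)) :=
          (cf.mul (continuousOn_const.mul (cT.sub continuousOn_const)).cexp).mul
            (continuousOn_const.mul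
              ((continuousOn_const.mul (cG.sub continuousOn_const)).sub hcz)).cexp
        exact (continuousOn_const.mul ((hk cf cG).sub (hk cp cQ))).mul continuousOn_const
      exact (aestronglyMeasurable_indicator_iff measurableSet_Ioc).2
        ((hcont.aestronglyMeasurable (μ := volume) measurableSet_Ioc).mono_measure
          (Measure.restrict_mono le_rfl Measure.restrict_le_self))
    · filter_upwards [hN.eventually_gt_atTop 0, hv₂, hexp] with i hi hvi hexi
      have hi' : (0 : ℝ) < N i := by exact_mod_cast hi
      refine (ae_restrict_iff' measurableSet_Ioi).2 (ae_of_all _ fun t ht => ?_)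
      have ht : 0 < t := ht
      have hv₂0 : 0 ≤ v₂ := hvi.1.trans hvi.2
      by_cases htL : t ∈ Set.Ioc 0 (L * N i)
      swap
      · rw [hS]
        simp only [Set.indicator_of_notMem htL, norm_zero]
        positivity
      rw [hS]
      simp only [Set.indicator_of_mem htL]
      rw [kern_sub]
      set x : ℝ := t / N i with hx
      have hxm : x ∈ Set.Ioc 0 L := ⟨div_pos ht hi', (div_le_iff₀ hi').2 htL.2⟩
      have hNx : (N i : ℝ) * x = t := by rw [hx]; field_simp
      set E := G (x * e) - Q (x * e) with hE
      have h1 : ‖Complex.exp (v i * (T (x * e) - T 0))‖ ≤ Real.exp (v₂ * M) := by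
        refine (Complex.norm_exp_le_exp_norm _).trans (Real.exp_le_exp.2 ?_)
        rw [norm_mul, Complex.norm_real, Real.norm_of_nonneg hvi.1]
        exact mul_le_mul hvi.2 (hTM x hxm) (norm_nonneg _) hv₂0
      have h2 : ‖Complex.exp (N i * (v i * (Q (x * e) - Q 0) - x * e))‖ *
          Real.exp (N i * (v i * ‖E‖)) ≤ Real.exp (-(κ * t)) := by
        rw [Complex.norm_exp, ← Real.exp_add]
        refine Real.exp_le_exp.2 ?_
        have h := mul_le_mul_of_nonneg_left (hexi x hxm) hi'.le
        have h' : ((N i : ℂ) * (v i * (Q (x * e) - Q 0) - x * e)).re =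
            N i * (v i * (Q (x * e) - Q 0) - x * e).re := by
          rw [← Complex.ofReal_natCast, Complex.re_ofReal_mul]
        rw [h', ← mul_add]
        refine h.trans_eq ?_
        rw [← hNx]; ring
      have hnE : ‖(N i : ℂ) * (v i * E)‖ = N i * (v i * ‖E‖) := by
        rw [norm_mul, norm_mul, Complex.norm_natCast, Complex.norm_real,
          Real.norm_of_nonneg hvi.1]
      have h3 : ‖Complex.exp ((N i : ℂ) * (v i * E))‖ ≤ Real.exp (N i * (v i * ‖E‖)) := by
        rw [← hnE]; exact Complex.norm_exp_le_exp_norm _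
      have h4 : ‖Complex.exp ((N i : ℂ) * (v i * E)) - 1‖ ≤
          N i * (v i * ‖E‖) * Real.exp (N i * (v i * ‖E‖)) := by
        rw [← hnE]; exact norm_exp_sub_one_le_norm_mul_exp _
      have hNq : (N i : ℝ) ^ (q - 1) * x ^ (q - 1) = t ^ (q - 1) := by
        rw [← Real.mul_rpow hi'.le hxm.1.le, hNx]
      have hNq' : (N i : ℝ) ^ (q - 1) * (N i * x ^ q) = t ^ q := by
        have : (N i : ℝ) ^ (q - 1) * N i = (N i : ℝ) ^ q := by
          rw [Real.rpow_sub_one hi'.ne']; field_simp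
        rw [← mul_assoc, this, ← Real.mul_rpow hi'.le hxm.1.le, hNx]
      rw [norm_mul, he1, mul_one, norm_mul, Complex.norm_real,
        Real.norm_of_nonneg (by positivity), norm_mul, norm_mul]
      set X := ‖Complex.exp (N i * (v i * (Q (x * e) - Q 0) - x * e))‖
      set Y := Real.exp (N i * (v i * ‖E‖))
      have hX : 0 ≤ X := norm_nonneg _
      have hY : 0 ≤ Y := (Real.exp_pos _).le
      have h5 : ‖(f (x * e) - p (x * e)) * Complex.exp (N i * (v i * E)) +
          p (x * e) * (Complex.exp (N i * (v i * E)) - 1)‖ ≤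
          M * x ^ (q - 1) * Y + M * (N i * (v₂ * (M * x ^ q)) * Y) := by
        refine (norm_add_le _ _).trans ?_
        rw [norm_mul, norm_mul]
        have := hfpM x hxm
        have := hpM x hxm
        have := hGQM x hxm
        have hx0 : 0 ≤ x ^ q := Real.rpow_nonneg hxm.1.le _
        have hx1 : 0 ≤ x ^ (q - 1) := Real.rpow_nonneg hxm.1.le _
        have hvE : v i * ‖E‖ ≤ v₂ * (M * x ^ q) :=
          mul_le_mul hvi.2 (hGQM x hxm) (norm_nonneg _) hv₂0
        have h4' : ‖Complex.exp ((N i : ℂ) * (v i * E)) - 1‖ ≤ N i * (v₂ * (M * x ^ q)) * Y :=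
          h4.trans (by gcongr)
        gcongr
      calc _ ≤ (N i : ℝ) ^ (q - 1) * (Real.exp (v₂ * M) * X *
            (M * x ^ (q - 1) * Y + M * (N i * (v₂ * (M * x ^ q)) * Y))) := by gcongr
        _ = Real.exp (v₂ * M) * M * (((N i : ℝ) ^ (q - 1) * x ^ (q - 1)) * (X * Y)) +
            Real.exp (v₂ * M) * (M * v₂ * M) * (((N i : ℝ) ^ (q - 1) * (N i * x ^ q)) * (X * Y)) := by
          ring
        _ ≤ _ := by
          rw [hNq, hNq']
          gcongr
    · exact ((integrableOn_rpow_mul_exp (by linarith) hκ).const_mul _).add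
        ((integrableOn_rpow_mul_exp (by linarith) hκ).const_mul _)
    · refine (ae_restrict_iff' measurableSet_Ioi).2 (ae_of_all _ fun t ht => ?_)
      refine (tendsto_kern_sub_pointwise hN hv hq hfp hGQ hT hp hQ ht).congr' ?_
      have hbig : Tendsto (fun i => L * (N i : ℝ)) l atTop :=
        (tendsto_natCast_atTop_atTop.comp hN).const_mul_atTop hL
      filter_upwards [hbig.eventually_ge_atTop t] with i hi
      simp only [hS]
      rw [Set.indicator_of_mem (show t ∈ Set.Ioc 0 (L * (N i : ℝ)) from ⟨ht, hi⟩)]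
  refine hmain.congr' ?_
  filter_upwards [hN.eventually_gt_atTop 0] with i hi
  rw [rpow_mul_segInt _ e hL q hi]

end Leg

/-! ### Local data at the singularity and their quantitative consequences. -/

/-- The open wedge of all `ζ` with `|arg ζ| > φ`. -/
def wedge (φ : ℝ) : Set ℂ := {ζ | ζ.re < ‖ζ‖ * Real.cos φ}

theorem mem_wedge_of_lt {φ : ℝ} (hφ : 0 < φ) (hφ' : φ < Real.pi / 2) {ζ : ℂ}
    (h : ζ.re * Real.sin φ < |ζ.im| * Real.cos φ) : ζ ∈ wedge φ := by
  have hc : 0 < Real.cos φ := Real.cos_pos_of_mem_Ioo ⟨by linarith, hφ'⟩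
  have hs : 0 < Real.sin φ := Real.sin_pos_of_pos_of_lt_pi hφ (by linarith [Real.pi_pos])
  change ζ.re < ‖ζ‖ * Real.cos φ
  rcases lt_or_ge ζ.re 0 with h0 | h0
  · exact h0.trans_le (by positivity)
  · refine lt_of_pow_lt_pow_left₀ 2 (by positivity) ?_
    rw [mul_pow, Complex.sq_norm, Complex.normSq_apply]
    have h1 : (ζ.re * Real.sin φ) ^ 2 < (|ζ.im| * Real.cos φ) ^ 2 := by
      gcongr
    rw [mul_pow, mul_pow, sq_abs] at h1
    have := Real.sin_sq_add_cos_sq φ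
    nlinarith

/-- The hypotheses of the local analysis, in the exponential coordinate `z = R e^ζ`. -/
structure LocalData (f T G p Q : ℂ → ℂ) (D : Set ℂ) (φ r₀ b₀ b₁ q : ℝ) (a₁ c₁ : ℂ) : Prop where
  angle_pos : 0 < φ
  angle_lt : φ < Real.pi / 2
  radius_pos : 0 < r₀
  one_lt : 1 < q
  isOpen : IsOpen D
  left_subset : {ζ : ℂ | ζ.re < 0} ⊆ D
  wedge_subset : ∀ ζ ∈ wedge φ, ‖ζ‖ < r₀ → ζ ∈ D
  -- The bound `7 / 2` lies strictly between `π` and `2π`: it leaves room beyond the heights `±π`,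
  -- while `0` remains the only excluded preimage of `R` on this part of the axis.
  axis_mem : ∀ y : ℝ, y ≠ 0 → |y| ≤ 7 / 2 → y * Complex.I ∈ D
  axis_lt : ∀ y : ℝ, y ≠ 0 → |y| ≤ 7 / 2 → (G (y * Complex.I)).re < b₀
  f_diff : DifferentiableOn ℂ f D
  T_diff : DifferentiableOn ℂ T D
  G_diff : DifferentiableOn ℂ G D
  p_diff : DifferentiableOn ℂ p (Metric.ball 0 r₀)
  T_diff' : DifferentiableOn ℂ T (Metric.ball 0 r₀)
  Q_diff : DifferentiableOn ℂ Q (Metric.ball 0 r₀)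
  p_zero : p 0 = 1
  Q_zero : Q 0 = b₀
  Q_deriv : HasDerivAt Q b₁ 0
  f_exp : (fun ζ => f ζ - p ζ - c₁ * (1 - Complex.exp ζ) ^ ((q - 1 : ℝ) : ℂ))
    =o[𝓝[wedge φ] 0] fun ζ => ‖ζ‖ ^ (q - 1)
  G_exp : (fun ζ => G ζ - Q ζ - a₁ * (1 - Complex.exp ζ) ^ (q : ℂ))
    =o[𝓝[wedge φ] 0] fun ζ => ‖ζ‖ ^ q

theorem isBigO_one_sub_exp_cpow (s : ℝ) (hs : 0 ≤ s) :
    (fun ζ => (1 - Complex.exp ζ) ^ (s : ℂ)) =O[𝓝 0] fun ζ : ℂ => ‖ζ‖ ^ s := by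
  refine IsBigO.of_bound (2 ^ s) ?_
  filter_upwards [Metric.closedBall_mem_nhds (0 : ℂ) one_pos] with ζ hζ
  rw [mem_closedBall_zero_iff] at hζ
  rw [Complex.norm_cpow_real, norm_sub_rev, Real.norm_of_nonneg (by positivity),
    ← Real.mul_rpow (by norm_num) (norm_nonneg _)]
  gcongr
  exact Complex.norm_exp_sub_one_le hζ

/-- `(1 - e^{te}) / t` tends to `-e`, a point of continuity of the power, and the positive factor
`t` can be taken out of the power. -/
theorem tendsto_one_sub_exp_cpow_ray {e : ℂ} (he : -e ∈ Complex.slitPlane) (s : ℝ) :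
    Tendsto (fun t : ℝ => (1 - Complex.exp (t * e)) ^ (s : ℂ) / ((t ^ s : ℝ) : ℂ)) (𝓝[>] 0)
      (𝓝 ((-e) ^ (s : ℂ))) := by
  have h1 : Tendsto (fun t : ℝ => -(dslope Complex.exp 0 (t * e) * e)) (𝓝[>] 0) (𝓝 (-e)) := by
    have h0 : Tendsto (fun t : ℝ => (t : ℂ) * e) (𝓝[>] 0) (𝓝 0) := by
      have : Continuous fun t : ℝ => (t : ℂ) * e := by fun_prop
      have h := this.tendsto 0
      simp only [Complex.ofReal_zero, zero_mul] at h
      exact h.mono_left nhdsWithin_le_nhds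
    have h := (continuousAt_dslope_same.2
      (Complex.differentiableAt_exp (x := 0))).tendsto.comp h0
    rw [dslope_same, Complex.deriv_exp, Complex.exp_zero] at h
    simpa using (h.mul_const e).neg
  have h2 := (continuousAt_cpow_const he (b := (s : ℂ))).tendsto.comp h1
  have h3 : ∀ᶠ t : ℝ in 𝓝[>] 0, -(dslope Complex.exp 0 (t * e) * e) ≠ 0 := by
    have he0 : -e ≠ 0 := Complex.slitPlane_ne_zero he
    exact h1.eventually_ne he0
  refine h2.congr' ?_
  filter_upwards [self_mem_nhdsWithin, h3] with t ht hne
  have ht : 0 < t := ht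
  have h4 := sub_smul_dslope Complex.exp 0 ((t : ℂ) * e)
  rw [sub_zero, smul_eq_mul, Complex.exp_zero] at h4
  have h5 : 1 - Complex.exp (t * e) = t * (-(dslope Complex.exp 0 (t * e) * e)) := by
    linear_combination h4
  have h6 : ((t ^ s : ℝ) : ℂ) ≠ 0 := by exact_mod_cast (Real.rpow_pos_of_pos ht s).ne'
  simp only [Function.comp]
  rw [h5, ofReal_mul_cpow ht hne, Complex.ofReal_cpow ht.le] at *
  rw [mul_div_cancel_left₀ _ h6]

theorem tendsto_ray_of_isLittleO {g : ℂ → ℂ} {φ s : ℝ} {e c : ℂ} (he1 : ‖e‖ = 1)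
    (hew : e.re < Real.cos φ) (he : -e ∈ Complex.slitPlane)
    (hg : (fun ζ => g ζ - c * (1 - Complex.exp ζ) ^ (s : ℂ))
      =o[𝓝[wedge φ] 0] fun ζ => ‖ζ‖ ^ s) :
    Tendsto (fun t : ℝ => g (t * e) / ((t ^ s : ℝ) : ℂ)) (𝓝[>] 0) (𝓝 (c * (-e) ^ (s : ℂ))) := by
  have h0 : Tendsto (fun t : ℝ => (t : ℂ) * e) (𝓝[>] 0) (𝓝[wedge φ] 0) := by
    refine tendsto_nhdsWithin_iff.2 ⟨?_, ?_⟩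
    · have : Continuous fun t : ℝ => (t : ℂ) * e := by fun_prop
      have h := this.tendsto 0
      simp only [Complex.ofReal_zero, zero_mul] at h
      exact h.mono_left nhdsWithin_le_nhds
    · filter_upwards [self_mem_nhdsWithin] with t ht
      have ht : 0 < t := ht
      rw [wedge, Set.mem_ofPred_eq, Complex.re_ofReal_mul, norm_mul, he1, Complex.norm_real,
        Real.norm_of_nonneg ht.le, mul_one]
      gcongr
  have h1 := (hg.comp_tendsto h0)
  have h2 : Tendsto (fun t : ℝ => (g (t * e) - c * (1 - Complex.exp (t * e)) ^ (s : ℂ)) /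
      ((t ^ s : ℝ) : ℂ)) (𝓝[>] 0) (𝓝 0) := by
    rw [← isLittleO_iff_tendsto']
    · refine h1.trans_isBigO (IsBigO.of_bound 1 ?_)
      filter_upwards [self_mem_nhdsWithin] with t ht
      have ht : 0 < t := ht
      simp [he1, abs_of_pos ht]
    · filter_upwards [self_mem_nhdsWithin] with t ht
      have ht : 0 < t := ht
      intro h
      exact absurd h (by exact_mod_cast (Real.rpow_pos_of_pos ht s).ne')
  have h3 := h2.add ((tendsto_one_sub_exp_cpow_ray he s).const_mul c)
  rw [zero_add] at h3
  refine h3.congr fun t => ?_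
  ring

namespace LocalData

variable {f T G p Q : ℂ → ℂ} {D : Set ℂ} {φ r₀ b₀ b₁ q : ℝ} {a₁ c₁ : ℂ}

theorem cos_pos (h : LocalData f T G p Q D φ r₀ b₀ b₁ q a₁ c₁) : 0 < Real.cos φ :=
  Real.cos_pos_of_mem_Ioo ⟨by linarith [h.angle_pos, Real.pi_pos], h.angle_lt⟩

theorem sin_pos (h : LocalData f T G p Q D φ r₀ b₀ b₁ q a₁ c₁) : 0 < Real.sin φ :=
  Real.sin_pos_of_pos_of_lt_pi h.angle_pos (by linarith [h.angle_lt, Real.pi_pos])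

theorem isBigO_f (h : LocalData f T G p Q D φ r₀ b₀ b₁ q a₁ c₁) :
    (fun ζ => f ζ - p ζ) =O[𝓝[wedge φ] 0] fun ζ => ‖ζ‖ ^ (q - 1) := by
  have h1 := ((isBigO_one_sub_exp_cpow (q - 1) (by linarith [h.one_lt])).mono
    nhdsWithin_le_nhds (l := 𝓝[wedge φ] 0)).const_mul_left c₁
  exact (h.f_exp.isBigO.add h1).congr_left fun ζ => by ring

theorem isBigO_G (h : LocalData f T G p Q D φ r₀ b₀ b₁ q a₁ c₁) :
    (fun ζ => G ζ - Q ζ) =O[𝓝[wedge φ] 0] fun ζ => ‖ζ‖ ^ q := by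
  have h1 := ((isBigO_one_sub_exp_cpow q (by linarith [h.one_lt])).mono
    nhdsWithin_le_nhds (l := 𝓝[wedge φ] 0)).const_mul_left a₁
  exact (h.G_exp.isBigO.add h1).congr_left fun ζ => by ring

/-- Because `q > 1`, the singular part cannot compete with the linear term that governs the decay.
-/
theorem isLittleO_G (h : LocalData f T G p Q D φ r₀ b₀ b₁ q a₁ c₁) :
    (fun ζ => G ζ - Q ζ) =o[𝓝[wedge φ] 0] fun ζ => ζ := by
  refine h.isBigO_G.trans_isLittleO ?_
  have h2 : Tendsto (fun ζ : ℂ => ‖ζ‖ ^ (q - 1)) (𝓝[wedge φ] 0) (𝓝 0) := by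
    have h3 : Tendsto (fun ζ : ℂ => ‖ζ‖) (𝓝[wedge φ] 0) (𝓝 0) := by
      have := (continuous_norm (E := ℂ)).tendsto 0
      rw [norm_zero] at this
      exact this.mono_left nhdsWithin_le_nhds
    have := h3.rpow_const (p := q - 1) (Or.inr (by linarith [h.one_lt]))
    rwa [Real.zero_rpow (by linarith [h.one_lt])] at this
  have h4 : (fun ζ : ℂ => ‖ζ‖ ^ (q - 1) * ‖ζ‖) =o[𝓝[wedge φ] 0] fun ζ : ℂ => (1 : ℝ) * ‖ζ‖ :=
    ((isLittleO_one_iff ℝ).2 h2).mul_isBigO (isBigO_refl _ _)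
  refine (h4.congr' ?_ ?_).of_norm_right
  · filter_upwards [self_mem_nhdsWithin] with ζ hζ
    have hne : ‖ζ‖ ≠ 0 := by
      intro h0
      rw [norm_eq_zero] at h0
      simp [wedge, h0] at hζ
    rw [Real.rpow_sub_one hne]
    field_simp
  · exact Eventually.of_forall fun ζ => one_mul _

/-- Quantitative form of the local expansions on a small wedge. -/
theorem exists_local_bounds (h : LocalData f T G p Q D φ r₀ b₀ b₁ q a₁ c₁) {η : ℝ} (hη : 0 < η) :
    ∃ r M : ℝ, 0 < r ∧ r ≤ r₀ ∧ 0 ≤ M ∧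
      (∀ ζ ∈ wedge φ, ‖ζ‖ < r → ‖f ζ - p ζ‖ ≤ M * ‖ζ‖ ^ (q - 1)) ∧
      (∀ ζ ∈ wedge φ, ‖ζ‖ < r → ‖G ζ - Q ζ‖ ≤ M * ‖ζ‖ ^ q) ∧
      (∀ ζ ∈ wedge φ, ‖ζ‖ < r → ‖G ζ - Q ζ‖ ≤ η * ‖ζ‖) ∧
      (∀ ζ : ℂ, ‖ζ‖ < r → ‖Q ζ - Q 0 - b₁ * ζ‖ ≤ η * ‖ζ‖) ∧
      (∀ ζ : ℂ, ‖ζ‖ < r → ‖T ζ - T 0‖ ≤ M) ∧ (∀ ζ : ℂ, ‖ζ‖ < r → ‖p ζ‖ ≤ M) := by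
  obtain ⟨M₁, hM₁⟩ := h.isBigO_f.bound
  obtain ⟨M₂, hM₂⟩ := h.isBigO_G.bound
  have hη₁ := h.isLittleO_G.def hη
  have hQ : ∀ᶠ ζ : ℂ in 𝓝 0, ‖Q ζ - Q 0 - b₁ * ζ‖ ≤ η * ‖ζ‖ := by
    have := (hasDerivAt_iff_isLittleO.1 h.Q_deriv).def hη
    filter_upwards [this] with ζ hζ
    simpa [mul_comm] using hζ
  have h0 : (0 : ℂ) ∈ Metric.ball 0 r₀ := Metric.mem_ball_self h.radius_pos
  have hT : ∀ᶠ ζ : ℂ in 𝓝 0, ‖T ζ - T 0‖ ≤ 1 := by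
    have hc := (h.T_diff'.continuousOn.continuousAt (Metric.ball_mem_nhds 0 h.radius_pos))
    have := Metric.tendsto_nhds.1 hc.tendsto 1 one_pos
    filter_upwards [this] with ζ hζ
    rw [dist_eq_norm] at hζ
    exact hζ.le
  have hp : ∀ᶠ ζ : ℂ in 𝓝 0, ‖p ζ‖ ≤ 2 := by
    have hc := (h.p_diff.continuousOn.continuousAt (Metric.ball_mem_nhds 0 h.radius_pos))
    have := Metric.tendsto_nhds.1 hc.tendsto 1 one_pos
    filter_upwards [this] with ζ hζ
    rw [dist_eq_norm, h.p_zero] at hζ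
    have := norm_sub_norm_le (p ζ) 1
    rw [norm_one] at this
    linarith
  rw [eventually_nhdsWithin_iff] at hM₁ hM₂ hη₁
  obtain ⟨r, hr, hball⟩ := Metric.eventually_nhds_iff.1
    (hM₁.and (hM₂.and (hη₁.and (hQ.and (hT.and hp)))))
  have hM : max (max |M₁| |M₂|) 2 ≥ 0 := le_max_of_le_right (by norm_num)
  have key : ∀ ζ : ℂ, ‖ζ‖ < min r r₀ → dist ζ 0 < r := fun ζ hζ => by
    rw [dist_zero_right]; exact hζ.trans_le (min_le_left _ _)
  refine ⟨min r r₀, max (max |M₁| |M₂|) 2, lt_min hr h.radius_pos, min_le_right _ _, hM,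
    ?_, ?_, ?_, ?_, ?_, ?_⟩
  · intro ζ hw hζ
    have := (hball (key ζ hζ)).1 hw
    rw [Real.norm_of_nonneg (by positivity)] at this
    refine this.trans ?_
    gcongr
    exact (le_abs_self _).trans ((le_max_left _ _).trans (le_max_left _ _))
  · intro ζ hw hζ
    have := (hball (key ζ hζ)).2.1 hw
    rw [Real.norm_of_nonneg (by positivity)] at this
    refine this.trans ?_
    gcongr
    exact (le_abs_self _).trans ((le_max_right _ _).trans (le_max_left _ _))
  · exact fun ζ hw hζ => (hball (key ζ hζ)).2.2.1 hw
  · exact fun ζ hζ => (hball (key ζ hζ)).2.2.2.1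
  · exact fun ζ hζ => (hball (key ζ hζ)).2.2.2.2.1.trans (le_max_of_le_right (by norm_num))
  · exact fun ζ hζ => (hball (key ζ hζ)).2.2.2.2.2.trans (le_max_right _ _)

/-- On a smaller wedge the derivative of `G` tends to `b₁`. -/
theorem exists_deriv_bound (h : LocalData f T G p Q D φ r₀ b₀ b₁ q a₁ c₁) {ψ : ℝ}
    (hψ : Real.cos ψ < Real.cos φ) (hψ0 : 0 ≤ Real.cos ψ) {η : ℝ} (hη : 0 < η) :
    ∃ r > 0, r ≤ r₀ ∧ ∀ ζ : ℂ, ζ ≠ 0 → ζ.re ≤ ‖ζ‖ * Real.cos ψ → ‖ζ‖ < r →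
      ‖deriv G ζ - b₁‖ ≤ η := by
  -- With this `k` the disc of radius `k ‖ζ‖` about a point of the smaller wedge stays inside the
  -- larger one, so Cauchy's estimate is available at the scale of `‖ζ‖`.
  set k : ℝ := (Real.cos φ - Real.cos ψ) / 3 with hk
  have hcφ := Real.cos_le_one φ
  have hk0 : 0 < k := by rw [hk]; linarith
  have hk1 : k ≤ 1 / 3 := by rw [hk]; linarith
  obtain ⟨r, M, hr, hrr, -, -, -, hG, hQ, -, -⟩ := h.exists_local_bounds
    (η := η * k / 4) (by positivity)
  refine ⟨r / 2, by positivity, by linarith, ?_⟩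
  intro ζ hζ0 hζ hζr
  have hn : 0 < ‖ζ‖ := norm_pos_iff.2 hζ0
  have hsub : ∀ w ∈ Metric.closedBall ζ (k * ‖ζ‖), w ∈ wedge φ ∧ ‖w‖ < r ∧ ‖w‖ ≤ 2 * ‖ζ‖ := by
    intro w hw
    rw [Metric.mem_closedBall, dist_eq_norm] at hw
    have h1 : ‖ζ‖ - k * ‖ζ‖ ≤ ‖w‖ := by
      have := norm_sub_norm_le ζ w
      rw [norm_sub_rev] at this
      linarith
    have h2 : ‖w‖ ≤ ‖ζ‖ + k * ‖ζ‖ := by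
      have := norm_sub_norm_le w ζ
      linarith
    have h3 : w.re ≤ ζ.re + k * ‖ζ‖ := by
      have := (Complex.abs_re_le_norm (w - ζ)).trans hw
      have := (abs_le.1 this).2
      rw [Complex.sub_re] at this
      linarith
    refine ⟨?_, by nlinarith, by nlinarith⟩
    rw [wedge, Set.mem_ofPred_eq]
    have h4 : (‖ζ‖ - k * ‖ζ‖) * Real.cos φ ≤ ‖w‖ * Real.cos φ :=
      mul_le_mul_of_nonneg_right h1 (by linarith)
    have h5 : Real.cos φ = Real.cos ψ + 3 * k := by rw [hk]; ring
    have h6 : k * Real.cos φ ≤ k := by nlinarith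
    nlinarith [mul_pos hn hk0]
  have hdG : ∀ w ∈ Metric.closedBall ζ (k * ‖ζ‖), DifferentiableAt ℂ G w := fun w hw =>
    h.G_diff.differentiableAt (h.isOpen.mem_nhds
      (h.wedge_subset w (hsub w hw).1 ((hsub w hw).2.1.trans_le hrr)))
  have hdE : DifferentiableOn ℂ (fun w => G w - Q 0 - b₁ * w)
      (Metric.closedBall ζ (k * ‖ζ‖)) := fun w hw =>
    (((hdG w hw).sub_const _).sub (differentiableAt_id.const_mul _)).differentiableWithinAt
  have hcl : DiffContOnCl ℂ (fun w => G w - Q 0 - b₁ * w) (Metric.ball ζ (k * ‖ζ‖)) :=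
    hdE.diffContOnCl_ball le_rfl
  -- On the circle `‖w‖ ≤ 2 ‖ζ‖`, so two errors of `η k / 4` times `‖w‖` add up to `η k ‖ζ‖`;
  -- dividing by the radius leaves `η`.
  have hb : ∀ w ∈ Metric.sphere ζ (k * ‖ζ‖), ‖G w - Q 0 - b₁ * w‖ ≤ η * k * ‖ζ‖ := by
    intro w hw
    obtain ⟨hw1, hw2, hw3⟩ := hsub w (Metric.sphere_subset_closedBall hw)
    have h1 := hG w hw1 hw2
    have h2 := hQ w hw2
    calc ‖G w - Q 0 - b₁ * w‖ = ‖(G w - Q w) + (Q w - Q 0 - b₁ * w)‖ := by congr 1; ring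
      _ ≤ _ := norm_add_le _ _
      _ ≤ η * k / 4 * ‖w‖ + η * k / 4 * ‖w‖ := add_le_add h1 h2
      _ = η * k / 2 * ‖w‖ := by ring
      _ ≤ η * k / 2 * (2 * ‖ζ‖) := by gcongr
      _ = _ := by ring
  have hmain := Complex.norm_deriv_le_of_forall_mem_sphere_norm_le (by positivity) hcl hb
  have hder : deriv (fun w => G w - Q 0 - b₁ * w) ζ = deriv G ζ - b₁ := by
    have h1 : HasDerivAt (fun w => G w - Q 0 - b₁ * w) (deriv G ζ - b₁ * 1) ζ :=
      ((hdG ζ (Metric.mem_closedBall_self (by positivity))).hasDerivAt.sub_const _).fun_sub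
        ((hasDerivAt_id' ζ).const_mul _)
    rw [h1.deriv, mul_one]
  rw [hder] at hmain
  refine hmain.trans_eq ?_
  field_simp

end LocalData

/-! ### Geometry of the deformed contour and the sign of the exponent on it. -/

theorem re_le_norm_mul_cos {ψ : ℝ} (hψ : 0 < ψ) (hψ' : ψ < Real.pi / 2) {ζ : ℂ} (h0 : 0 ≤ ζ.re)
    (h : ζ.re * Real.sin ψ ≤ |ζ.im| * Real.cos ψ) : ζ.re ≤ ‖ζ‖ * Real.cos ψ := by
  have hc : 0 < Real.cos ψ := Real.cos_pos_of_mem_Ioo ⟨by linarith, hψ'⟩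
  have hs : 0 < Real.sin ψ := Real.sin_pos_of_pos_of_lt_pi hψ (by linarith [Real.pi_pos])
  refine le_of_sq_le_sq ?_ (by positivity)
  rw [mul_pow, Complex.sq_norm, Complex.normSq_apply]
  have h1 : (ζ.re * Real.sin ψ) ^ 2 ≤ (|ζ.im| * Real.cos ψ) ^ 2 := by
    gcongr
  rw [mul_pow, mul_pow, sq_abs] at h1
  have := Real.sin_sq_add_cos_sq ψ
  nlinarith

/-- The truncated upper (`σ = 1`) or lower (`σ = -1`) half plane used in the deformation. -/
def tiltedStrip (φ ρ σ : ℝ) : Set ℂ :=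
  {ζ | ζ.re * Real.sin φ < σ * ζ.im * Real.cos φ ∧ ζ.re < ρ ∧ σ * ζ.im < 7 / 2}

theorem isOpen_tiltedStrip (φ ρ σ : ℝ) : IsOpen (tiltedStrip φ ρ σ) := by
  have h1 : IsOpen {ζ : ℂ | ζ.re * Real.sin φ < σ * ζ.im * Real.cos φ} :=
    isOpen_lt (by fun_prop) (by fun_prop)
  have h2 : IsOpen {ζ : ℂ | ζ.re < ρ} := isOpen_lt (by fun_prop) (by fun_prop)
  have h3 : IsOpen {ζ : ℂ | σ * ζ.im < 7 / 2} := isOpen_lt (by fun_prop) (by fun_prop)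
  exact h1.inter (h2.inter h3)

theorem convex_tiltedStrip (φ ρ σ : ℝ) : Convex ℝ (tiltedStrip φ ρ σ) := by
  rintro z ⟨z1, z2, z3⟩ w ⟨w1, w2, w3⟩ a b ha hb hab
  simp only [tiltedStrip, Set.mem_ofPred_eq, Complex.add_re, Complex.add_im, Complex.smul_re,
    Complex.smul_im, smul_eq_mul]
  have hcomb : ∀ {x y x' y' : ℝ}, x < y → x' < y' → a * x + b * x' < a * y + b * y' := by
    intro x y x' y' h1 h2
    rcases ha.eq_or_lt with h0 | h0
    · subst h0
      have : b = 1 := by linarith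
      subst this
      linarith
    · nlinarith [mul_lt_mul_of_pos_left h1 h0, mul_le_mul_of_nonneg_left h2.le hb]
  refine ⟨?_, ?_, ?_⟩
  · linarith [hcomb z1 w1]
  · have := hcomb z2 w2
    rw [← add_mul, hab, one_mul] at this
    exact this
  · have := hcomb z3 w3
    rw [← add_mul, hab, one_mul] at this
    linarith

namespace LocalData

variable {f T G p Q : ℂ → ℂ} {D : Set ℂ} {φ r₀ b₀ b₁ q : ℝ} {a₁ c₁ : ℂ}

/-- Just to the right of the imaginary axis, outside the wedge, the exponent is negative. -/
theorem exists_re_exponent_le (h : LocalData f T G p Q D φ r₀ b₀ b₁ q a₁ c₁) {ψ : ℝ} (hψ : φ < ψ)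
    (hψ' : ψ < Real.pi / 2) {v₁ v₂ d₀ : ℝ} (hv₁ : 0 < v₁) (hv : v₁ ≤ v₂) (hd₀ : 0 < d₀)
    (hd : ∀ v ∈ Set.Icc v₁ v₂, d₀ ≤ 1 - v * b₁) :
    ∃ r > 0, r ≤ r₀ ∧ ∀ x y : ℝ, 0 < x → |y| ≤ 7 / 2 → x * Real.sin ψ ≤ |y| * Real.cos ψ →
      ‖(x + y * Complex.I : ℂ)‖ < r → ∀ v ∈ Set.Icc v₁ v₂,
      (v * (G (x + y * Complex.I) - b₀) - (x + y * Complex.I)).re ≤ -(d₀ / 2 * x) := by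
  have hφ := h.angle_pos
  have hv₂ : 0 < v₂ := hv₁.trans_le hv
  have hcψ : 0 < Real.cos ψ := Real.cos_pos_of_mem_Ioo ⟨by linarith, hψ'⟩
  have hsψ : 0 < Real.sin ψ := Real.sin_pos_of_pos_of_lt_pi (by linarith) (by linarith)
  have hcos : Real.cos ψ < Real.cos φ :=
    Real.cos_lt_cos_of_nonneg_of_le_pi_div_two hφ.le hψ'.le hψ
  obtain ⟨r, hr, hr0, hder⟩ := h.exists_deriv_bound hcos hcψ.le (η := d₀ / (2 * v₂))
    (by positivity)
  refine ⟨r, hr, hr0, fun x y hx hy7 hxy hn v hvI => ?_⟩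
  have hv0 : 0 < v := hv₁.trans_le hvI.1
  have hy : 0 < |y| := by
    by_contra hcon
    have : |y| = 0 := le_antisymm (not_lt.1 hcon) (abs_nonneg y)
    rw [this, zero_mul] at hxy
    nlinarith [mul_pos hx hsψ]
  have hpt : ∀ t ∈ Set.Icc 0 x, (t + y * Complex.I : ℂ) ≠ 0 ∧
      (t + y * Complex.I : ℂ).re ≤ ‖(t + y * Complex.I : ℂ)‖ * Real.cos ψ ∧
      ‖(t + y * Complex.I : ℂ)‖ < r := by
    intro t ht
    have hy0 : y ≠ 0 := abs_pos.1 hy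
    refine ⟨fun h0 => hy0 (by simpa using congrArg Complex.im h0), ?_, ?_⟩
    · refine re_le_norm_mul_cos (hφ.trans hψ) hψ' (by simpa using ht.1) ?_
      simp only [Complex.add_re, Complex.ofReal_re, Complex.mul_re, Complex.I_re, mul_zero,
        Complex.ofReal_im, Complex.I_im, mul_one, sub_self, add_zero, Complex.add_im,
        Complex.mul_im, zero_add]
      exact (mul_le_mul_of_nonneg_right ht.2 hsψ.le).trans hxy
    · refine lt_of_le_of_lt ?_ hn
      rw [Complex.norm_add_mul_I, Complex.norm_add_mul_I]
      have := ht.1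
      have := ht.2
      gcongr
  -- The function is integrated horizontally from `iy`, where `Re G < b₀`. Its growth is at most
  -- `(b₁ + d₀ / (2 v₂)) x`; multiplied by `v` and set against `-x`, this leaves at most `-(d₀ / 2)
  -- x`.
  have hdG : ∀ t ∈ Set.Icc 0 x, HasDerivWithinAt
      (fun t : ℝ => G (t + y * Complex.I) - b₁ * t)
      (deriv G (t + y * Complex.I) - b₁) (Set.Icc 0 x) t := by
    intro t ht
    obtain ⟨h0, h1, h2⟩ := hpt t ht
    have hD : (t + y * Complex.I : ℂ) ∈ D := by
      refine h.wedge_subset _ (lt_of_le_of_lt h1 ?_) (h2.trans_le hr0)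
      exact mul_lt_mul_of_pos_left hcos (norm_pos_iff.2 h0)
    have hG := (h.G_diff.differentiableAt (h.isOpen.mem_nhds hD)).hasDerivAt
    have h3 : HasDerivAt (fun t : ℝ => (t : ℂ) + y * Complex.I) 1 t := by
      simpa using (Complex.ofRealCLM.hasDerivAt (x := t)).add_const (y * Complex.I)
    have h4 : HasDerivAt (fun t : ℝ => (b₁ : ℂ) * t) (b₁ * 1) t := by
      simpa using (Complex.ofRealCLM.hasDerivAt (x := t)).const_mul (b₁ : ℂ)
    have h5 := (hG.comp t h3).sub h4
    rw [mul_one, mul_one] at h5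
    exact h5.hasDerivWithinAt
  have hmv := norm_image_sub_le_of_norm_deriv_le_segment' hdG (C := d₀ / (2 * v₂))
    (fun t ht => by
      obtain ⟨h0, h1, h2⟩ := hpt t ⟨ht.1, ht.2.le⟩
      exact hder _ h0 h1 h2) x ⟨hx.le, le_rfl⟩
  have hax := h.axis_lt y (abs_pos.1 hy) hy7
  have hre := (Complex.re_le_norm _).trans hmv
  simp only [Complex.ofReal_zero, zero_add, mul_zero, sub_zero, Complex.sub_re,
    Complex.ofReal_re, Complex.add_re, Complex.mul_re, Complex.I_re,
    Complex.ofReal_im, Complex.I_im, mul_one, sub_self, add_zero] at hre ⊢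
  have hdv := hd v hvI
  have h6 : v * (d₀ / (2 * v₂) * x) ≤ d₀ / 2 * x := by
    calc v * (d₀ / (2 * v₂) * x) ≤ v₂ * (d₀ / (2 * v₂) * x) := by
          have := hvI.2; gcongr
      _ = _ := by field_simp
  have h7 : v * ((G (x + y * Complex.I)).re - b₀) ≤ v * (b₁ * x + d₀ / (2 * v₂) * x) := by
    gcongr
    linarith
  nlinarith

/-- The strict inequality on the axis is an open condition, and the part of the axis with `r ≤ |y| ≤
7 / 2` is compact, so it persists on a thickening. -/
theorem exists_outer (h : LocalData f T G p Q D φ r₀ b₀ b₁ q a₁ c₁) {r : ℝ} (hr : 0 < r) :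
    ∃ ρ > 0, ∀ x y : ℝ, 0 ≤ x → x < ρ → r ≤ |y| → |y| ≤ 7 / 2 →
      (x + y * Complex.I : ℂ) ∈ D ∧ (G (x + y * Complex.I)).re < b₀ := by
  have hO : IsOpen (D ∩ G ⁻¹' {z | z.re < b₀}) :=
    h.G_diff.continuousOn.isOpen_inter_preimage h.isOpen
      (isOpen_lt Complex.continuous_re continuous_const)
  have hK : IsCompact ((fun y : ℝ => (y : ℂ) * Complex.I) '' {y : ℝ | r ≤ |y| ∧ |y| ≤ 7 / 2}) := by
    refine IsCompact.image ?_ (by fun_prop)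
    refine isCompact_Icc.of_isClosed_subset (s := Set.Icc (-(7 / 2 : ℝ)) (7 / 2)) ?_ ?_
    · exact (isClosed_le continuous_const continuous_abs).inter
        (isClosed_le continuous_abs continuous_const)
    · exact fun y hy => abs_le.1 hy.2
  obtain ⟨ρ, hρ, hsub⟩ := hK.exists_thickening_subset_open hO (by
    rintro _ ⟨y, hy, rfl⟩
    have hy0 : y ≠ 0 := abs_pos.1 (hr.trans_le hy.1)
    exact ⟨h.axis_mem y hy0 hy.2, h.axis_lt y hy0 hy.2⟩)
  refine ⟨ρ, hρ, fun x y hx hxρ hy hy7 => hsub ?_⟩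
  rw [Metric.mem_thickening_iff]
  refine ⟨y * Complex.I, ⟨y, ⟨hy, hy7⟩, rfl⟩, ?_⟩
  rw [dist_eq_norm, add_sub_cancel_right, Complex.norm_real, Real.norm_of_nonneg hx]
  exact hxρ

/-- The strip is covered by the left half plane, the small wedge at `0` and the thickened part of
the axis. Requiring `ρ ≤ r / 2` makes the last two overlap. -/
theorem tiltedStrip_subset (h : LocalData f T G p Q D φ r₀ b₀ b₁ q a₁ c₁) {r ρ σ : ℝ}
    (hrr : r ≤ r₀) (hρr : ρ ≤ r / 2) (hσ : |σ| = 1)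
    (hout : ∀ x y : ℝ, 0 ≤ x → x < ρ → r / 2 ≤ |y| → |y| ≤ 7 / 2 → (x + y * Complex.I : ℂ) ∈ D) :
    tiltedStrip φ ρ σ ⊆ D := by
  rintro ζ ⟨h1, h2, h3⟩
  have hc := h.cos_pos
  have hs := h.sin_pos
  rcases lt_or_ge ζ.re 0 with h0 | h0
  · exact h.left_subset h0
  have h4 : 0 < σ * ζ.im := by
    by_contra hcon
    nlinarith [mul_nonneg h0 hs.le, mul_nonneg (neg_nonneg.2 (not_lt.1 hcon)) hc.le]
  have h5 : |ζ.im| = σ * ζ.im := by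
    rw [← abs_of_pos h4, abs_mul, hσ, one_mul]
  rw [← h5] at h1 h3
  rcases lt_or_ge |ζ.im| (r / 2) with h6 | h6
  · refine h.wedge_subset ζ (mem_wedge_of_lt h.angle_pos h.angle_lt h1) ?_
    refine lt_of_lt_of_le ?_ hrr
    have := Complex.norm_le_abs_re_add_abs_im ζ
    rw [abs_of_nonneg h0] at this
    linarith
  · have := hout ζ.re ζ.im h0 h2 h6 h3.le
    rwa [Complex.re_add_im] at this

/-- The constants of the deformed contour: opening angle `ψ`, leg length `L`, and bounds. -/
theorem exists_contour (h : LocalData f T G p Q D φ r₀ b₀ b₁ q a₁ c₁) {v₁ v₂ d₀ : ℝ}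
    (hv₁ : 0 < v₁) (hv : v₁ ≤ v₂) (hd₀ : 0 < d₀) (hd : ∀ v ∈ Set.Icc v₁ v₂, d₀ ≤ 1 - v * b₁) :
    ∃ ψ L r M c ρ : ℝ, φ < ψ ∧ ψ < Real.pi / 2 ∧ 0 < L ∧ L < r ∧ r ≤ r₀ ∧ 0 < c ∧ 0 ≤ M ∧
      L * Real.cos ψ < ρ ∧ L ≤ Real.cos φ ∧
      tiltedStrip φ ρ 1 ⊆ D ∧ tiltedStrip φ ρ (-1) ⊆ D ∧
      (∀ ζ ∈ wedge φ, ‖ζ‖ < r → ‖f ζ - p ζ‖ ≤ M * ‖ζ‖ ^ (q - 1)) ∧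
      (∀ ζ ∈ wedge φ, ‖ζ‖ < r → ‖G ζ - Q ζ‖ ≤ M * ‖ζ‖ ^ q) ∧
      (∀ ζ : ℂ, ‖ζ‖ < r → ‖T ζ - T 0‖ ≤ M) ∧ (∀ ζ : ℂ, ‖ζ‖ < r → ‖p ζ‖ ≤ M) ∧
      (∀ ζ ∈ wedge φ, ‖ζ‖ < r → v₂ * ‖G ζ - Q ζ‖ ≤ d₀ * Real.cos ψ / 4 * ‖ζ‖) ∧
      (∀ ζ : ℂ, ‖ζ‖ < r → v₂ * ‖Q ζ - Q 0 - b₁ * ζ‖ ≤ d₀ * Real.cos ψ / 4 * ‖ζ‖) ∧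
      (∀ y : ℝ, L * Real.sin ψ ≤ |y| → |y| ≤ 7 / 2 →
        ((L * Real.cos ψ : ℝ) + y * Complex.I : ℂ) ∈ D ∧ ∀ v ∈ Set.Icc v₁ v₂,
        (v * (G ((L * Real.cos ψ : ℝ) + y * Complex.I) - b₀) -
          ((L * Real.cos ψ : ℝ) + y * Complex.I)).re ≤ -c) := by
  have hφ := h.angle_pos
  have hφ' := h.angle_lt
  have hv₂ : 0 < v₂ := hv₁.trans_le hv
  obtain ⟨ψ, hψ, hψ'⟩ := exists_between h.angle_lt
  have hcψ : 0 < Real.cos ψ := Real.cos_pos_of_mem_Ioo ⟨by linarith, hψ'⟩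
  have hsψ : 0 < Real.sin ψ := Real.sin_pos_of_pos_of_lt_pi (by linarith) (by linarith)
  have hcφ := h.cos_pos
  obtain ⟨ra, M, hra, hra0, hM, hf, hG, hGo, hQo, hT, hp⟩ := h.exists_local_bounds
    (η := d₀ * Real.cos ψ / (4 * v₂)) (by positivity)
  obtain ⟨rb, hrb, hrb0, hver⟩ := h.exists_re_exponent_le hψ hψ' hv₁ hv hd₀ hd
  set r := min ra rb with hr
  have hr0 : 0 < r := lt_min hra hrb
  have hrra : r ≤ ra := min_le_left _ _
  have hrrb : r ≤ rb := min_le_right _ _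
  obtain ⟨ρ', hρ', hout⟩ := h.exists_outer (half_pos hr0)
  set ρ := min ρ' (r / 2) with hρ
  have hρ0 : 0 < ρ := lt_min hρ' (by linarith)
  have hρρ' : ρ ≤ ρ' := min_le_left _ _
  have hρr : ρ ≤ r / 2 := min_le_right _ _
  -- `L ≤ ρ / 2` keeps the end of each leg inside the strips. `L ≤ cos φ` ensures that the corner at
  -- height `π` satisfies their slope condition.
  set L := min (ρ / 2) (Real.cos φ) with hL
  have hL0 : 0 < L := lt_min (by linarith) hcφ
  have hLρ : L ≤ ρ / 2 := min_le_left _ _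
  have hLc : L * Real.cos ψ ≤ L := mul_le_of_le_one_right hL0.le (Real.cos_le_one ψ)
  have hLc0 : 0 < L * Real.cos ψ := by positivity
  have hmulbound : ∀ {X Y : ℝ}, X ≤ d₀ * Real.cos ψ / (4 * v₂) * Y →
      v₂ * X ≤ d₀ * Real.cos ψ / 4 * Y := by
    intro X Y hXY
    calc v₂ * X ≤ v₂ * (d₀ * Real.cos ψ / (4 * v₂) * Y) := by gcongr
      _ = _ := by field_simp
  -- Near `0` the exponent on the vertical line is at most `-(d₀ / 2) x`, farther away at most `-x`;
  -- hence the decay rate with `min 1 (d₀ / 2)`.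
  refine ⟨ψ, L, r, M, min 1 (d₀ / 2) * (L * Real.cos ψ), ρ, hψ, hψ', hL0, by linarith,
    hrra.trans hra0, by positivity, hM, by linarith, min_le_right _ _, ?_, ?_, ?_, ?_, ?_, ?_, ?_,
    ?_, ?_⟩
  · exact h.tiltedStrip_subset (hrra.trans hra0) hρr (by simp)
      fun x y hx hxρ hy hy7 => (hout x y hx (hxρ.trans_le hρρ') hy hy7).1
  · exact h.tiltedStrip_subset (hrra.trans hra0) hρr (by simp)
      fun x y hx hxρ hy hy7 => (hout x y hx (hxρ.trans_le hρρ') hy hy7).1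
  · exact fun ζ hw hζ => hf ζ hw (hζ.trans_le hrra)
  · exact fun ζ hw hζ => hG ζ hw (hζ.trans_le hrra)
  · exact fun ζ hζ => hT ζ (hζ.trans_le hrra)
  · exact fun ζ hζ => hp ζ (hζ.trans_le hrra)
  · exact fun ζ hw hζ => hmulbound (hGo ζ hw (hζ.trans_le hrra))
  · exact fun ζ hζ => hmulbound (hQo ζ (hζ.trans_le hrra))
  · intro y hy hy7
    set x := L * Real.cos ψ with hx
    have hxy : x * Real.sin ψ ≤ |y| * Real.cos ψ := by
      calc x * Real.sin ψ = (L * Real.sin ψ) * Real.cos ψ := by rw [hx]; ring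
        _ ≤ _ := by gcongr
    have hm1 : min 1 (d₀ / 2) * x ≤ 1 * x := by gcongr; exact min_le_left _ _
    have hm2 : min 1 (d₀ / 2) * x ≤ d₀ / 2 * x := by gcongr; exact min_le_right _ _
    rcases lt_or_ge |y| (r / 2) with hyr | hyr
    · have hn : ‖(x + y * Complex.I : ℂ)‖ < r := by
        have := Complex.norm_le_abs_re_add_abs_im (x + y * Complex.I : ℂ)
        simp only [Complex.add_re, Complex.ofReal_re, Complex.mul_re, Complex.I_re, mul_zero,
          Complex.ofReal_im, Complex.I_im, mul_one, sub_self, add_zero, Complex.add_im,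
          Complex.mul_im, zero_add, abs_of_pos hLc0] at this
        linarith
      refine ⟨h.wedge_subset _ ?_ (hn.trans_le (hrra.trans hra0)), fun v hvI => ?_⟩
      · have hne : (x + y * Complex.I : ℂ) ≠ 0 := fun h0 => hLc0.ne' (by
          simpa using congrArg Complex.re h0)
        have := re_le_norm_mul_cos (hφ.trans hψ) hψ' (ζ := (x + y * Complex.I : ℂ))
          (by simpa using hLc0.le) (by simpa using hxy)
        refine lt_of_le_of_lt this (mul_lt_mul_of_pos_left ?_ (norm_pos_iff.2 hne))
        exact Real.cos_lt_cos_of_nonneg_of_le_pi_div_two hφ.le hψ'.le hψ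
      · have := hver x y hLc0 hy7 hxy (hn.trans_le hrrb) v hvI
        linarith
    · obtain ⟨h1, h2⟩ := hout x y hLc0.le (by linarith) hyr hy7
      refine ⟨h1, fun v hvI => ?_⟩
      have hv0 : 0 < v := hv₁.trans_le hvI.1
      simp only [Complex.sub_re, Complex.ofReal_re, Complex.add_re,
        Complex.mul_re, Complex.I_re, mul_zero, Complex.ofReal_im, Complex.I_im, mul_one, sub_self,
        add_zero]
      nlinarith [mul_pos hv0 (sub_pos.2 h2)]

end LocalData

/-! ### Limit of the normalised coefficient integral. -/

/-- Integrability is drawn from a uniform bound, since the integrands need not be continuous at the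
endpoint `a`, which will be the singular point. -/
theorem segInt_sub {F A : ℂ → ℂ} {a b : ℂ} {M : ℝ}
    (hF : ContinuousOn (fun t : ℝ => F (a + t * (b - a))) (Set.Ioc 0 1))
    (hA : ContinuousOn (fun t : ℝ => A (a + t * (b - a))) (Set.Ioc 0 1))
    (hFM : ∀ t ∈ Set.Ioc (0 : ℝ) 1, ‖F (a + t * (b - a))‖ ≤ M)
    (hAM : ∀ t ∈ Set.Ioc (0 : ℝ) 1, ‖A (a + t * (b - a))‖ ≤ M) :
    segInt (fun z => F z - A z) a b = segInt F a b - segInt A a b := by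
  have key : ∀ {F : ℂ → ℂ}, ContinuousOn (fun t : ℝ => F (a + t * (b - a))) (Set.Ioc 0 1) →
      (∀ t ∈ Set.Ioc (0 : ℝ) 1, ‖F (a + t * (b - a))‖ ≤ M) →
      IntervalIntegrable (fun t : ℝ => F (a + t * (b - a)) * (b - a)) volume 0 1 := by
    intro F hF hFM
    rw [intervalIntegrable_iff_integrableOn_Ioc_of_le zero_le_one]
    have : IntegrableOn (fun t : ℝ => F (a + t * (b - a))) (Set.Ioc 0 1) volume :=
      Integrable.mono' (integrableOn_const (C := M) (by simp))
        (hF.aestronglyMeasurable measurableSet_Ioc)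
        ((ae_restrict_iff' measurableSet_Ioc).2 (ae_of_all _ hFM))
    exact Integrable.mul_const this _
  rw [segInt, segInt, segInt, ← intervalIntegral.integral_sub (key hF hFM) (key hA hAM)]
  congr 1
  ext t
  ring

theorem norm_kern_le {f T G : ℂ → ℂ} {b ζ : ℂ} {N : ℕ} {v v₂ B c : ℝ} (hv : 0 ≤ v) (hv₂ : v ≤ v₂)
    (hf : ‖f ζ‖ ≤ B) (hT : ‖T ζ - T 0‖ ≤ B) (hc : (v * (G ζ - b) - ζ).re ≤ -c) :
    ‖kern f T G b N v ζ‖ ≤ B * Real.exp (v₂ * B) * Real.exp (-(c * N)) := by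
  have hB : 0 ≤ B := (norm_nonneg _).trans hf
  rw [kern, norm_mul, norm_mul]
  have h1 : ‖Complex.exp (v * (T ζ - T 0))‖ ≤ Real.exp (v₂ * B) := by
    refine (Complex.norm_exp_le_exp_norm _).trans (Real.exp_le_exp.2 ?_)
    rw [norm_mul, Complex.norm_real, Real.norm_of_nonneg hv]
    exact mul_le_mul hv₂ hT (norm_nonneg _) (hv.trans hv₂)
  have h2 : ‖Complex.exp (N * (v * (G ζ - b) - ζ))‖ ≤ Real.exp (-(c * N)) := by
    rw [Complex.norm_exp, ← Complex.ofReal_natCast, Complex.re_ofReal_mul]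
    refine Real.exp_le_exp.2 ?_
    have := mul_le_mul_of_nonneg_left hc (Nat.cast_nonneg (α := ℝ) N)
    linarith
  gcongr

theorem kern_periodic {f T G : ℂ → ℂ} (hf : ∀ z, f (z + 2 * Real.pi * Complex.I) = f z)
    (hT : ∀ z, T (z + 2 * Real.pi * Complex.I) = T z)
    (hG : ∀ z, G (z + 2 * Real.pi * Complex.I) = G z) (b : ℂ) (N : ℕ) (v : ℝ) (z : ℂ) :
    kern f T G b N v (z + 2 * Real.pi * Complex.I) = kern f T G b N v z := by
  rw [kern, kern, hf, hT, hG]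
  congr 1
  rw [Complex.exp_eq_exp_iff_exists_int]
  exact ⟨-N, by push_cast; ring⟩

theorem differentiableOn_kern {f T G : ℂ → ℂ} {D : Set ℂ} (hf : DifferentiableOn ℂ f D)
    (hT : DifferentiableOn ℂ T D) (hG : DifferentiableOn ℂ G D) (b : ℂ) (N : ℕ) (v : ℝ) :
    DifferentiableOn ℂ (kern f T G b N v) D :=
  (hf.mul ((hT.sub_const _).const_mul _).cexp).mul
    ((((hG.sub_const _).const_mul _).sub differentiableOn_id).const_mul _).cexp

theorem tendsto_rpow_mul_of_norm_le_exp {ι : Type*} {l : Filter ι} {N : ι → ℕ} {X : ι → ℂ}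
    {B c : ℝ} (q : ℝ) (hN : Tendsto N l atTop) (hc : 0 < c)
    (hX : ∀ᶠ i in l, ‖X i‖ ≤ B * Real.exp (-(c * N i))) :
    Tendsto (fun i => (((N i : ℝ) ^ q : ℝ) : ℂ) * X i) l (𝓝 0) := by
  have h1 := ((tendsto_rpow_mul_exp_neg_mul_atTop_nhds_zero q c hc).comp
    (tendsto_natCast_atTop_atTop.comp hN)).const_mul B
  rw [mul_zero] at h1
  refine squeeze_zero_norm' ?_ h1
  filter_upwards [hX] with i hi
  rw [norm_mul, Complex.norm_real, Real.norm_of_nonneg (by positivity)]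
  calc (N i : ℝ) ^ q * ‖X i‖ ≤ (N i : ℝ) ^ q * (B * Real.exp (-(c * N i))) := by gcongr
    _ = _ := by simp only [Function.comp, neg_mul]; ring

namespace LocalData

variable {f T G p Q : ℂ → ℂ} {D : Set ℂ} {φ r₀ b₀ b₁ q : ℝ} {a₁ c₁ : ℂ}
  {ι : Type*} {l : Filter ι} {N : ι → ℕ} {v : ι → ℝ} {vs v₁ v₂ d₀ L r M α : ℝ} {e : ℂ}

/-- The exponent equals `w (Q ζ - Q 0 - b₁ ζ) - (1 - w b₁) ζ`, whose second term supplies the decay.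
-/
theorem re_exponent_Q_le (hd : ∀ v ∈ Set.Icc v₁ v₂, d₀ ≤ 1 - v * b₁) (hv₁ : 0 < v₁) {w : ℝ}
    (hw : w ∈ Set.Icc v₁ v₂) {ζ : ℂ} {X : ℝ} (hζ : 0 ≤ ζ.re)
    (hX : v₂ * ‖Q ζ - Q 0 - b₁ * ζ‖ ≤ X) :
    (w * (Q ζ - Q 0) - ζ).re ≤ X - d₀ * ζ.re := by
  have hw0 : 0 < w := hv₁.trans_le hw.1
  have h1 : (w * (Q ζ - Q 0) - ζ).re = w * (Q ζ - Q 0 - b₁ * ζ).re - (1 - w * b₁) * ζ.re := by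
    simp only [Complex.sub_re, Complex.mul_re, Complex.ofReal_re, Complex.ofReal_im, zero_mul,
      sub_zero]
    ring
  rw [h1]
  have h2 : w * (Q ζ - Q 0 - b₁ * ζ).re ≤ v₂ * ‖Q ζ - Q 0 - b₁ * ζ‖ :=
    calc w * (Q ζ - Q 0 - b₁ * ζ).re ≤ w * ‖Q ζ - Q 0 - b₁ * ζ‖ := by
          gcongr; exact Complex.re_le_norm _
      _ ≤ _ := by have := hw.2; gcongr
  have h3 := mul_le_mul_of_nonneg_right (hd w hw) hζ
  linarith

theorem ray_mem_wedge (he1 : ‖e‖ = 1) (hew : e.re < Real.cos φ) {t : ℝ} (ht : 0 < t) :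
    (t * e : ℂ) ∈ wedge φ ∧ ‖(t * e : ℂ)‖ = t := by
  have hn : ‖(t * e : ℂ)‖ = t := by
    rw [norm_mul, he1, Complex.norm_real, Real.norm_of_nonneg ht.le, mul_one]
  refine ⟨?_, hn⟩
  rw [wedge, Set.mem_ofPred_eq, Complex.re_ofReal_mul, hn]
  gcongr

/-- Bounds for the integrands on the wedge near `0`. -/
theorem exists_bound_near_zero (h : LocalData f T G p Q D φ r₀ b₀ b₁ q a₁ c₁)
    (hf : ∀ ζ ∈ wedge φ, ‖ζ‖ < r → ‖f ζ - p ζ‖ ≤ M * ‖ζ‖ ^ (q - 1))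
    (hG : ∀ ζ ∈ wedge φ, ‖ζ‖ < r → ‖G ζ - Q ζ‖ ≤ M * ‖ζ‖ ^ q)
    (hT : ∀ ζ : ℂ, ‖ζ‖ < r → ‖T ζ - T 0‖ ≤ M) (hp : ∀ ζ : ℂ, ‖ζ‖ < r → ‖p ζ‖ ≤ M)
    (hQ : ∀ ζ : ℂ, ‖ζ‖ < r → v₂ * ‖Q ζ - Q 0 - b₁ * ζ‖ ≤ M * ‖ζ‖) (hM : 0 ≤ M)
    (hv₂ : 0 < v₂) (N : ℕ) {w : ℝ} (hw : w ∈ Set.Icc 0 v₂) :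
    ∃ B : ℝ, (∀ ζ ∈ wedge φ, ‖ζ‖ < r → ‖kern f T G b₀ N w ζ‖ ≤ B) ∧
      (∀ ζ : ℂ, ‖ζ‖ < r → ‖kern p T Q b₀ N w ζ‖ ≤ B) := by
  set B₁ := M + M * r ^ (q - 1) with hB₁
  set B₂ := M * r ^ q + (M * r / v₂ + |b₁| * r) with hB₂
  have hq := h.one_lt
  have hQb : ∀ ζ : ℂ, ‖ζ‖ < r → ‖Q ζ - b₀‖ ≤ M * r / v₂ + |b₁| * r := by
    intro ζ hζ
    rw [← h.Q_zero]
    have h1 : ‖Q ζ - Q 0 - b₁ * ζ‖ ≤ M * r / v₂ := by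
      rw [le_div_iff₀ hv₂, mul_comm]
      exact (hQ ζ hζ).trans (by gcongr)
    calc ‖Q ζ - Q 0‖ = ‖(Q ζ - Q 0 - b₁ * ζ) + b₁ * ζ‖ := by congr 1; ring
      _ ≤ _ := norm_add_le _ _
      _ ≤ _ := by
        rw [norm_mul, Complex.norm_real, Real.norm_eq_abs]
        gcongr
  have hkern : ∀ {f G : ℂ → ℂ} {ζ : ℂ}, ‖ζ‖ < r → ‖f ζ‖ ≤ B₁ → ‖G ζ - b₀‖ ≤ B₂ →
      ‖kern f T G b₀ N w ζ‖ ≤ B₁ * Real.exp (v₂ * B₁) * Real.exp (-(-(v₂ * B₂ + r) * N)) := by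
    intro f G ζ hζ hf hG
    have hr : 0 < r := (norm_nonneg ζ).trans_lt hζ
    -- Only boundedness for fixed `N` is wanted, so a negative decay rate is admissible.
    refine norm_kern_le hw.1 hw.2 hf ((hT ζ hζ).trans (le_add_of_nonneg_right (by positivity))) ?_
    refine (Complex.re_le_norm _).trans ((norm_sub_le _ _).trans ?_)
    rw [norm_mul, Complex.norm_real, Real.norm_of_nonneg hw.1, neg_neg]
    have := hw.2
    have : 0 ≤ ‖G ζ - b₀‖ := norm_nonneg _
    gcongr
  refine ⟨B₁ * Real.exp (v₂ * B₁) * Real.exp (-(-(v₂ * B₂ + r) * N)), ?_, ?_⟩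
  · intro ζ hζw hζ
    have hr : 0 < r := (norm_nonneg ζ).trans_lt hζ
    refine hkern hζ ?_ ?_
    · calc ‖f ζ‖ = ‖p ζ + (f ζ - p ζ)‖ := by congr 1; ring
        _ ≤ _ := norm_add_le _ _
        _ ≤ _ := add_le_add (hp ζ hζ) ((hf ζ hζw hζ).trans (by gcongr))
    · calc ‖G ζ - b₀‖ = ‖(G ζ - Q ζ) + (Q ζ - b₀)‖ := by congr 1; ring
        _ ≤ _ := norm_add_le _ _
        _ ≤ _ := add_le_add ((hG ζ hζw hζ).trans (by gcongr)) (hQb ζ hζ)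
  · intro ζ hζ
    have hr : 0 < r := (norm_nonneg ζ).trans_lt hζ
    exact hkern hζ ((hp ζ hζ).trans (le_add_of_nonneg_right (by positivity)))
      ((hQb ζ hζ).trans (le_add_of_nonneg_left (by positivity)))

theorem tendsto_leg_difference [l.IsCountablyGenerated]
    (h : LocalData f T G p Q D φ r₀ b₀ b₁ q a₁ c₁) (hN : Tendsto N l atTop)
    (hv : Tendsto v l (𝓝 vs)) (hvI : ∀ᶠ i in l, v i ∈ Set.Icc v₁ v₂) (hvs : vs ∈ Set.Icc v₁ v₂)
    (hv₁ : 0 < v₁) (hd₀ : 0 < d₀) (hd : ∀ v ∈ Set.Icc v₁ v₂, d₀ ≤ 1 - v * b₁)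
    (hL : 0 < L) (hLr : L < r) (hr₀ : r ≤ r₀) (hM : 0 ≤ M)
    (hα : 0 < α) (he1 : ‖e‖ = 1) (heα : e.re = α) (hαφ : α < Real.cos φ) (heim : e.im ≠ 0)
    (hf : ∀ ζ ∈ wedge φ, ‖ζ‖ < r → ‖f ζ - p ζ‖ ≤ M * ‖ζ‖ ^ (q - 1))
    (hG : ∀ ζ ∈ wedge φ, ‖ζ‖ < r → ‖G ζ - Q ζ‖ ≤ M * ‖ζ‖ ^ q)
    (hT : ∀ ζ : ℂ, ‖ζ‖ < r → ‖T ζ - T 0‖ ≤ M) (hp : ∀ ζ : ℂ, ‖ζ‖ < r → ‖p ζ‖ ≤ M)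
    (hGo : ∀ ζ ∈ wedge φ, ‖ζ‖ < r → v₂ * ‖G ζ - Q ζ‖ ≤ d₀ * α / 4 * ‖ζ‖)
    (hQo : ∀ ζ : ℂ, ‖ζ‖ < r → v₂ * ‖Q ζ - Q 0 - b₁ * ζ‖ ≤ d₀ * α / 4 * ‖ζ‖) :
    Tendsto (fun i => (((N i : ℝ) ^ q : ℝ) : ℂ) *
        (segInt (kern f T G b₀ (N i) (v i)) 0 (L * e) -
          segInt (kern p T Q b₀ (N i) (v i)) 0 (L * e))) l
      (𝓝 (c₁ * rayIntegral (q - 1) (1 - vs * b₁) e +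
        vs * a₁ * rayIntegral q (1 - vs * b₁) e)) := by
  have hew : e.re < Real.cos φ := heα ▸ hαφ
  have hslit : -e ∈ Complex.slitPlane := Or.inr (by simpa using heim)
  have hray : ∀ t ∈ Set.Ioc 0 L, (t * e : ℂ) ∈ wedge φ ∧ ‖(t * e : ℂ)‖ = t :=
    fun t ht => ray_mem_wedge he1 hew ht.1
  have hlt : ∀ t ∈ Set.Ioc 0 L, ‖(t * e : ℂ)‖ < r := fun t ht => by
    rw [(hray t ht).2]; exact ht.2.trans_lt hLr
  have hmD : Set.MapsTo (fun t : ℝ => (t * e : ℂ)) (Set.Ioc 0 L) D := fun t ht =>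
    h.wedge_subset _ (hray t ht).1 ((hlt t ht).trans_le hr₀)
  have hmB : Set.MapsTo (fun t : ℝ => (t * e : ℂ)) (Set.Ioc 0 L) (Metric.ball 0 r₀) :=
    fun t ht => by simpa using (hlt t ht).trans_le hr₀
  have hcr : ContinuousOn (fun t : ℝ => (t * e : ℂ)) (Set.Ioc 0 L) := by fun_prop
  have hv₂ : 0 < v₂ := hv₁.trans_le (hvs.1.trans hvs.2)
  have hray0 : Tendsto (fun t : ℝ => (t : ℂ) * e) (𝓝[>] 0) (𝓝 0) := by
    have : Continuous fun t : ℝ => (t : ℂ) * e := by fun_prop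
    have h := this.tendsto 0
    simp only [Complex.ofReal_zero, zero_mul] at h
    exact h.mono_left nhdsWithin_le_nhds
  have hb0 : Metric.ball (0 : ℂ) r₀ ∈ 𝓝 0 := Metric.ball_mem_nhds 0 h.radius_pos
  have hTc := (h.T_diff'.continuousOn.continuousAt hb0).tendsto.comp hray0
  have hpc := (h.p_diff.continuousOn.continuousAt hb0).tendsto.comp hray0
  rw [h.p_zero] at hpc
  -- The linear term gives decay `d₀ α`; the remainder of `Q` and the difference `G - Q` each
  -- consume a quarter of it, which leaves `κ = d₀ α / 2`.
  have main := tendsto_leg (e := e) (L := L) (M := M) (κ := d₀ * α / 2) (v₂ := v₂) hN hv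
    (by filter_upwards [hvI] with i hi using ⟨hv₁.le.trans hi.1, hi.2⟩) h.one_lt hL (by positivity)
    hM he1 (heα ▸ hα) (hd₀.trans_le (hd vs hvs))
    (h.f_diff.continuousOn.comp hcr hmD) (h.p_diff.continuousOn.comp hcr hmB)
    (h.T_diff'.continuousOn.comp hcr hmB) (h.G_diff.continuousOn.comp hcr hmD)
    (h.Q_diff.continuousOn.comp hcr hmB)
    (fun t ht => by have := hf _ (hray t ht).1 (hlt t ht); rwa [(hray t ht).2] at this)
    (fun t ht => by have := hG _ (hray t ht).1 (hlt t ht); rwa [(hray t ht).2] at this)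
    (fun t ht => hT _ (hlt t ht)) (fun t ht => hp _ (hlt t ht))
    (by
      filter_upwards [hvI] with i hi t ht
      have h1 := hGo _ (hray t ht).1 (hlt t ht)
      have h2 := hQo _ (hlt t ht)
      rw [(hray t ht).2] at h1 h2
      have h3 := re_exponent_Q_le hd hv₁ hi (ζ := t * e)
        (by rw [Complex.re_ofReal_mul, heα]; have := ht.1; positivity) h2
      have h4 : v i * ‖G (t * e) - Q (t * e)‖ ≤ v₂ * ‖G (t * e) - Q (t * e)‖ := by
        have := hi.2; gcongr
      rw [Complex.re_ofReal_mul, heα] at h3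
      linarith)
    (tendsto_ray_of_isLittleO (g := fun ζ => f ζ - p ζ) he1 hew hslit h.f_exp)
    (tendsto_ray_of_isLittleO (g := fun ζ => G ζ - Q ζ) he1 hew hslit h.G_exp)
    hTc hpc h.Q_deriv
  rw [h.Q_zero] at main
  refine main.congr' ?_
  filter_upwards [hvI] with i hi
  obtain ⟨B, hB1, hB2⟩ := h.exists_bound_near_zero (M := max M (d₀ * α / 4)) (r := r) (v₂ := v₂)
    (fun ζ hw hζ => (hf ζ hw hζ).trans (by gcongr; exact le_max_left _ _))
    (fun ζ hw hζ => (hG ζ hw hζ).trans (by gcongr; exact le_max_left _ _))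
    (fun ζ hζ => (hT ζ hζ).trans (le_max_left _ _))
    (fun ζ hζ => (hp ζ hζ).trans (le_max_left _ _))
    (fun ζ hζ => (hQo ζ hζ).trans (by gcongr; exact le_max_right _ _))
    (le_max_of_le_left hM) hv₂ (N i) (w := v i) ⟨hv₁.le.trans hi.1, hi.2⟩
  have hscale : ∀ t ∈ Set.Ioc (0 : ℝ) 1, L * t ∈ Set.Ioc 0 L := fun t ht =>
    ⟨mul_pos hL ht.1, mul_le_of_le_one_right hL.le ht.2⟩
  have hpt : ∀ t : ℝ, (0 : ℂ) + t * (L * e - 0) = ((L * t : ℝ) : ℂ) * e := fun t => by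
    push_cast; ring
  have hcr' : ContinuousOn (fun t : ℝ => ((L * t : ℝ) : ℂ) * e) (Set.Ioc 0 1) := by fun_prop
  rw [segInt_sub (M := B)]
  · simp only [hpt]
    exact (differentiableOn_kern h.f_diff h.T_diff h.G_diff _ _ _).continuousOn.comp hcr'
      fun t ht => hmD (hscale t ht)
  · simp only [hpt]
    exact (differentiableOn_kern h.p_diff h.T_diff' h.Q_diff _ _ _).continuousOn.comp hcr'
      fun t ht => hmB (hscale t ht)
  · intro t ht
    rw [hpt]
    exact hB1 _ (hray _ (hscale t ht)).1 (hlt _ (hscale t ht))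
  · intro t ht
    rw [hpt]
    exact hB2 _ (hlt _ (hscale t ht))

end LocalData

theorem mem_tiltedStrip_iff {φ ρ σ x y : ℝ} :
    (x + y * Complex.I : ℂ) ∈ tiltedStrip φ ρ σ ↔
      x * Real.sin φ < σ * y * Real.cos φ ∧ x < ρ ∧ σ * y < 7 / 2 := by
  simp [tiltedStrip]

theorem exp_mul_I_eq (L ψ : ℝ) : (L : ℂ) * Complex.exp (ψ * Complex.I) =
    (L * Real.cos ψ : ℝ) + (L * Real.sin ψ : ℝ) * Complex.I := by
  rw [Complex.exp_mul_I]
  push_cast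
  ring

namespace LocalData

variable {f T G p Q : ℂ → ℂ} {D : Set ℂ} {φ r₀ b₀ b₁ q : ℝ} {a₁ c₁ : ℂ}
  {ι : Type*} {l : Filter ι} {N : ι → ℕ} {v : ι → ℝ} {vs v₁ v₂ : ℝ}

/-- Limit of the normalised coefficient integral. -/
theorem tendsto_coefficient [l.IsCountablyGenerated]
    (h : LocalData f T G p Q D φ r₀ b₀ b₁ q a₁ c₁)
    (hfper : ∀ z, f (z + 2 * Real.pi * Complex.I) = f z)
    (hTper : ∀ z, T (z + 2 * Real.pi * Complex.I) = T z)
    (hGper : ∀ z, G (z + 2 * Real.pi * Complex.I) = G z)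
    (hN : Tendsto N l atTop) (hv : Tendsto v l (𝓝 vs))
    (hvI : ∀ᶠ i in l, v i ∈ Set.Icc v₁ v₂) (hvs : vs ∈ Set.Icc v₁ v₂) (hv₁ : 0 < v₁)
    {d₀ : ℝ} (hd₀ : 0 < d₀) (hd : ∀ v ∈ Set.Icc v₁ v₂, d₀ ≤ 1 - v * b₁) {C : ℕ → ℝ → ℂ}
    (hC : ∀ (N : ℕ) (v ε : ℝ), 0 < ε → segInt (kern f T G b₀ N v)
      (-ε - Real.pi * Complex.I) (-ε + Real.pi * Complex.I) = C N v) :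
    Tendsto (fun i => (((N i : ℝ) ^ q : ℝ) : ℂ) * C (N i) (v i)) l
      (𝓝 (2 * Real.pi * Complex.I *
        (c₁ * (((1 - vs * b₁) ^ (-q) / Real.Gamma (1 - q) : ℝ) : ℂ) +
          vs * a₁ * (((1 - vs * b₁) ^ (-q - 1) / Real.Gamma (-q) : ℝ) : ℂ)))) := by
  obtain ⟨ψ, L, r, M, c, ρ, hψ, hψ', hL, hLr, hr₀, hc, hM, hLρ, hLφ, hUp, hLo, hf, hG, hT, hp,
    hGo, hQo, hver⟩ := h.exists_contour hv₁ (hvs.1.trans hvs.2) hd₀ hd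
  have hφ := h.angle_pos
  have hq := h.one_lt
  have hcφ := h.cos_pos
  have hsφ := h.sin_pos
  have hψ0 : 0 < ψ := hφ.trans hψ
  have hpi := Real.pi_pos
  have hpi3 := Real.pi_gt_three
  have hpi4 : Real.pi < 7 / 2 := by linarith [Real.pi_lt_d2]
  have hcψ : 0 < Real.cos ψ := Real.cos_pos_of_mem_Ioo ⟨by linarith, hψ'⟩
  have hsψ : 0 < Real.sin ψ := Real.sin_pos_of_pos_of_lt_pi hψ0 (by linarith)
  have hcos : Real.cos ψ < Real.cos φ :=
    Real.cos_lt_cos_of_nonneg_of_le_pi_div_two hφ.le hψ'.le hψ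
  have hv₂ : 0 < v₂ := hv₁.trans_le (hvs.1.trans hvs.2)
  set x := L * Real.cos ψ with hx
  set y := L * Real.sin ψ with hy
  have hx0 : 0 < x := by positivity
  have hy0 : 0 < y := by positivity
  have hL1 : L ≤ 1 := hLφ.trans (Real.cos_le_one φ)
  have hxL : x ≤ L := mul_le_of_le_one_right hL.le (Real.cos_le_one ψ)
  have hyL : y ≤ L := mul_le_of_le_one_right hL.le (Real.sin_le_one ψ)
  have hxy : x * Real.sin φ < y * Real.cos φ := by
    have h1 : 0 < Real.sin (ψ - φ) := Real.sin_pos_of_pos_of_lt_pi (by linarith) (by linarith)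
    rw [Real.sin_sub] at h1
    rw [hx, hy]
    nlinarith
  set e₁ := Complex.exp (ψ * Complex.I) with he₁
  set e₂ := Complex.exp ((-ψ : ℝ) * Complex.I) with he₂
  have hp₁ : (L * e₁ : ℂ) = x + y * Complex.I := exp_mul_I_eq L ψ
  have hp₂ : (L * e₂ : ℂ) = x + (-y : ℝ) * Complex.I := by
    rw [he₂, exp_mul_I_eq L (-ψ), Real.cos_neg, Real.sin_neg, mul_neg]
  have hn₁ : ‖e₁‖ = 1 := Complex.norm_exp_ofReal_mul_I ψ
  have hn₂ : ‖e₂‖ = 1 := Complex.norm_exp_ofReal_mul_I (-ψ)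
  have hre₁ : e₁.re = Real.cos ψ := Complex.exp_ofReal_mul_I_re ψ
  have hre₂ : e₂.re = Real.cos ψ := by rw [he₂, Complex.exp_ofReal_mul_I_re, Real.cos_neg]
  have him₁ : e₁.im ≠ 0 := by rw [he₁, Complex.exp_ofReal_mul_I_im]; exact hsψ.ne'
  have him₂ : e₂.im ≠ 0 := by
    rw [he₂, Complex.exp_ofReal_mul_I_im, Real.sin_neg]; exact (neg_neg_of_pos hsψ).ne
  have leg₁ := h.tendsto_leg_difference hN hv hvI hvs hv₁ hd₀ hd hL hLr hr₀ hM hcψ hn₁ hre₁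
    hcos him₁ hf hG hT hp hGo hQo
  have leg₂ := h.tendsto_leg_difference hN hv hvI hvs hv₁ hd₀ hd hL hLr hr₀ hM hcψ hn₂ hre₂
    hcos him₂ hf hG hT hp hGo hQo
  have hvert₁ : ∀ t ∈ Set.Icc (0 : ℝ) 1,
      (L * e₁ + t * (x + Real.pi * Complex.I - L * e₁) : ℂ) =
        x + ((y + t * (Real.pi - y) : ℝ) : ℂ) * Complex.I ∧
      y ≤ |y + t * (Real.pi - y)| ∧ |y + t * (Real.pi - y)| ≤ 7 / 2 := by
    intro t ht
    have h1 : 0 ≤ t * (Real.pi - y) := mul_nonneg ht.1 (by linarith)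
    have h2 : t * (Real.pi - y) ≤ Real.pi - y := mul_le_of_le_one_left (by linarith) ht.2
    rw [abs_of_nonneg (by linarith), hp₁]
    refine ⟨by push_cast; ring, by linarith, by linarith⟩
  have hvert₂ : ∀ t ∈ Set.Icc (0 : ℝ) 1,
      (L * e₂ + t * (x - Real.pi * Complex.I - L * e₂) : ℂ) =
        x + ((-(y + t * (Real.pi - y)) : ℝ) : ℂ) * Complex.I ∧
      y ≤ |-(y + t * (Real.pi - y))| ∧ |-(y + t * (Real.pi - y))| ≤ 7 / 2 := by
    intro t ht
    obtain ⟨-, h1, h2⟩ := hvert₁ t ht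
    rw [abs_neg, hp₂]
    refine ⟨by push_cast; ring, h1, h2⟩
  have hdK : ∀ (n : ℕ) (w : ℝ), DifferentiableOn ℂ (kern f T G b₀ n w) D := fun n w =>
    differentiableOn_kern h.f_diff h.T_diff h.G_diff _ _ _
  -- The legs translated to the left remain in the wedge, where the integrand is bounded for fixed
  -- `N`; this is the domination needed for `ε → 0`.
  have hshift : ∀ {σ : ℝ} {e : ℂ}, |σ| = 1 → (L * e : ℂ) = x + (σ * y : ℝ) * Complex.I →
      ∀ ε ∈ Set.Ioo 0 (r - L), ∀ t ∈ Set.Icc (0 : ℝ) 1,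
      (-(ε : ℝ) + t * (L * e) : ℂ) ∈ wedge φ ∧ ‖(-(ε : ℝ) + t * (L * e) : ℂ)‖ < r := by
    intro σ e hσ he ε hε t ht
    have hne : ‖(L * e : ℂ)‖ = L := by
      rw [he, Complex.norm_add_mul_I, Real.sqrt_eq_iff_mul_self_eq_of_pos hL, hx, hy]
      have h1 : σ ^ 2 = 1 := by rw [← sq_abs, hσ, one_pow]
      linear_combination -L ^ 2 * Real.sin_sq_add_cos_sq ψ - L ^ 2 * Real.sin ψ ^ 2 * h1
    constructor
    · refine mem_wedge_of_lt hφ h.angle_lt ?_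
      rw [he]
      simp only [Complex.add_re, Complex.neg_re, Complex.ofReal_re, Complex.re_ofReal_mul,
        Complex.add_im, Complex.neg_im, Complex.ofReal_im, Complex.im_ofReal_mul, Complex.I_re,
        Complex.I_im, neg_zero, zero_add, mul_zero, add_zero, mul_one]
      rw [abs_mul, abs_mul, hσ, abs_of_pos hy0, abs_of_nonneg ht.1, one_mul]
      have h1 := mul_le_mul_of_nonneg_left hxy.le ht.1
      have h2 := mul_pos hε.1 hsφ
      linarith
    · refine (norm_add_le _ _).trans_lt ?_
      rw [norm_neg, norm_mul, hne, Complex.norm_real, Complex.norm_real,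
        Real.norm_of_nonneg hε.1.le, Real.norm_of_nonneg ht.1]
      have := mul_le_of_le_one_left hL.le ht.2
      linarith [hε.2]
  have hsh₁ := hshift (σ := 1) (e := e₁) (by simp) (by rw [one_mul]; exact hp₁)
  have hsh₂ := hshift (σ := -1) (e := e₂) (by simp) (by rw [neg_one_mul]; exact hp₂)
  have hstrip : ∀ {σ : ℝ}, |σ| = 1 → ∀ ε ∈ Set.Ioo 0 (r - L), ∀ X Y : ℝ, X ≤ x → Y < 7 / 2 →
      X * Real.sin φ ≤ Y * Real.cos φ →
      (X + (σ * Y : ℝ) * Complex.I - ε : ℂ) ∈ tiltedStrip φ ρ σ := by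
    intro σ hσ ε hε X Y hX hY hXY
    have h1 : σ * (σ * Y) = Y := by
      rw [← mul_assoc, ← pow_two, ← sq_abs, hσ]; ring
    rw [show (X + (σ * Y : ℝ) * Complex.I - ε : ℂ) = ((X - ε : ℝ) : ℂ) + (σ * Y : ℝ) * Complex.I by
      push_cast; ring, mem_tiltedStrip_iff, h1]
    have := mul_pos hε.1 hsφ
    refine ⟨by linarith, by linarith [hε.1], hY⟩
  have hxpi : x * Real.sin φ ≤ Real.pi * Real.cos φ := by
    have h1 : x * Real.sin φ ≤ x := mul_le_of_le_one_right hx0.le (Real.sin_le_one φ)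
    nlinarith
  have hcontour : ∀ᶠ i in l, C (N i) (v i) =
      segInt (kern f T G b₀ (N i) (v i)) 0 (L * e₁) +
        segInt (kern f T G b₀ (N i) (v i)) (L * e₁) (x + Real.pi * Complex.I) -
      (segInt (kern f T G b₀ (N i) (v i)) 0 (L * e₂) +
        segInt (kern f T G b₀ (N i) (v i)) (L * e₂) (x - Real.pi * Complex.I)) := by
    filter_upwards [hvI] with i hi
    obtain ⟨B, hB, -⟩ := h.exists_bound_near_zero (M := max M (d₀ * Real.cos ψ / 4)) (r := r)
      (v₂ := v₂)
      (fun ζ hw hζ => (hf ζ hw hζ).trans (by gcongr; exact le_max_left _ _))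
      (fun ζ hw hζ => (hG ζ hw hζ).trans (by gcongr; exact le_max_left _ _))
      (fun ζ hζ => (hT ζ hζ).trans (le_max_left _ _))
      (fun ζ hζ => (hp ζ hζ).trans (le_max_left _ _))
      (fun ζ hζ => (hQo ζ hζ).trans (by gcongr; exact le_max_right _ _))
      (le_max_of_le_left hM) hv₂ (N i) (w := v i) ⟨hv₁.le.trans hi.1, hi.2⟩
    have hrayD : ∀ {e : ℂ}, ‖e‖ = 1 → e.re = Real.cos ψ → ∀ t ∈ Set.Ioc (0 : ℝ) 1,
        (t * (L * e) : ℂ) ∈ D := by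
      intro e hn hre t ht
      obtain ⟨h1, h2⟩ := ray_mem_wedge (φ := φ) hn (hre ▸ hcos) (mul_pos ht.1 hL)
      rw [show (t * (L * e) : ℂ) = ((t * L : ℝ) : ℂ) * e by push_cast; ring]
      refine h.wedge_subset _ h1 ?_
      rw [h2]
      have := mul_le_of_le_one_left hL.le ht.2
      linarith
    refine eq_legs_add_outer (ε₀ := r - L) (M := B) h.isOpen (hdK _ _)
      (kern_periodic hfper hTper hGper _ _ _)
      (convex_tiltedStrip φ ρ 1) (isOpen_tiltedStrip φ ρ 1) hUp
      (convex_tiltedStrip φ ρ (-1)) (isOpen_tiltedStrip φ ρ (-1)) hLo h.left_subset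
      (by linarith) ?_ ?_ (hrayD hn₁ hre₁) (hrayD hn₂ hre₂)
      (fun ε hε t ht => hB _ (hsh₁ ε hε t ht).1 (hsh₁ ε hε t ht).2)
      (fun ε hε t ht => hB _ (hsh₂ ε hε t ht).1 (hsh₂ ε hε t ht).2)
      (fun t ht => by
        obtain ⟨h1, h2, h3⟩ := hvert₁ t ht
        rw [h1]
        exact (hver _ h2 h3).1)
      (fun t ht => by
        obtain ⟨h1, h2, h3⟩ := hvert₂ t ht
        rw [h1]
        exact (hver _ h2 h3).1)
      (fun ε hε => hC (N i) (v i) ε hε.1)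
    · intro ε hε
      have s := hstrip (σ := 1) (by simp) ε hε
      refine ⟨?_, ?_, ?_, ?_⟩
      · simpa using s 0 0 hx0.le (by norm_num) (by simp)
      · rw [hp₁]
        simpa using s x y le_rfl (by linarith) hxy.le
      · simpa using s x Real.pi le_rfl hpi4 hxpi
      · simpa using s 0 Real.pi hx0.le hpi4 (by rw [zero_mul]; positivity)
    · intro ε hε
      have s := hstrip (σ := -1) (by simp) ε hε
      refine ⟨?_, ?_, ?_, ?_⟩
      · simpa using s 0 0 hx0.le (by norm_num) (by simp)
      · rw [hp₂]
        simpa using s x y le_rfl (by linarith) hxy.le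
      · simpa [sub_eq_add_neg] using s x Real.pi le_rfl hpi4 hxpi
      · simpa using s 0 Real.pi hx0.le hpi4 (by rw [zero_mul]; positivity)
  obtain ⟨B₁, hB₁⟩ : ∃ B : ℝ, ∀ t : ℝ, y ≤ |t| → |t| ≤ 7 / 2 →
      ‖f (x + t * Complex.I)‖ ≤ B ∧ ‖T (x + t * Complex.I) - T 0‖ ≤ B := by
    have hK : IsCompact ((fun t : ℝ => (x : ℂ) + t * Complex.I) ''
        {t : ℝ | y ≤ |t| ∧ |t| ≤ 7 / 2}) := by
      refine IsCompact.image ?_ (by fun_prop)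
      refine isCompact_Icc.of_isClosed_subset (s := Set.Icc (-(7 / 2 : ℝ)) (7 / 2)) ?_ ?_
      · exact (isClosed_le continuous_const continuous_abs).inter
          (isClosed_le continuous_abs continuous_const)
      · exact fun t ht => abs_le.1 ht.2
    have hsub : ((fun t : ℝ => (x : ℂ) + t * Complex.I) '' {t : ℝ | y ≤ |t| ∧ |t| ≤ 7 / 2}) ⊆ D := by
      rintro _ ⟨t, ht, rfl⟩
      exact (hver t ht.1 ht.2).1
    obtain ⟨Bf, hBf⟩ := hK.exists_bound_of_continuousOn (h.f_diff.continuousOn.mono hsub)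
    obtain ⟨BT, hBT⟩ := hK.exists_bound_of_continuousOn
      ((h.T_diff.sub_const (T 0)).continuousOn.mono hsub)
    exact ⟨max Bf BT, fun t h1 h2 => ⟨(hBf _ ⟨t, ⟨h1, h2⟩, rfl⟩).trans (le_max_left _ _),
      (hBT _ ⟨t, ⟨h1, h2⟩, rfl⟩).trans (le_max_right _ _)⟩⟩
  have hverK : ∀ᶠ i in l, ∀ t : ℝ, y ≤ |t| → |t| ≤ 7 / 2 →
      ‖kern f T G b₀ (N i) (v i) (x + t * Complex.I)‖ ≤
        B₁ * Real.exp (v₂ * B₁) * Real.exp (-(c * N i)) := by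
    filter_upwards [hvI] with i hi t h1 h2
    exact norm_kern_le (hv₁.le.trans hi.1) hi.2 (hB₁ t h1 h2).1 (hB₁ t h1 h2).2
      ((hver t h1 h2).2 _ hi)
  have outer₁ : Tendsto (fun i => (((N i : ℝ) ^ q : ℝ) : ℂ) *
      segInt (kern f T G b₀ (N i) (v i)) (L * e₁) (x + Real.pi * Complex.I)) l (𝓝 0) := by
    refine tendsto_rpow_mul_of_norm_le_exp q hN hc
      (B := B₁ * Real.exp (v₂ * B₁) * ‖(x + Real.pi * Complex.I - L * e₁ : ℂ)‖) ?_
    filter_upwards [hverK] with i hi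
    refine (norm_segInt_le (fun t ht => ?_)).trans_eq (mul_right_comm _ _ _)
    obtain ⟨h1, h2, h3⟩ := hvert₁ t ht
    rw [h1]
    exact hi _ h2 h3
  have outer₂ : Tendsto (fun i => (((N i : ℝ) ^ q : ℝ) : ℂ) *
      segInt (kern f T G b₀ (N i) (v i)) (L * e₂) (x - Real.pi * Complex.I)) l (𝓝 0) := by
    refine tendsto_rpow_mul_of_norm_le_exp q hN hc
      (B := B₁ * Real.exp (v₂ * B₁) * ‖(x - Real.pi * Complex.I - L * e₂ : ℂ)‖) ?_
    filter_upwards [hverK] with i hi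
    refine (norm_segInt_le (fun t ht => ?_)).trans_eq (mul_right_comm _ _ _)
    obtain ⟨h1, h2, h3⟩ := hvert₂ t ht
    rw [h1]
    exact hi _ h2 h3
  have hchord : ∀ t ∈ Set.Icc (0 : ℝ) 1,
      (L * e₂ + t * (L * e₁ - L * e₂) : ℂ).re = x ∧
        ‖(L * e₂ + t * (L * e₁ - L * e₂) : ℂ)‖ ≤ L := by
    intro t ht
    constructor
    · rw [hp₁, hp₂]
      simp
    · have m₁ : (L * e₁ : ℂ) ∈ Metric.closedBall (0 : ℂ) L := by
        simp [hn₁, abs_of_pos hL]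
      have m₂ : (L * e₂ : ℂ) ∈ Metric.closedBall (0 : ℂ) L := by
        simp [hn₂, abs_of_pos hL]
      simpa using add_mul_sub_mem_of_convex (convex_closedBall (0 : ℂ) L) m₂ m₁ ht
  -- On the chord `Re ζ = x`, and the Taylor remainder of `Q` costs at most `d₀ x / 4` out of `d₀
  -- x`.
  have inner : Tendsto (fun i => (((N i : ℝ) ^ q : ℝ) : ℂ) *
      segInt (kern p T Q b₀ (N i) (v i)) (L * e₂) (L * e₁)) l (𝓝 0) := by
    refine tendsto_rpow_mul_of_norm_le_exp q hN (c := d₀ * x / 2) (by positivity)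
      (B := M * Real.exp (v₂ * M) * ‖(L * e₁ - L * e₂ : ℂ)‖) ?_
    filter_upwards [hvI] with i hi
    refine (norm_segInt_le (fun t ht => ?_)).trans_eq (mul_right_comm _ _ _)
    obtain ⟨h1, h2⟩ := hchord t ht
    refine norm_kern_le (hv₁.le.trans hi.1) hi.2 (hp _ (h2.trans_lt hLr)) (hT _ (h2.trans_lt hLr)) ?_
    have h3 := re_exponent_Q_le hd hv₁ hi (by rw [h1]; exact hx0.le) (hQo _ (h2.trans_lt hLr))
    rw [← h.Q_zero]
    refine h3.trans ?_
    rw [h1]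
    have h4 : d₀ * Real.cos ψ / 4 * ‖(L * e₂ + t * (L * e₁ - L * e₂) : ℂ)‖ ≤
        d₀ * Real.cos ψ / 4 * L := by gcongr
    have h5 : d₀ * Real.cos ψ / 4 * L = d₀ * x / 4 := by rw [hx]; ring
    have h6 : 0 < d₀ * x := by positivity
    linarith
  -- The comparison integrand has no singularity at `0`, so its two legs may be replaced by the
  -- chord joining their ends.
  have hball : ∀ i, segInt (kern p T Q b₀ (N i) (v i)) 0 (L * e₁) -
      segInt (kern p T Q b₀ (N i) (v i)) 0 (L * e₂) =
      segInt (kern p T Q b₀ (N i) (v i)) (L * e₂) (L * e₁) := by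
    intro i
    have m0 : (0 : ℂ) ∈ Metric.ball (0 : ℂ) r₀ := Metric.mem_ball_self h.radius_pos
    have m₁ : (L * e₁ : ℂ) ∈ Metric.ball (0 : ℂ) r₀ := by
      simpa [hn₁, abs_of_pos hL] using hLr.trans_le hr₀
    have m₂ : (L * e₂ : ℂ) ∈ Metric.ball (0 : ℂ) r₀ := by
      simpa [hn₂, abs_of_pos hL] using hLr.trans_le hr₀
    have := segInt_add (convex_ball (0 : ℂ) r₀) Metric.isOpen_ball
      (differentiableOn_kern h.p_diff h.T_diff' h.Q_diff b₀ (N i) (v i)) m0 m₂ m₁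
    linear_combination -this
  have hdpos : 0 < 1 - vs * b₁ := hd₀.trans_le (hd vs hvs)
  have hH₁ := rayIntegral_sub (s := q - 1) (by linarith) hdpos hψ0 hψ'
  have hH₂ := rayIntegral_sub (s := q) (by linarith) hdpos hψ0 hψ'
  rw [← he₁, ← he₂] at hH₁ hH₂
  rw [show -(q - 1) - 1 = -q by ring, show -(q - 1) = 1 - q by ring] at hH₁
  -- The integral is exactly the difference of the corrected legs, plus the outer segments, plus the
  -- chord; only the legs survive in the limit.
  have total := (((leg₁.sub leg₂).add outer₁).sub outer₂).add inner
  refine (total.congr' ?_).trans_eq ?_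
  · filter_upwards [hcontour] with i hi
    rw [hi]
    linear_combination -(((N i : ℝ) ^ q : ℝ) : ℂ) * hball i
  · congr 1
    linear_combination c₁ * hH₁ + vs * a₁ * hH₂

end LocalData

/-! ### The domain `Δ₀` seen in the exponential coordinate. -/

section Domain

variable {R η φ : ℝ}

/-- The cosine is strictly decreasing on `[0, π]`, which trades the argument for an open condition;
the vertex is excluded automatically, as the inequality would read `0 < 0`. -/
theorem mem_Delta0_iff (hφ : 0 < φ) (hφ' : φ < Real.pi / 2) {z : ℂ} :
    z ∈ Delta0 R η φ ↔ ‖z‖ < ‖(R : ℂ) * (1 + η * Complex.exp (φ * Complex.I))‖ ∧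
      (z - R).re < ‖z - R‖ * Real.cos φ := by
  rw [Delta0, Set.mem_ofPred_eq]
  refine and_congr_right fun _ => ?_
  by_cases hz : z = R
  · simp [hz]
  have h0 : 0 < ‖z - R‖ := norm_pos_iff.2 (sub_ne_zero.2 hz)
  have h1 : φ < |Complex.arg (z - R)| ↔ Real.cos |Complex.arg (z - R)| < Real.cos φ :=
    (Real.strictAntiOn_cos.lt_iff_gt ⟨abs_nonneg _, Complex.abs_arg_le_pi _⟩
      ⟨hφ.le, by linarith [Real.pi_pos]⟩).symm
  rw [Real.cos_abs] at h1
  rw [h1, ← Complex.norm_mul_cos_arg (z - R), mul_lt_mul_iff_right₀ h0]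
  simp [hz]

theorem isOpen_Delta0 (hφ : 0 < φ) (hφ' : φ < Real.pi / 2) : IsOpen (Delta0 R η φ) := by
  have : Delta0 R η φ = {z | ‖z‖ < ‖(R : ℂ) * (1 + η * Complex.exp (φ * Complex.I))‖} ∩
      {z : ℂ | (z - R).re < ‖z - R‖ * Real.cos φ} := Set.ext fun z => mem_Delta0_iff hφ hφ'
  rw [this]
  exact (isOpen_lt (by fun_prop) (by fun_prop)).inter (isOpen_lt (by fun_prop) (by fun_prop))

theorem lt_outer_radius (hR : 0 < R) (hη : 0 < η) (hφ : 0 < φ) (hφ' : φ < Real.pi / 2) :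
    R < ‖(R : ℂ) * (1 + η * Complex.exp (φ * Complex.I))‖ := by
  have hc : 0 < Real.cos φ := Real.cos_pos_of_mem_Ioo ⟨by linarith, hφ'⟩
  have h1 : (1 + η * Complex.exp (φ * Complex.I)).re = 1 + η * Real.cos φ := by
    rw [Complex.add_re, Complex.re_ofReal_mul, Complex.exp_ofReal_mul_I_re, Complex.one_re]
  have h2 := Complex.re_le_norm (1 + η * Complex.exp (φ * Complex.I))
  rw [norm_mul, Complex.norm_real, Real.norm_of_nonneg hR.le]
  have h3 : 0 < η * Real.cos φ := by positivity
  nlinarith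

theorem norm_mul_exp (hR : 0 < R) (ζ : ℂ) : ‖(R * Complex.exp ζ : ℂ)‖ = R * Real.exp ζ.re := by
  rw [norm_mul, Complex.norm_real, Real.norm_of_nonneg hR.le, Complex.norm_exp]

theorem mem_Delta0_of_re_lt (hφ : 0 < φ) (hφ' : φ < Real.pi / 2) {z : ℂ}
    (hz : ‖z‖ < ‖(R : ℂ) * (1 + η * Complex.exp (φ * Complex.I))‖) (hre : z.re < R) :
    z ∈ Delta0 R η φ := by
  have hc : 0 < Real.cos φ := Real.cos_pos_of_mem_Ioo ⟨by linarith, hφ'⟩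
  refine (mem_Delta0_iff hφ hφ').2 ⟨hz, lt_of_lt_of_le ?_ (by positivity : (0 : ℝ) ≤ _)⟩
  simpa using hre

theorem ball_subset_Delta0 (hR : 0 < R) (hη : 0 < η) (hφ : 0 < φ) (hφ' : φ < Real.pi / 2) :
    Metric.ball 0 R ⊆ Delta0 R η φ := by
  intro z hz
  rw [mem_ball_zero_iff] at hz
  exact mem_Delta0_of_re_lt hφ hφ' (hz.trans (lt_outer_radius hR hη hφ hφ'))
    ((Complex.re_le_norm z).trans_lt hz)

theorem mul_exp_mem_Delta0_of_re_neg (hR : 0 < R) (hη : 0 < η) (hφ : 0 < φ)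
    (hφ' : φ < Real.pi / 2) {ζ : ℂ} (hζ : ζ.re < 0) : (R * Complex.exp ζ : ℂ) ∈ Delta0 R η φ := by
  refine ball_subset_Delta0 hR hη hφ hφ' ?_
  rw [mem_ball_zero_iff, norm_mul_exp hR]
  have := Real.exp_lt_one_iff.2 hζ
  nlinarith

theorem mul_exp_mul_I_mem_Delta0 (hR : 0 < R) (hη : 0 < η) (hφ : 0 < φ)
    (hφ' : φ < Real.pi / 2) {y : ℝ} (hy : y ≠ 0) (hy' : |y| ≤ 7 / 2) :
    (R * Complex.exp (y * Complex.I) : ℂ) ∈ Delta0 R η φ := by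
  refine mem_Delta0_of_re_lt hφ hφ' ?_ ?_
  · rw [norm_mul_exp hR]
    simpa using lt_outer_radius hR hη hφ hφ'
  · rw [Complex.re_ofReal_mul, Complex.exp_ofReal_mul_I_re]
    have h1 : Real.cos y ≠ 1 := by
      have := abs_le.1 hy'
      have := Real.pi_gt_three
      rw [Ne, Real.cos_eq_one_iff_of_lt_of_lt (by linarith) (by linarith)]
      exact hy
    have := lt_of_le_of_ne (Real.cos_le_one y) h1
    nlinarith

/-- `R e^ζ - R` equals `R ζ` up to a quadratic error, so directions turn only by `O(‖ζ‖)`; the gap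
between `φ` and `φ₁` absorbs this. -/
theorem exists_wedge_subset (hR : 0 < R) (hη : 0 < η) (hφ : 0 < φ) {φ₁ : ℝ} (hφφ₁ : φ < φ₁)
    (hφ₁ : φ₁ < Real.pi / 2) : ∃ r > 0, ∀ ζ ∈ wedge φ₁, ‖ζ‖ < r →
      (R * Complex.exp ζ : ℂ) ∈ Delta0 R η φ := by
  have hφ' : φ < Real.pi / 2 := hφφ₁.trans hφ₁
  have hc : 0 < Real.cos φ := Real.cos_pos_of_mem_Ioo ⟨by linarith, hφ'⟩
  have hcos : Real.cos φ₁ < Real.cos φ :=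
    Real.cos_lt_cos_of_nonneg_of_le_pi_div_two hφ.le hφ₁.le hφφ₁
  have hc1 := Real.cos_le_one φ
  have hcont : ∀ᶠ ζ : ℂ in 𝓝 0,
      ‖(R * Complex.exp ζ : ℂ)‖ < ‖(R : ℂ) * (1 + η * Complex.exp (φ * Complex.I))‖ := by
    have : ContinuousAt (fun ζ : ℂ => ‖(R * Complex.exp ζ : ℂ)‖) 0 := by fun_prop
    refine this.eventually_lt continuousAt_const ?_
    simpa [abs_of_pos hR] using lt_outer_radius hR hη hφ hφ'
  obtain ⟨r, hr, hball⟩ := Metric.eventually_nhds_iff.1 hcont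
  set k := (Real.cos φ - Real.cos φ₁) / 2 with hk
  have hk0 : 0 < k := by rw [hk]; linarith
  refine ⟨min r (min 1 k), by positivity, fun ζ hw hζ => ?_⟩
  have hζr : ‖ζ‖ < r := hζ.trans_le (min_le_left _ _)
  have hζ1 : ‖ζ‖ < 1 := hζ.trans_le ((min_le_right _ _).trans (min_le_left _ _))
  have hζk : ‖ζ‖ < k := hζ.trans_le ((min_le_right _ _).trans (min_le_right _ _))
  refine (mem_Delta0_iff hφ hφ').2 ⟨hball (by simpa using hζr), ?_⟩
  have h1 := Complex.norm_exp_sub_one_sub_id_le hζ1.le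
  have hz : (R * Complex.exp ζ - R : ℂ) = R * (Complex.exp ζ - 1) := by ring
  rw [hz, Complex.re_ofReal_mul, norm_mul, Complex.norm_real, Real.norm_of_nonneg hR.le, mul_assoc]
  refine mul_lt_mul_of_pos_left ?_ hR
  have hw : ζ.re < ‖ζ‖ * Real.cos φ₁ := hw
  have hn : 0 < ‖ζ‖ := by
    rcases (norm_nonneg ζ).eq_or_lt with h0 | h0
    · rw [norm_eq_zero.1 h0.symm] at hw
      simp at hw
    · exact h0
  have h2 : (Complex.exp ζ - 1).re ≤ ζ.re + ‖ζ‖ ^ 2 := by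
    have := (Complex.re_le_norm _).trans h1
    simp only [Complex.sub_re] at this ⊢
    linarith
  have h3 : ‖ζ‖ - ‖ζ‖ ^ 2 ≤ ‖Complex.exp ζ - 1‖ := by
    have := norm_sub_norm_le ζ (ζ - (Complex.exp ζ - 1))
    rw [sub_sub_cancel, norm_sub_rev ζ] at this
    linarith
  have h4 : (‖ζ‖ - ‖ζ‖ ^ 2) * Real.cos φ ≤ ‖Complex.exp ζ - 1‖ * Real.cos φ := by gcongr
  have h5 : ‖ζ‖ ^ 2 < ‖ζ‖ * k := by nlinarith
  have h6 : ‖ζ‖ ^ 2 * Real.cos φ ≤ ‖ζ‖ ^ 2 := mul_le_of_le_one_right (by positivity) hc1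
  have h7 : ‖ζ‖ * k = (‖ζ‖ * Real.cos φ - ‖ζ‖ * Real.cos φ₁) / 2 := by rw [hk]; ring
  nlinarith

theorem tendsto_mul_exp (hR : 0 < R) (hη : 0 < η) (hφ : 0 < φ) {φ₁ : ℝ} (hφφ₁ : φ < φ₁)
    (hφ₁ : φ₁ < Real.pi / 2) :
    Tendsto (fun ζ : ℂ => R * Complex.exp ζ) (𝓝[wedge φ₁] 0) (𝓝[Delta0 R η φ] (R : ℂ)) := by
  refine tendsto_nhdsWithin_iff.2 ⟨?_, ?_⟩
  · have : Continuous fun ζ : ℂ => (R : ℂ) * Complex.exp ζ := by fun_prop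
    have h := this.tendsto 0
    rw [Complex.exp_zero, mul_one] at h
    exact h.mono_left nhdsWithin_le_nhds
  · obtain ⟨r, hr, hsub⟩ := exists_wedge_subset hR hη hφ hφφ₁ hφ₁
    rw [eventually_nhdsWithin_iff]
    filter_upwards [Metric.ball_mem_nhds (0 : ℂ) hr] with ζ hζ hw
    exact hsub ζ hw (by simpa using hζ)

end Domain

/-! ### Singular expansions in powers of `1 - e^ζ`. -/

section Expansion

theorem isBigO_one_sub_exp_rpow (φ : ℝ) {s : ℝ} (hs : 0 ≤ s) :
    (fun ζ : ℂ => ‖1 - Complex.exp ζ‖ ^ s) =O[𝓝[wedge φ] 0] fun ζ : ℂ => ‖ζ‖ ^ s := by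
  have h := (isBigO_one_sub_exp_cpow s hs).norm_left
  simp only [Complex.norm_cpow_real] at h
  exact h.mono nhdsWithin_le_nhds

theorem isLittleO_norm_rpow (φ : ℝ) {s t : ℝ} (hst : s < t) :
    (fun ζ : ℂ => ‖ζ‖ ^ t) =o[𝓝[wedge φ] 0] fun ζ : ℂ => ‖ζ‖ ^ s := by
  have h2 : Tendsto (fun ζ : ℂ => ‖ζ‖ ^ (t - s)) (𝓝[wedge φ] 0) (𝓝 0) := by
    have h3 : Tendsto (fun ζ : ℂ => ‖ζ‖) (𝓝[wedge φ] 0) (𝓝 0) := by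
      have := (continuous_norm (E := ℂ)).tendsto 0
      rw [norm_zero] at this
      exact this.mono_left nhdsWithin_le_nhds
    have := h3.rpow_const (p := t - s) (Or.inr (by linarith))
    rwa [Real.zero_rpow (by linarith)] at this
  have h4 : (fun ζ : ℂ => ‖ζ‖ ^ (t - s) * ‖ζ‖ ^ s) =o[𝓝[wedge φ] 0]
      fun ζ : ℂ => (1 : ℝ) * ‖ζ‖ ^ s :=
    ((isLittleO_one_iff ℝ).2 h2).mul_isBigO (isBigO_refl _ _)
  refine h4.congr' ?_ (Eventually.of_forall fun ζ => one_mul _)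
  filter_upwards [self_mem_nhdsWithin] with ζ hζ
  have hne : 0 < ‖ζ‖ := by
    rcases (norm_nonneg ζ).eq_or_lt with h0 | h0
    · have hw : ζ.re < ‖ζ‖ * Real.cos φ := hζ
      rw [norm_eq_zero.1 h0.symm] at hw
      simp at hw
    · exact h0
  rw [← Real.rpow_add hne, sub_add_cancel]

/-- Truncating a singular expansion with exponent `s` at an order `u ≤ s`. -/
theorem isLittleO_of_expansion {g P : ℂ → ℂ} {φ s δ : ℝ} {a : ℂ} (hs : 0 < s) (hδ : 0 < δ)
    (hg : (fun ζ => g ζ - P ζ - a * (1 - Complex.exp ζ) ^ (s : ℂ))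
      =O[𝓝[wedge φ] 0] fun ζ => ‖1 - Complex.exp ζ‖ ^ (s + δ)) {u : ℝ} (hu : u ≤ s) :
    (fun ζ => g ζ - P ζ - (if u = s then a else 0) * (1 - Complex.exp ζ) ^ (u : ℂ))
      =o[𝓝[wedge φ] 0] fun ζ => ‖ζ‖ ^ u := by
  have h1 := hg.trans (isBigO_one_sub_exp_rpow φ (s := s + δ) (by linarith))
  have h2 := h1.trans_isLittleO (isLittleO_norm_rpow φ (s := s) (t := s + δ) (by linarith))
  rcases hu.eq_or_lt with rfl | hlt
  · simpa using h2
  · have h3 := ((isBigO_one_sub_exp_cpow s hs.le).mono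
      nhdsWithin_le_nhds (l := 𝓝[wedge φ] 0)).const_mul_left a
    have h4 := ((h2.isBigO.add h3).congr_left fun ζ => sub_add_cancel _ _).trans_isLittleO
      (isLittleO_norm_rpow φ hlt)
    simpa [hlt.ne] using h4

/-- The polynomial `∑_{n < m} p_n (1 - e^ζ)^n`. -/
noncomputable def expPoly (c : ℕ → ℂ) (m : ℕ) (ζ : ℂ) : ℂ :=
  ∑ n ∈ Finset.range m, c n * (1 - Complex.exp ζ) ^ n

theorem differentiable_expPoly (c : ℕ → ℂ) (m : ℕ) : Differentiable ℂ (expPoly c m) := by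
  unfold expPoly
  fun_prop

theorem expPoly_zero (c : ℕ → ℂ) {m : ℕ} (hm : 0 < m) : expPoly c m 0 = c 0 := by
  rw [expPoly, Finset.sum_eq_single_of_mem 0 (by simpa using hm)]
  · simp
  · intro n _ hn
    simp [hn]

theorem hasDerivAt_expPoly_zero (c : ℕ → ℂ) {m : ℕ} (hm : 1 < m) :
    HasDerivAt (expPoly c m) (-c 1) 0 := by
  have h1 : HasDerivAt (expPoly c m) (∑ n ∈ Finset.range m,
      c n * (n * (1 - Complex.exp 0) ^ (n - 1) * (-Complex.exp 0))) 0 := by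
    refine HasDerivAt.fun_sum fun n _ => ?_
    exact (((Complex.hasDerivAt_exp 0).const_sub 1).fun_pow n).const_mul (c n)
  convert h1 using 1
  rw [Finset.sum_eq_single_of_mem 1 (by simpa using hm)]
  · simp
  · intro n _ hn
    rcases Nat.eq_zero_or_pos n with rfl | hn0
    · simp
    · simp [show n - 1 ≠ 0 by omega]

end Expansion

/-! ### Strict maximality at `R` on the circle, from non-arithmeticity. -/

section Positivity

variable {κ : ℕ → ℝ}

theorem genCoeff_nonneg (hκ : ∀ j, 1 ≤ j → 0 ≤ κ j) (j : ℕ) : 0 ≤ genCoeff κ j := by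
  rcases Nat.eq_zero_or_pos j with rfl | hj
  · simp [genCoeff]
  · exact div_nonneg (hκ j hj) (Nat.cast_nonneg _)

/-- The integers `n` with `n y ∈ 2πℤ` form a subgroup `dℤ`. If it contained every `j` with `κ j ≠
0`, non-arithmeticity would leave `|d| ≤ 1`; `d = 0` is excluded by a positive `κ j`, and `|d| = 1`
forces `cos y = 1`. -/
theorem NonArithmetic.exists_cos_ne_one (hNA : NonArithmetic κ) {y : ℝ} (hy : Real.cos y ≠ 1) :
    ∃ j : ℕ, 1 ≤ j ∧ κ j ≠ 0 ∧ Real.cos (j * y) ≠ 1 := by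
  by_contra! hcon
  obtain ⟨d, hd⟩ := Int.subgroup_cyclic
    ((AddSubgroup.zmultiples (2 * Real.pi)).comap (zmultiplesHom ℝ y))
  have hmem : ∀ n : ℤ, Real.cos (n * y) = 1 ↔ d ∣ n := by
    intro n
    have h1 : n ∈ (AddSubgroup.zmultiples (2 * Real.pi)).comap (zmultiplesHom ℝ y) ↔
        Real.cos (n * y) = 1 := by
      rw [AddSubgroup.mem_comap, AddSubgroup.mem_zmultiples_iff, Real.cos_eq_one_iff]
      simp
    rw [← h1, hd, ← AddSubgroup.zmultiples_eq_closure, Int.mem_zmultiples_iff]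
  have hdiv : ∀ j : ℕ, 1 ≤ j → κ j ≠ 0 → d.natAbs ∣ j := by
    intro j hj hκj
    rw [← Int.natCast_dvd_natCast, Int.natAbs_dvd]
    refine (hmem j).1 ?_
    exact_mod_cast hcon j hj hκj
  obtain ⟨h1, j, hj2, hj⟩ := hNA
  have hd1 : ¬ 1 < d.natAbs := fun h => h1 ⟨_, h, hdiv⟩
  have hjd := hdiv j (by omega) hj.ne'
  interval_cases hd' : d.natAbs
  · rw [zero_dvd_iff] at hjd
    omega
  · have : d ∣ (1 : ℤ) := by rw [← Int.natAbs_dvd, hd']; simp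
    have := (hmem 1).2 this
    simp only [Int.cast_one, one_mul] at this
    exact hy this

/-- Strict maximality of `Re g` at `R` on the circle of radius `R`. -/
theorem re_lt_of_nonArithmetic (hκ : ∀ j, 1 ≤ j → 0 ≤ κ j) (hNA : NonArithmetic κ) {R : ℝ}
    (hR : 0 < R) {g : ℂ → ℂ}
    (hg : ∀ z : ℂ, ‖z‖ < R → HasSum (fun j : ℕ => (genCoeff κ j : ℂ) * z ^ j) (g z)) {b₀ : ℝ}
    (hb : Tendsto (fun r : ℝ => g r) (𝓝[<] R) (𝓝 b₀)) {y : ℝ} (hy : Real.cos y ≠ 1)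
    (hc : ContinuousAt g (R * Complex.exp (y * Complex.I))) :
    (g (R * Complex.exp (y * Complex.I))).re < b₀ := by
  obtain ⟨j, hj, hκj, hcos⟩ := hNA.exists_cos_ne_one hy
  -- A single index with `cos (j y) ≠ 1` gives the defect `A r^j` inside the disc. It stays bounded
  -- away from `0` as `r → R`, so strictness survives the limit.
  set A : ℝ := genCoeff κ j * (1 - Real.cos (j * y)) with hA
  have hApos : 0 < A := by
    refine mul_pos (div_pos ((hκ j hj).lt_of_ne' hκj) (by exact_mod_cast hj)) ?_
    have := lt_of_le_of_ne (Real.cos_le_one (j * y)) hcos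
    linarith
  have hle : ∀ r ∈ Set.Ioo 0 R, (g (r * Complex.exp (y * Complex.I))).re ≤ (g r).re - A * r ^ j := by
    intro r hr
    have hn : ‖(r : ℂ)‖ = r := by rw [Complex.norm_real, Real.norm_of_nonneg hr.1.le]
    have h1 := Complex.hasSum_re (hg r (by rw [hn]; exact hr.2))
    have h2 := Complex.hasSum_re (hg (r * Complex.exp (y * Complex.I)) (by
      rw [norm_mul, hn, Complex.norm_exp_ofReal_mul_I, mul_one]; exact hr.2))
    have h3 := h1.sub h2
    have hterm : ∀ k : ℕ, ((genCoeff κ k : ℂ) * (r : ℂ) ^ k).re -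
        ((genCoeff κ k : ℂ) * (r * Complex.exp (y * Complex.I)) ^ k).re =
        genCoeff κ k * (1 - Real.cos (k * y)) * r ^ k := by
      intro k
      rw [mul_pow, ← Complex.exp_nat_mul, ← mul_assoc (k : ℂ), ← Complex.ofReal_natCast,
        ← Complex.ofReal_mul, ← Complex.ofReal_pow, Complex.re_ofReal_mul, Complex.re_ofReal_mul,
        Complex.re_ofReal_mul, Complex.exp_ofReal_mul_I_re, Complex.ofReal_re]
      ring
    simp only [hterm] at h3
    have h4 := le_hasSum h3 j fun k _ => by
      have := genCoeff_nonneg hκ k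
      have := Real.cos_le_one (k * y)
      have := hr.1.le
      have : 0 ≤ 1 - Real.cos (k * y) := by linarith
      positivity
    linarith
  have hev : ∀ᶠ r : ℝ in 𝓝[<] R, r ∈ Set.Ioo 0 R := Ioo_mem_nhdsLT hR
  have l1 : Tendsto (fun r : ℝ => (g (r * Complex.exp (y * Complex.I))).re) (𝓝[<] R)
      (𝓝 (g (R * Complex.exp (y * Complex.I))).re) := by
    have h1 : Tendsto (fun r : ℝ => (r * Complex.exp (y * Complex.I) : ℂ)) (𝓝[<] R)
        (𝓝 (R * Complex.exp (y * Complex.I))) := by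
      have : Continuous fun r : ℝ => (r * Complex.exp (y * Complex.I) : ℂ) := by fun_prop
      exact (this.tendsto R).mono_left nhdsWithin_le_nhds
    exact (Complex.continuous_re.tendsto _).comp (hc.tendsto.comp h1)
  have l2 : Tendsto (fun r : ℝ => (g r).re - A * r ^ j) (𝓝[<] R) (𝓝 (b₀ - A * R ^ j)) := by
    have h1 := (Complex.continuous_re.tendsto _).comp hb
    have h2 : Tendsto (fun r : ℝ => A * r ^ j) (𝓝[<] R) (𝓝 (A * R ^ j)) := by
      have : Continuous fun r : ℝ => A * r ^ j := by fun_prop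
      exact (this.tendsto R).mono_left nhdsWithin_le_nhds
    simpa using h1.sub h2
  have := le_of_tendsto_of_tendsto l1 l2 (by filter_upwards [hev] with r hr using hle r hr)
  have h5 : 0 < A * R ^ j := by positivity
  linarith

end Positivity

/-! ### Construction of the local data from the expansions at `R`. -/

section Transfer

variable {R η φ : ℝ}

theorem tendsto_of_expansion {g : ℂ → ℂ} {cg : ℕ → ℂ} {m : ℕ} (hm : 0 < m) {a : ℂ} {s δ : ℝ}
    (hs : 0 < s) (hδ : 0 < δ) (hR : 0 < R) {S : Set ℂ}
    (hexp : (fun z : ℂ => g z - ((∑ n ∈ Finset.range m, cg n * (1 - z / R) ^ n) +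
      a * (1 - z / R) ^ (s : ℂ))) =O[𝓝[S] (R : ℂ)] fun z : ℂ => ‖1 - z / R‖ ^ (s + δ)) :
    Tendsto g (𝓝[S] (R : ℂ)) (𝓝 (cg 0)) := by
  have hRne : (R : ℂ) ≠ 0 := by exact_mod_cast hR.ne'
  have hw : Tendsto (fun z : ℂ => 1 - z / R) (𝓝[S] (R : ℂ)) (𝓝 0) := by
    have : Continuous fun z : ℂ => 1 - z / R := by fun_prop
    have h := this.tendsto R
    rw [div_self hRne, sub_self] at h
    exact h.mono_left nhdsWithin_le_nhds
  have hn : Tendsto (fun z : ℂ => ‖1 - z / R‖) (𝓝[S] (R : ℂ)) (𝓝 0) := by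
    simpa using hw.norm
  have hpow : ∀ {t : ℝ}, 0 < t → Tendsto (fun z : ℂ => ‖1 - z / R‖ ^ t) (𝓝[S] (R : ℂ)) (𝓝 0) := by
    intro t ht
    have := hn.rpow_const (p := t) (Or.inr ht.le)
    rwa [Real.zero_rpow ht.ne'] at this
  have h1 := hexp.trans_tendsto (hpow (by linarith))
  have h2 : Tendsto (fun z : ℂ => a * (1 - z / R) ^ (s : ℂ)) (𝓝[S] (R : ℂ)) (𝓝 0) := by
    have : Tendsto (fun z : ℂ => (1 - z / R) ^ (s : ℂ)) (𝓝[S] (R : ℂ)) (𝓝 0) := by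
      rw [tendsto_zero_iff_norm_tendsto_zero]
      simpa only [Complex.norm_cpow_real] using hpow hs
    simpa using this.const_mul a
  have h3 : Tendsto (fun z : ℂ => ∑ n ∈ Finset.range m, cg n * (1 - z / R) ^ n) (𝓝[S] (R : ℂ))
      (𝓝 (cg 0)) := by
    have h := tendsto_finsetSum (Finset.range m) fun n _ => (hw.pow n).const_mul (cg n)
    rwa [Finset.sum_eq_single_of_mem 0 (by simpa using hm) (fun n _ hn => by simp [hn]),
      pow_zero, mul_one] at h
  have h4 := h1.add (h3.add h2)
  rw [add_zero, zero_add] at h4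
  exact h4.congr fun z => by ring

/-- `1 - z / R` becomes exactly `1 - e^ζ`, so the coefficients carry over unchanged; this is why the
comparison functions are polynomials in `1 - e^ζ` and not in `ζ`. -/
theorem expansion_exp {g : ℂ → ℂ} {cg : ℕ → ℂ} {m : ℕ} {a : ℂ} {s t : ℝ} (hR : 0 < R)
    (hη : 0 < η) (hφ : 0 < φ) {φ₁ : ℝ} (hφφ₁ : φ < φ₁) (hφ₁ : φ₁ < Real.pi / 2)
    (hexp : (fun z : ℂ => g z - ((∑ n ∈ Finset.range m, cg n * (1 - z / R) ^ n) +
      a * (1 - z / R) ^ (s : ℂ))) =O[𝓝[Delta0 R η φ] (R : ℂ)] fun z : ℂ => ‖1 - z / R‖ ^ t) :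
    (fun ζ : ℂ => g (R * Complex.exp ζ) - expPoly cg m ζ - a * (1 - Complex.exp ζ) ^ (s : ℂ))
      =O[𝓝[wedge φ₁] 0] fun ζ => ‖1 - Complex.exp ζ‖ ^ t := by
  have hRne : (R : ℂ) ≠ 0 := by exact_mod_cast hR.ne'
  have h := hexp.comp_tendsto (tendsto_mul_exp hR hη hφ hφφ₁ hφ₁)
  simp only [Function.comp_def, mul_div_cancel_left₀ _ hRne] at h
  exact h.congr_left fun ζ => by rw [expPoly]; ring

/-- From the expansions at `R` to the local data in the exponential coordinate. -/
theorem exists_localData {κ : ℕ → ℝ} (hκ : ∀ j, 1 ≤ j → 0 ≤ κ j) (hNA : NonArithmetic κ)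
    (hR : 0 < R) (hη : 0 < η) (hφ : 0 < φ) (hφ' : φ < Real.pi / 2) {gκ gθ f : ℂ → ℂ}
    (hgκ : ∀ z : ℂ, ‖z‖ < R → HasSum (fun j : ℕ => (genCoeff κ j : ℂ) * z ^ j) (gκ z))
    (hgκ' : DifferentiableOn ℂ gκ (Delta0 R η φ)) (hgθ' : DifferentiableOn ℂ gθ (Delta0 R η φ))
    (hgθR : AnalyticAt ℂ gθ (R : ℂ)) (hf' : DifferentiableOn ℂ f (Delta0 R η φ))
    {cg cf : ℕ → ℂ} {mg mf : ℕ} (hmg : 1 < mg) (hmf : 0 < mf) {b₀ b₁ s δ β δ' q : ℝ} {a c : ℂ}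
    (hcf : cf 0 = 1) (hcg₀ : cg 0 = b₀) (hcg₁ : cg 1 = -b₁) (hs : 0 < s) (hδ : 0 < δ)
    (hβ : 0 < β) (hδ' : 0 < δ')
    (hexp : (fun z : ℂ => gκ z - ((∑ n ∈ Finset.range mg, cg n * (1 - z / R) ^ n) +
      a * (1 - z / R) ^ (s : ℂ))) =O[𝓝[Delta0 R η φ] (R : ℂ)] fun z : ℂ => ‖1 - z / R‖ ^ (s + δ))
    (hfexp : (fun z : ℂ => f z - ((∑ n ∈ Finset.range mf, cf n * (1 - z / R) ^ n) +
      c * (1 - z / R) ^ (β : ℂ))) =O[𝓝[Delta0 R η φ] (R : ℂ)] fun z : ℂ => ‖1 - z / R‖ ^ (β + δ'))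
    (hq : 1 < q) (hqs : q ≤ s) (hqβ : q - 1 ≤ β) :
    ∃ φ₁ r₀ : ℝ, LocalData (fun ζ => f (R * Complex.exp ζ)) (fun ζ => gθ (R * Complex.exp ζ))
      (fun ζ => gκ (R * Complex.exp ζ)) (expPoly cf mf) (expPoly cg mg)
      ((fun ζ : ℂ => (R * Complex.exp ζ : ℂ)) ⁻¹' Delta0 R η φ) φ₁ r₀ b₀ b₁ q
      (if q = s then a else 0) (if q - 1 = β then c else 0) := by
  obtain ⟨φ₁, hφφ₁, hφ₁⟩ := exists_between hφ'
  obtain ⟨r, hr, hrw⟩ := exists_wedge_subset (η := η) hR hη hφ hφφ₁ hφ₁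
  have hopen : IsOpen (Delta0 R η φ) := isOpen_Delta0 hφ hφ'
  have hce : Continuous fun ζ : ℂ => (R * Complex.exp ζ : ℂ) := by fun_prop
  have hde : Differentiable ℂ fun ζ : ℂ => (R * Complex.exp ζ : ℂ) := by fun_prop
  have hT : ∀ᶠ ζ : ℂ in 𝓝 0, DifferentiableAt ℂ gθ (R * Complex.exp ζ) := by
    have h1 : ∀ᶠ z in 𝓝 (R : ℂ), DifferentiableAt ℂ gθ z :=
      hgθR.eventually_analyticAt.mono fun z hz => hz.differentiableAt
    have h2 := hce.tendsto 0
    rw [Complex.exp_zero, mul_one] at h2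
    exact h2.eventually h1
  obtain ⟨r', hr', hTr⟩ := Metric.eventually_nhds_iff.1 hT
  have hmaps : Set.MapsTo (fun ζ : ℂ => (R * Complex.exp ζ : ℂ))
      ((fun ζ : ℂ => (R * Complex.exp ζ : ℂ)) ⁻¹' Delta0 R η φ) (Delta0 R η φ) := fun ζ hζ => hζ
  refine ⟨φ₁, min r r', ?_⟩
  refine
    { angle_pos := hφ.trans hφφ₁
      angle_lt := hφ₁
      radius_pos := lt_min hr hr'
      one_lt := hq
      isOpen := hopen.preimage hce
      left_subset := fun ζ hζ => mul_exp_mem_Delta0_of_re_neg hR hη hφ hφ' hζ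
      wedge_subset := fun ζ hw hζ => hrw ζ hw (hζ.trans_le (min_le_left _ _))
      axis_mem := fun y hy hy' => mul_exp_mul_I_mem_Delta0 hR hη hφ hφ' hy hy'
      axis_lt := ?_
      f_diff := hf'.comp hde.differentiableOn hmaps
      T_diff := hgθ'.comp hde.differentiableOn hmaps
      G_diff := hgκ'.comp hde.differentiableOn hmaps
      p_diff := (differentiable_expPoly cf mf).differentiableOn
      T_diff' := ?_
      Q_diff := (differentiable_expPoly cg mg).differentiableOn
      p_zero := by rw [expPoly_zero cf hmf, hcf]
      Q_zero := by rw [expPoly_zero cg (by omega), hcg₀]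
      Q_deriv := by simpa [hcg₁] using hasDerivAt_expPoly_zero cg hmg
      f_exp := ?_
      G_exp := ?_ }
  · intro y hy hy'
    have hb : Tendsto (fun r : ℝ => gκ r) (𝓝[<] R) (𝓝 b₀) := by
      rw [← hcg₀]
      refine (tendsto_of_expansion (by omega) hs hδ hR hexp).comp (tendsto_nhdsWithin_iff.2 ⟨?_, ?_⟩)
      · exact (Complex.continuous_ofReal.tendsto R).mono_left nhdsWithin_le_nhds
      · filter_upwards [Ioo_mem_nhdsLT hR] with x hx
        refine ball_subset_Delta0 hR hη hφ hφ' ?_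
        rw [mem_ball_zero_iff, Complex.norm_real, Real.norm_of_nonneg hx.1.le]
        exact hx.2
    have hcos : Real.cos y ≠ 1 := by
      have := abs_le.1 hy'
      have := Real.pi_gt_three
      rw [Ne, Real.cos_eq_one_iff_of_lt_of_lt (by linarith) (by linarith)]
      exact hy
    exact re_lt_of_nonArithmetic hκ hNA hR hgκ hb hcos
      (hgκ'.continuousOn.continuousAt
        (hopen.mem_nhds (mul_exp_mul_I_mem_Delta0 hR hη hφ hφ' hy hy')))
  · intro ζ hζ
    have := hTr (y := ζ) (lt_of_lt_of_le hζ (min_le_right _ _))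
    exact (this.comp ζ hde.differentiableAt).differentiableWithinAt
  · have := isLittleO_of_expansion hβ hδ' (expansion_exp hR hη hφ hφφ₁ hφ₁ hfexp) hqβ
    exact this
  · exact isLittleO_of_expansion hs hδ (expansion_exp hR hη hφ hφφ₁ hφ₁ hexp) hqs

end Transfer

/-! ### Uniformity in `v` and the size of the coefficients. -/

/-- Each point of `K` gets a neighbourhood with its own threshold for `N`, and finitely many cover
`K`. This is why the limits above are taken along a general filter with `v` varying. -/
theorem eventually_forall_of_prod {K : Set ℝ} (hK : IsCompact K) {P : ℕ → ℝ → Prop}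
    (h : ∀ x ∈ K, ∀ᶠ z : ℕ × ℝ in atTop ×ˢ 𝓝[K] x, P z.1 z.2) :
    ∀ᶠ N in atTop, ∀ v ∈ K, P N v := by
  refine hK.induction_on (p := fun s => ∀ᶠ N in atTop, ∀ v ∈ s, P N v) (by simp) ?_ ?_ ?_
  · intro s t hst ht
    filter_upwards [ht] with N hN v hv using hN v (hst hv)
  · intro s t hs ht
    filter_upwards [hs, ht] with N h1 h2 v hv using hv.elim (h1 v) (h2 v)
  · intro x hx
    obtain ⟨pa, ha, pb, hb, hab⟩ := eventually_prod_iff.1 (h x hx)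
    exact ⟨{v | pb v}, hb, by filter_upwards [ha] with N hN v hv using hab hN hv⟩

/-- The limit of the normalised coefficients. -/
noncomputable def limitCoeff (q b₁ a₁ c₁ v : ℝ) : ℝ :=
  c₁ * ((1 - v * b₁) ^ (-q) / Real.Gamma (1 - q)) +
    v * a₁ * ((1 - v * b₁) ^ (-q - 1) / Real.Gamma (-q))

theorem continuousOn_limitCoeff {q b₁ a₁ c₁ : ℝ} {K : Set ℝ} (hK : ∀ v ∈ K, 0 < 1 - v * b₁) :
    ContinuousOn (limitCoeff q b₁ a₁ c₁) K := by
  have h : ∀ x : ℝ, ContinuousOn (fun v : ℝ => (1 - v * b₁) ^ x) K := fun x =>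
    ContinuousOn.rpow_const (by fun_prop) fun v hv => Or.inl (hK v hv).ne'
  unfold limitCoeff
  exact (continuousOn_const.mul ((h _).div_const _)).add
    ((continuousOn_id.mul continuousOn_const).mul ((h _).div_const _))

/-- The size `e^{v (t + N b₀)} N^{-q} R^{-N}` of the coefficients. -/
noncomputable def coeffScale (R t b₀ q : ℝ) (N : ℕ) (v : ℝ) : ℝ :=
  Real.exp (v * (t + N * b₀)) * (N : ℝ) ^ (-q) / R ^ N

theorem coeffScale_pos {R t b₀ q : ℝ} (hR : 0 < R) {N : ℕ} (hN : 0 < N) (v : ℝ) :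
    0 < coeffScale R t b₀ q N v := by
  have : (0 : ℝ) < N := by exact_mod_cast hN
  unfold coeffScale
  positivity

/-- Uniform asymptotics of the coefficients from the local data. -/
theorem LocalData.eventually_norm_coeffAt_sub_le {R η φ φ₁ r₀ b₀ b₁ q : ℝ} {a₁ c₁ t : ℝ}
    {f gθ gκ p Q : ℂ → ℂ} (hR : 0 < R) (hη : 0 < η) (hφ : 0 < φ) (hφ' : φ < Real.pi / 2)
    (h : LocalData (fun ζ => f (R * Complex.exp ζ)) (fun ζ => gθ (R * Complex.exp ζ))
      (fun ζ => gκ (R * Complex.exp ζ)) p Q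
      ((fun ζ : ℂ => (R * Complex.exp ζ : ℂ)) ⁻¹' Delta0 R η φ) φ₁ r₀ b₀ b₁ q a₁ c₁)
    (hgκ' : DifferentiableOn ℂ gκ (Delta0 R η φ)) (hgθ' : DifferentiableOn ℂ gθ (Delta0 R η φ))
    (hf' : DifferentiableOn ℂ f (Delta0 R η φ)) (ht : gθ R = t) {v₁ v₂ d₀ : ℝ} (hv₁ : 0 < v₁)
    (hd₀ : 0 < d₀) (hd : ∀ v ∈ Set.Icc v₁ v₂, d₀ ≤ 1 - v * b₁) {ε : ℝ} (hε : 0 < ε) :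
    ∀ᶠ N : ℕ in atTop, ∀ v ∈ Set.Icc v₁ v₂,
      ‖coeffAt N (fun z => f z * Complex.exp (v * (gθ z + N * gκ z))) -
        ((coeffScale R t b₀ q N v * limitCoeff q b₁ a₁ c₁ v : ℝ) : ℂ)‖ ≤
        ε * coeffScale R t b₀ q N v := by
  have hexpper : ∀ z : ℂ, Complex.exp (z + 2 * Real.pi * Complex.I) = Complex.exp z :=
    fun z => Complex.exp_periodic z
  set A : ℕ → ℝ → ℂ := fun N v =>
    coeffAt N (fun z => f z * Complex.exp (v * (gθ z + N * gκ z))) with hA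
  set C : ℕ → ℝ → ℂ := fun N v => 2 * Real.pi * Complex.I * (R : ℂ) ^ N * A N v *
    Complex.exp (-(v * (t + N * b₀))) with hC
  have hball := ball_subset_Delta0 hR hη hφ hφ'
  have hCeq : ∀ (N : ℕ) (v ε : ℝ), 0 < ε → segInt (kern (fun ζ => f (R * Complex.exp ζ))
      (fun ζ => gθ (R * Complex.exp ζ)) (fun ζ => gκ (R * Complex.exp ζ)) b₀ N v)
      (-ε - Real.pi * Complex.I) (-ε + Real.pi * Complex.I) = C N v := by
    intro N v ε hε
    have hF : DifferentiableOn ℂ (fun z => f z * Complex.exp (v * (gθ z + N * gκ z)))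
        (Metric.ball 0 R) := by
      have h1 := hf'.mono hball
      have h2 := hgθ'.mono hball
      have h3 := hgκ'.mono hball
      exact h1.mul ((h2.add (h3.const_mul _)).const_mul _).cexp
    have h0 := segInt_exp_eq_coeffAt hR hF N hε
    change segInt _ _ _ = 2 * Real.pi * Complex.I * (R : ℂ) ^ N *
      coeffAt N (fun z => f z * Complex.exp (v * (gθ z + N * gκ z))) *
      Complex.exp (-(v * (t + N * b₀)))
    rw [← h0, segInt, segInt, ← intervalIntegral.integral_mul_const]
    congr 1
    ext x
    set ζ : ℂ := -ε - Real.pi * Complex.I +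
      x * (-ε + Real.pi * Complex.I - (-ε - Real.pi * Complex.I)) with hζ
    have : kern (fun ζ => f (R * Complex.exp ζ)) (fun ζ => gθ (R * Complex.exp ζ))
        (fun ζ => gκ (R * Complex.exp ζ)) b₀ N v ζ =
        f (R * Complex.exp ζ) * Complex.exp (v * (gθ (R * Complex.exp ζ) +
          N * gκ (R * Complex.exp ζ))) * Complex.exp (-(N * ζ)) *
          Complex.exp (-(v * (t + N * b₀))) := by
      rw [kern, Complex.exp_zero, mul_one, ht, mul_assoc, mul_assoc, mul_assoc,
        ← Complex.exp_add, ← Complex.exp_add, ← Complex.exp_add]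
      ring_nf
    rw [this]
    ring
  refine eventually_forall_of_prod isCompact_Icc fun vs hvs => ?_
  have hvt : Tendsto (fun z : ℕ × ℝ => z.2) (atTop ×ˢ 𝓝[Set.Icc v₁ v₂] vs)
      (𝓝[Set.Icc v₁ v₂] vs) := tendsto_snd
  have hlim := h.tendsto_coefficient (l := atTop ×ˢ 𝓝[Set.Icc v₁ v₂] vs)
    (N := fun z : ℕ × ℝ => z.1) (v := fun z : ℕ × ℝ => z.2) (vs := vs)
    (fun z => by simp only [hexpper]) (fun z => by simp only [hexpper])
    (fun z => by simp only [hexpper]) tendsto_fst (hvt.mono_right nhdsWithin_le_nhds)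
    (hvt.eventually self_mem_nhdsWithin) hvs hv₁ hd₀ hd hCeq
  have hpi : (2 * Real.pi * Complex.I : ℂ) ≠ 0 := Complex.two_pi_I_ne_zero
  have hlim' : Tendsto (fun z : ℕ × ℝ => (((z.1 : ℝ) ^ q : ℝ) : ℂ) * C z.1 z.2 /
      (2 * Real.pi * Complex.I)) (atTop ×ˢ 𝓝[Set.Icc v₁ v₂] vs)
      (𝓝 ((limitCoeff q b₁ a₁ c₁ vs : ℝ) : ℂ)) := by
    have := hlim.div_const (2 * Real.pi * Complex.I)
    rw [mul_div_cancel_left₀ _ hpi] at this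
    convert this using 2
    rw [limitCoeff]
    push_cast
    ring
  have hLc : Tendsto (fun z : ℕ × ℝ => ((limitCoeff q b₁ a₁ c₁ z.2 : ℝ) : ℂ))
      (atTop ×ˢ 𝓝[Set.Icc v₁ v₂] vs) (𝓝 ((limitCoeff q b₁ a₁ c₁ vs : ℝ) : ℂ)) :=
    (Complex.continuous_ofReal.tendsto _).comp
      ((continuousOn_limitCoeff (fun v hv => hd₀.trans_le (hd v hv)) vs hvs).tendsto.comp hvt)
  have hdiff := hlim'.sub hLc
  rw [sub_self] at hdiff
  have hsmall := (tendsto_zero_iff_norm_tendsto_zero.1 hdiff).eventually_le_const hε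
  have hpos : ∀ᶠ z : ℕ × ℝ in atTop ×ˢ 𝓝[Set.Icc v₁ v₂] vs, 0 < z.1 :=
    tendsto_fst.eventually (eventually_gt_atTop 0)
  filter_upwards [hsmall, hpos] with z hz hz0
  obtain ⟨N, v⟩ := z
  simp only at hz hz0 ⊢
  have hS := coeffScale_pos (t := t) (b₀ := b₀) (q := q) hR hz0 v
  have hN : (0 : ℝ) < N := by exact_mod_cast hz0
  -- The normalisation `N^q C / (2πi)` is the coefficient divided by its scale, so a limit becomes
  -- an error of size `o(coeffScale)`.
  have hkey : (((N : ℝ) ^ q : ℝ) : ℂ) * C N v / (2 * Real.pi * Complex.I) =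
      A N v / ((coeffScale R t b₀ q N v : ℝ) : ℂ) := by
    have h1 : ((coeffScale R t b₀ q N v : ℝ) : ℂ) = Complex.exp (v * (t + N * b₀)) *
        (((N : ℝ) ^ q : ℝ) : ℂ)⁻¹ / (R : ℂ) ^ N := by
      rw [coeffScale, Real.rpow_neg hN.le]
      push_cast
      ring
    have h2 : (((N : ℝ) ^ q : ℝ) : ℂ) ≠ 0 := by exact_mod_cast (Real.rpow_pos_of_pos hN q).ne'
    have hRne : (R : ℂ) ≠ 0 := by exact_mod_cast hR.ne'
    have hE := Complex.exp_ne_zero (v * (t + N * b₀) : ℂ)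
    rw [h1, hC]
    simp only [Complex.exp_neg]
    field_simp
  rw [hkey] at hz
  have hSne : ((coeffScale R t b₀ q N v : ℝ) : ℂ) ≠ 0 := by exact_mod_cast hS.ne'
  have h3 : A N v - ((coeffScale R t b₀ q N v * limitCoeff q b₁ a₁ c₁ v : ℝ) : ℂ) =
      ((coeffScale R t b₀ q N v : ℝ) : ℂ) * (A N v / ((coeffScale R t b₀ q N v : ℝ) : ℂ) -
        ((limitCoeff q b₁ a₁ c₁ v : ℝ) : ℂ)) := by
    push_cast
    field_simp
  rw [h3, norm_mul, Complex.norm_real, Real.norm_of_nonneg hS.le, mul_comm ε]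
  exact mul_le_mul_of_nonneg_left hz hS.le

/-- Comparison of an error of size `o(S)` with a multiple of `S` that is bounded away from zero. -/
theorem eventually_norm_le_mul_abs {K : Set ℝ} (hK : IsCompact K) {g : ℝ → ℝ}
    (hg : ContinuousOn g K) (hg0 : ∀ v ∈ K, g v ≠ 0) {X : ℕ → ℝ → ℂ} {S : ℕ → ℝ → ℝ}
    (hS : ∀ᶠ N in atTop, ∀ v ∈ K, 0 < S N v)
    (hX : ∀ ε : ℝ, 0 < ε → ∀ᶠ N in atTop, ∀ v ∈ K, ‖X N v‖ ≤ ε * S N v) {ε : ℝ} (hε : 0 < ε) :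
    ∀ᶠ N in atTop, ∀ v ∈ K, ‖X N v‖ ≤ ε * |S N v * g v| := by
  rcases K.eq_empty_or_nonempty with rfl | hne
  · simp
  obtain ⟨w, hw, hmin⟩ := hK.exists_isMinOn hne hg.abs
  have hw0 : 0 < |g w| := abs_pos.2 (hg0 w hw)
  filter_upwards [hS, hX (ε * |g w|) (by positivity)] with N h1 h2 v hv
  have h3 : |g w| ≤ |g v| := hmin hv
  have h4 := h1 v hv
  calc ‖X N v‖ ≤ ε * |g w| * S N v := h2 v hv
    _ ≤ ε * |g v| * S N v := by gcongr
    _ = _ := by rw [abs_mul, abs_of_pos h4]; ring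

/-! ### The cycle index as a sum over partitions, and its recursion. -/

section CycleIndex

/-- The weight `∏_{j ≤ N} (x_j / j)^{c_j} / c_j!` of a multiset of cycle lengths. -/
noncomputable def cycleWeight (x : ℕ → ℝ) (N : ℕ) (m : Multiset ℕ) : ℝ :=
  ∏ j ∈ Finset.Icc 1 N, (x j / j) ^ m.count j / (m.count j).factorial

/-- The sum of the weights of the partitions of `n`. -/
noncomputable def cycleSum (x : ℕ → ℝ) (N n : ℕ) : ℝ :=
  ∑ p : n.Partition, cycleWeight x N p.parts

/-- One more part `j` multiplies the weight by `x j / j` over the new multiplicity, and the factor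
on the left cancels both denominators. -/
theorem mul_count_mul_cycleWeight_cons (x : ℕ → ℝ) {N j : ℕ} (hj : j ∈ Finset.Icc 1 N)
    (m : Multiset ℕ) :
    (j * (j ::ₘ m).count j : ℕ) * cycleWeight x N (j ::ₘ m) = x j * cycleWeight x N m := by
  have hj0 : (j : ℝ) ≠ 0 := by
    have := (Finset.mem_Icc.1 hj).1
    exact_mod_cast (by omega : j ≠ 0)
  have hf : ((m.count j).factorial : ℝ) ≠ 0 := by exact_mod_cast (m.count j).factorial_ne_zero
  have hc : ((m.count j : ℝ) + 1) ≠ 0 := by positivity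
  rw [cycleWeight, cycleWeight, ← Finset.mul_prod_erase _ _ hj, ← Finset.mul_prod_erase _ _ hj]
  have h : ∏ i ∈ (Finset.Icc 1 N).erase j, (x i / i) ^ (j ::ₘ m).count i /
      ((j ::ₘ m).count i).factorial =
      ∏ i ∈ (Finset.Icc 1 N).erase j, (x i / i) ^ m.count i / (m.count i).factorial :=
    Finset.prod_congr rfl fun i hi => by
      rw [Multiset.count_cons_of_ne (Finset.ne_of_mem_erase hi)]
  rw [h, Multiset.count_cons_self, Nat.factorial_succ, pow_succ]
  push_cast
  field_simp

theorem sum_mul_count_parts {N n : ℕ} (hn : n ≤ N) (p : n.Partition) :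
    ∑ j ∈ Finset.Icc 1 N, j * p.parts.count j = n := by
  conv_rhs => rw [← p.parts_sum]
  rw [Finset.sum_multiset_count_of_subset p.parts (Finset.Icc 1 N)]
  · exact Finset.sum_congr rfl fun j _ => by rw [smul_eq_mul, mul_comm]
  · intro j hj
    rw [Multiset.mem_toFinset] at hj
    exact Finset.mem_Icc.2 ⟨p.parts_pos hj, (p.le_of_mem_parts hj).trans hn⟩

/-- Removing one part `j` is a bijection from the partitions of `n` containing `j` to the partitions
of `n - j`. -/
theorem sum_mul_count_mul_cycleWeight (x : ℕ → ℝ) {N n j : ℕ} (hj : j ∈ Finset.Icc 1 N)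
    (hjn : j ≤ n) :
    ∑ p : n.Partition, ((j * p.parts.count j : ℕ) : ℝ) * cycleWeight x N p.parts =
      x j * cycleSum x N (n - j) := by
  classical
  rw [cycleSum, Finset.mul_sum]
  have hj1 := (Finset.mem_Icc.1 hj).1
  rw [← Finset.sum_filter_of_ne (p := fun p : n.Partition => j ∈ p.parts)]
  swap
  · intro p _ hp
    by_contra hc
    rw [Multiset.count_eq_zero_of_notMem hc] at hp
    simp at hp
  refine Finset.sum_bij'
    (fun p hp => ⟨p.parts.erase j, fun h => p.parts_pos (Multiset.mem_of_mem_erase h), ?_⟩)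
    (fun p _ => ⟨j ::ₘ p.parts, fun h => ?_, ?_⟩) ?_ ?_ ?_ ?_ ?_
  · have h := congrArg Multiset.sum (Multiset.cons_erase (Finset.mem_filter.1 hp).2)
    rw [Multiset.sum_cons, p.parts_sum] at h
    omega
  · rcases Multiset.mem_cons.1 h with rfl | h
    · omega
    · exact p.parts_pos h
  · rw [Multiset.sum_cons, p.parts_sum]
    omega
  · intro p _
    exact Finset.mem_univ _
  · intro p _
    simp
  · intro p hp
    ext1
    exact Multiset.cons_erase (Finset.mem_filter.1 hp).2
  · intro p _
    ext1
    simp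
  · intro p hp
    have h := Multiset.cons_erase (Finset.mem_filter.1 hp).2
    rw [← mul_count_mul_cycleWeight_cons x hj, h]

/-- The factor `n + 1` is written as the sum of the parts, `∑ j c_j`, and the summations are
exchanged. This is the recursion for the coefficients of `exp (∑ x_j z^j / j)`. -/
theorem mul_cycleSum (x : ℕ → ℝ) {N n : ℕ} (hn : n + 1 ≤ N) :
    ((n + 1 : ℕ) : ℝ) * cycleSum x N (n + 1) =
      ∑ k ∈ Finset.range (n + 1), x (k + 1) * cycleSum x N (n - k) := by
  have h1 : ((n + 1 : ℕ) : ℝ) * cycleSum x N (n + 1) = ∑ j ∈ Finset.Icc 1 N,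
      ∑ p : (n + 1).Partition, ((j * p.parts.count j : ℕ) : ℝ) * cycleWeight x N p.parts := by
    rw [Finset.sum_comm, cycleSum, Finset.mul_sum]
    refine Finset.sum_congr rfl fun p _ => ?_
    rw [← Finset.sum_mul, ← Nat.cast_sum, sum_mul_count_parts hn p]
  have h2 : ∑ j ∈ Finset.Icc 1 N,
      ∑ p : (n + 1).Partition, ((j * p.parts.count j : ℕ) : ℝ) * cycleWeight x N p.parts =
      ∑ j ∈ Finset.Icc 1 (n + 1), x j * cycleSum x N (n + 1 - j) := by
    rw [← Finset.sum_subset (Finset.Icc_subset_Icc_right hn)]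
    · refine Finset.sum_congr rfl fun j hj => ?_
      have := Finset.mem_Icc.1 hj
      exact sum_mul_count_mul_cycleWeight x (Finset.Icc_subset_Icc_right hn hj) this.2
    · intro j hj hj'
      refine Finset.sum_eq_zero fun p _ => ?_
      have hlt : n + 1 < j := by
        by_contra hc
        exact hj' (Finset.mem_Icc.2 ⟨(Finset.mem_Icc.1 hj).1, by omega⟩)
      rw [Multiset.count_eq_zero_of_notMem fun h => by have := p.le_of_mem_parts h; omega]
      simp
  rw [h1, h2, ← Finset.Ico_add_one_right_eq_Icc, Finset.sum_Ico_eq_sum_range]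
  refine Finset.sum_congr (by simp) fun k _ => ?_
  rw [add_comm 1 k, Nat.add_sub_add_right]

theorem cycleSum_zero (x : ℕ → ℝ) (N : ℕ) : cycleSum x N 0 = 1 := by
  rw [cycleSum, Fintype.sum_unique]
  simp [cycleWeight]

/-- The count by `cycleType` ignores fixed points; they reappear as the factorial of `N - m.sum`,
the multiplicity of the part `1`. -/
theorem card_partition_eq {N : ℕ} (p : (Fintype.card (Fin N)).Partition) :
    (Finset.univ.filter fun σ : Equiv.Perm (Fin N) => σ.partition = p).card *
      ∏ j ∈ Finset.Icc 1 N, j ^ p.parts.count j * (p.parts.count j).factorial = N.factorial := by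
  set m := p.parts.filter (2 ≤ ·) with hm
  have hsplit : m + Multiset.replicate (p.parts.count 1) 1 = p.parts := by
    rw [← Multiset.filter_eq', hm]
    conv_rhs => rw [← Multiset.filter_add_not (2 ≤ ·) p.parts]
    congr 1
    refine Multiset.filter_congr fun j hj => ?_
    have := p.parts_pos hj
    omega
  have hsum : m.sum + p.parts.count 1 = N := by
    have := congrArg Multiset.sum hsplit
    rw [Multiset.sum_add, p.parts_sum] at this
    simpa using this
  have hiff : ∀ σ : Equiv.Perm (Fin N), σ.partition = p ↔ σ.cycleType = m := by
    intro σ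
    constructor
    · rintro rfl
      exact Equiv.Perm.filter_parts_partition_eq_cycleType.symm
    · intro h
      ext1
      have hN : Fintype.card (Fin N) - m.sum = p.parts.count 1 := by
        have := Fintype.card_fin N
        omega
      rw [Equiv.Perm.parts_partition, ← Equiv.Perm.sum_cycleType, h, hN, hsplit]
  have hcard := Equiv.Perm.card_of_cycleType_mul_eq (Fin N) m
  rw [if_pos ⟨by rw [Fintype.card_fin]; omega, fun j hj => (Multiset.mem_filter.1 hj).2⟩,
    Fintype.card_fin, show N - m.sum = p.parts.count 1 by omega] at hcard
  simp_rw [hiff]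
  rw [← hcard]
  congr 1
  have hsub : m.toFinset ⊆ Finset.Icc 1 N := by
    intro j hj
    rw [Multiset.mem_toFinset] at hj
    have h1 := (Multiset.mem_filter.1 hj).2
    have h2 := Multiset.le_sum_of_mem hj
    exact Finset.mem_Icc.2 ⟨by omega, by omega⟩
  have hcount : ∀ j, 2 ≤ j → m.count j = p.parts.count j := fun j hj =>
    Multiset.count_filter_of_pos hj
  have hone : m.count 1 = 0 :=
    Multiset.count_eq_zero_of_notMem fun h => by simpa using (Multiset.mem_filter.1 h).2
  rw [Finset.prod_multiset_count_of_subset m _ hsub, Finset.prod_subset hsub fun j _ hj => by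
      rw [Multiset.mem_toFinset] at hj
      rw [Multiset.count_eq_zero_of_notMem hj, Nat.factorial_zero],
    mul_assoc, ← Finset.prod_mul_distrib]
  have hfirst : (p.parts.count 1).factorial =
      ∏ j ∈ Finset.Icc 1 N, if j = 1 then (p.parts.count 1).factorial else 1 := by
    rw [Finset.prod_ite_eq']
    split_ifs with h
    · rfl
    · have : N = 0 := by
        by_contra hc
        exact h (Finset.mem_Icc.2 ⟨le_rfl, by omega⟩)
      rw [show p.parts.count 1 = 0 by omega, Nat.factorial_zero]
  rw [hfirst, ← Finset.prod_mul_distrib]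
  refine Finset.prod_congr rfl fun j hj => ?_
  split_ifs with h
  · rw [h, hone]
    simp
  · rw [one_mul, hcount j (by have := (Finset.mem_Icc.1 hj).1; omega)]

/-- `H_N` as a sum over partitions. -/
theorem H_eq_cycleSum (θ κ : ℕ → ℝ) (N : ℕ) :
    H θ κ N = cycleSum (fun j => θ j + N * κ j) N N := by
  -- `σ.partition` partitions `Fintype.card (Fin N)`, which is `N` only up to a rewriting in a
  -- dependent type.
  have hcast : ∀ (n : ℕ), n = N → cycleSum (fun j => θ j + N * κ j) N N =
      cycleSum (fun j => θ j + N * κ j) N n := by rintro n rfl; rfl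
  rw [hcast _ (Fintype.card_fin N), H, cycleSum, Finset.sum_div,
    ← Finset.sum_fiberwise Finset.univ (fun σ : Equiv.Perm (Fin N) => σ.partition)]
  refine Finset.sum_congr rfl fun p _ => ?_
  rw [Finset.sum_congr rfl (g := fun _ => (∏ j ∈ Finset.Icc 1 N,
    (θ j + N * κ j) ^ p.parts.count j) / (N.factorial : ℝ)) fun σ hσ => by
      rw [← (Finset.mem_filter.1 hσ).2]; rfl]
  rw [Finset.sum_const, nsmul_eq_mul, ← card_partition_eq p, cycleWeight, Finset.prod_div_distrib]
  have hne : ((Finset.univ.filter fun σ : Equiv.Perm (Fin N) => σ.partition = p).card : ℝ) ≠ 0 := by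
    have h := card_partition_eq p
    have h' := N.factorial_ne_zero
    rw [← h] at h'
    exact_mod_cast left_ne_zero_of_mul h'
  push_cast
  rw [Finset.prod_mul_distrib]
  simp_rw [div_pow]
  rw [Finset.prod_div_distrib]
  field_simp

end CycleIndex

/-! ### Taylor coefficients of the exponential of a power series. -/

section ExpSeries

theorem iteratedDeriv_eq_factorial_mul {g : ℂ → ℂ} {a : ℕ → ℂ} {R : ℝ} (hR : 0 < R)
    (hg : ∀ z : ℂ, ‖z‖ < R → HasSum (fun j : ℕ => a j * z ^ j) (g z)) :
    AnalyticAt ℂ g 0 ∧ ∀ n : ℕ, iteratedDeriv n g 0 = n.factorial * a n := by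
  have hat : HasFPowerSeriesAt g (FormalMultilinearSeries.ofScalars ℂ a) 0 := by
    rw [hasFPowerSeriesAt_iff]
    filter_upwards [Metric.ball_mem_nhds (0 : ℂ) hR] with z hz
    simpa [mul_comm] using hg z (by simpa using hz)
  refine ⟨hat.analyticAt, fun n => ?_⟩
  obtain ⟨r, hr⟩ := hat
  have h := hr.factorial_smul 1 n
  rw [iteratedDeriv_eq_iteratedFDeriv, ← h]
  simp

/-- The recursion for the Taylor coefficients of the exponential of a power series. -/
theorem mul_coeffAt_exp {g : ℂ → ℂ} (hg : AnalyticAt ℂ g 0) (n : ℕ) :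
    ((n + 1 : ℕ) : ℂ) * coeffAt (n + 1) (fun z => Complex.exp (g z)) =
      ∑ k ∈ Finset.range (n + 1), ((k + 1 : ℕ) * coeffAt (k + 1) g) *
        coeffAt (n - k) (fun z => Complex.exp (g z)) := by
  have hd : deriv (fun z => Complex.exp (g z)) =ᶠ[𝓝 0] fun z => deriv g z * Complex.exp (g z) := by
    filter_upwards [hg.eventually_analyticAt] with z hz
    rw [(hz.differentiableAt.hasDerivAt.cexp).deriv, mul_comm]
  have hF : AnalyticAt ℂ (fun z => Complex.exp (g z)) 0 := hg.cexp
  have h1 : iteratedDeriv (n + 1) (fun z => Complex.exp (g z)) 0 =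
      ∑ k ∈ Finset.range (n + 1), (n.choose k : ℂ) * iteratedDeriv (k + 1) g 0 *
        iteratedDeriv (n - k) (fun z => Complex.exp (g z)) 0 := by
    rw [iteratedDeriv_succ', hd.iteratedDeriv_eq,
      iteratedDeriv_fun_mul hg.deriv.contDiffAt hF.contDiffAt]
    simp_rw [iteratedDeriv_succ']
  have hfac : ∀ m : ℕ, (m.factorial : ℂ) ≠ 0 := fun m => by exact_mod_cast m.factorial_ne_zero
  unfold coeffAt
  rw [h1, Nat.factorial_succ, Finset.sum_div, Finset.mul_sum]
  refine Finset.sum_congr rfl fun k hk => ?_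
  have hkn : k ≤ n := by have := Finset.mem_range.1 hk; omega
  have hch : (n.choose k : ℂ) * k.factorial * (n - k).factorial = n.factorial := by
    exact_mod_cast Nat.choose_mul_factorial_mul_factorial hkn
  have hk1 : ((k : ℂ) + 1) ≠ 0 := by exact_mod_cast k.succ_ne_zero
  have hn1 : ((n : ℂ) + 1) ≠ 0 := by exact_mod_cast n.succ_ne_zero
  rw [Nat.factorial_succ]
  have h2 := hfac k
  have h3 := hfac n
  have h4 := hfac (n - k)
  push_cast
  field_simp
  rw [← hch]
  ring

/-- The generating function of the cycle index evaluated at `x`. -/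
theorem cycleSum_eq_coeffAt {x : ℕ → ℝ} {g : ℂ → ℂ} {R : ℝ} (hR : 0 < R)
    (hg : ∀ z : ℂ, ‖z‖ < R → HasSum (fun j : ℕ => (genCoeff x j : ℂ) * z ^ j) (g z)) (N n : ℕ)
    (hn : n ≤ N) : (cycleSum x N n : ℂ) = coeffAt n (fun z => Complex.exp (g z)) := by
  obtain ⟨han, hder⟩ := iteratedDeriv_eq_factorial_mul hR hg
  induction n using Nat.strong_induction_on with
  | _ n ih =>
    cases n with
    | zero =>
      -- The recursions agree, and so do the initial values, because the coefficient at index `0` is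
      -- `0 / 0`-safe: `genCoeff x 0 = 0`, hence `g 0 = 0`.
      have h0 := hder 0
      simp only [iteratedDeriv_zero, genCoeff, Nat.cast_zero, div_zero, Complex.ofReal_zero,
        mul_zero] at h0
      simp [cycleSum_zero, coeffAt, h0]
    | succ n =>
      have hn1 : ((n + 1 : ℕ) : ℂ) ≠ 0 := by exact_mod_cast n.succ_ne_zero
      refine mul_left_cancel₀ hn1 ?_
      rw [mul_coeffAt_exp han]
      have h := congrArg (fun t : ℝ => (t : ℂ)) (mul_cycleSum x hn)
      push_cast at h ⊢
      rw [h]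
      refine Finset.sum_congr rfl fun k hk => ?_
      rw [ih (n - k) (by omega) (by omega)]
      congr 1
      have hk1 : ((k : ℂ) + 1) ≠ 0 := by exact_mod_cast k.succ_ne_zero
      have hf : ((k + 1).factorial : ℂ) ≠ 0 := by exact_mod_cast (k + 1).factorial_ne_zero
      rw [coeffAt, hder, genCoeff]
      push_cast
      field_simp

/-- `H_N` as a Taylor coefficient. -/
theorem H_eq_coeffAt {θ κ : ℕ → ℝ} {gθ gκ : ℂ → ℂ} {R : ℝ} (hR : 0 < R)
    (hgθ : ∀ z : ℂ, ‖z‖ < R → HasSum (fun j : ℕ => (genCoeff θ j : ℂ) * z ^ j) (gθ z))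
    (hgκ : ∀ z : ℂ, ‖z‖ < R → HasSum (fun j : ℕ => (genCoeff κ j : ℂ) * z ^ j) (gκ z)) (N : ℕ) :
    (H θ κ N : ℂ) = coeffAt N (fun z => Complex.exp (gθ z + N * gκ z)) := by
  rw [H_eq_cycleSum]
  refine cycleSum_eq_coeffAt hR (fun z hz => ?_) N N le_rfl
  convert (hgθ z hz).add ((hgκ z hz).mul_left (N : ℂ)) using 2 with j
  simp only [genCoeff]
  push_cast
  ring

end ExpSeries

/-! ### Boundary values of the generating functions. -/

section Boundary

variable {R : ℝ}

theorem ofReal_genFun {x : ℕ → ℝ} {g : ℂ → ℂ}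
    (hg : ∀ z : ℂ, ‖z‖ < R → HasSum (fun j : ℕ => (genCoeff x j : ℂ) * z ^ j) (g z)) {r : ℝ}
    (hr : |r| < R) : (genFun x r : ℂ) = g r := by
  rw [genFun, Complex.ofReal_tsum, ← (hg r (by simpa using hr)).tsum_eq]
  push_cast
  rfl

/-- At a point of continuity of the extension, the boundary value is the value of the extension. -/
theorem eq_toReal_boundaryDeriv_zero {x : ℕ → ℝ} {g : ℂ → ℂ} (hR : 0 < R)
    (hg : ∀ z : ℂ, ‖z‖ < R → HasSum (fun j : ℕ => (genCoeff x j : ℂ) * z ^ j) (g z))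
    (hc : ContinuousAt g R) : g R = ((boundaryDeriv x 0 R).toReal : ℂ) := by
  have hlim : Tendsto (fun r : ℝ => g r) (𝓝[<] R) (𝓝 (g R)) :=
    hc.tendsto.comp ((Complex.continuous_ofReal.tendsto R).mono_left nhdsWithin_le_nhds)
  have heq : ∀ᶠ r : ℝ in 𝓝[<] R, (genFun x r : ℂ) = g r := by
    filter_upwards [Ioo_mem_nhdsLT hR] with r hr
    exact ofReal_genFun hg (by rw [abs_of_pos hr.1]; exact hr.2)
  have hlim' : Tendsto (fun r : ℝ => (genFun x r : ℂ)) (𝓝[<] R) (𝓝 (g R)) :=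
    hlim.congr' (heq.mono fun r hr => hr.symm)
  have hre : Tendsto (genFun x) (𝓝[<] R) (𝓝 (g R).re) := by
    simpa [Function.comp_def] using (Complex.continuous_re.tendsto _).comp hlim'
  have him : (g R).im = 0 := by
    have h : Tendsto (fun _ : ℝ => (0 : ℝ)) (𝓝[<] R) (𝓝 (g R).im) := by
      simpa [Function.comp_def] using (Complex.continuous_im.tendsto _).comp hlim'
    exact tendsto_nhds_unique h tendsto_const_nhds
  have hb : boundaryDeriv x 0 R = ((g R).re : EReal) := by
    rw [boundaryDeriv]
    refine Tendsto.limUnder_eq ?_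
    simpa [modDeriv, Function.comp_def] using (continuous_coe_real_ereal.tendsto _).comp hre
  rw [hb, EReal.toReal_coe]
  exact Complex.ext (by simp) (by simpa using him)

end Boundary

/-! ### Coefficient asymptotics under the hypotheses at `R`. -/

section Transfer

variable {θ κ : ℕ → ℝ} {R η φ : ℝ} {gκ gθ f : ℂ → ℂ}

/-- Uniform asymptotics of the coefficients of `f e^{v G_N}` in terms of the expansions at `R`. -/
theorem eventually_norm_coeffAt_sub_le (hκ : ∀ j, 1 ≤ j → 0 ≤ κ j) (hNA : NonArithmetic κ)
    (hR : 0 < R) (hη : 0 < η) (hφ : 0 < φ) (hφ' : φ < Real.pi / 2)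
    (hgκ : ∀ z : ℂ, ‖z‖ < R → HasSum (fun j : ℕ => (genCoeff κ j : ℂ) * z ^ j) (gκ z))
    (hgκ' : DifferentiableOn ℂ gκ (Delta0 R η φ))
    (hgθ : ∀ z : ℂ, ‖z‖ < R → HasSum (fun j : ℕ => (genCoeff θ j : ℂ) * z ^ j) (gθ z))
    (hgθ' : DifferentiableOn ℂ gθ (Delta0 R η φ)) (hgθR : AnalyticAt ℂ gθ (R : ℂ))
    {s a δ : ℝ} (hs : 1 < s) (hδ : 0 < δ)
    (hexp : (fun z : ℂ => gκ z - ((∑ n ∈ Finset.range ⌈s⌉₊,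
        (-1 : ℂ) ^ n * ((boundaryDeriv κ n R).toReal : ℂ) / (Nat.factorial n : ℂ) *
          (1 - z / R) ^ n) + (a : ℂ) * (1 - z / R) ^ (s : ℂ)))
      =O[𝓝[Delta0 R η φ] (R : ℂ)] fun z : ℂ => ‖1 - z / R‖ ^ (s + δ))
    (hf' : DifferentiableOn ℂ f (Delta0 R η φ)) {cf : ℕ → ℂ} {mf : ℕ} (hmf : 0 < mf)
    (hcf : cf 0 = 1) {β c δ' : ℝ} (hβ : 0 < β) (hδ' : 0 < δ')
    (hfexp : (fun z : ℂ => f z - ((∑ n ∈ Finset.range mf, cf n * (1 - z / R) ^ n) +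
      (c : ℂ) * (1 - z / R) ^ (β : ℂ)))
      =O[𝓝[Delta0 R η φ] (R : ℂ)] fun z : ℂ => ‖1 - z / R‖ ^ (β + δ'))
    {q a₁ c₁ : ℝ} (hq : 1 < q) (hqs : q ≤ s) (hqβ : q - 1 ≤ β)
    (ha₁ : a₁ = if q = s then a else 0) (hc₁ : c₁ = if q - 1 = β then c else 0)
    {v₁ v₂ d₀ : ℝ} (hv₁ : 0 < v₁) (hd₀ : 0 < d₀)
    (hd : ∀ v ∈ Set.Icc v₁ v₂, d₀ ≤ 1 - v * (boundaryDeriv κ 1 R).toReal)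
    {ε : ℝ} (hε : 0 < ε) :
    ∀ᶠ N : ℕ in atTop, ∀ v ∈ Set.Icc v₁ v₂,
      ‖coeffAt N (fun z => f z * Complex.exp (v * (gθ z + N * gκ z))) -
        ((coeffScale R (boundaryDeriv θ 0 R).toReal (boundaryDeriv κ 0 R).toReal q N v *
          limitCoeff q (boundaryDeriv κ 1 R).toReal a₁ c₁ v : ℝ) : ℂ)‖ ≤
        ε * coeffScale R (boundaryDeriv θ 0 R).toReal (boundaryDeriv κ 0 R).toReal q N v := by
  have hmg : 1 < ⌈s⌉₊ := by
    rw [Nat.lt_ceil]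
    exact_mod_cast hs
  obtain ⟨φ₁, r₀, h⟩ := exists_localData (b₀ := (boundaryDeriv κ 0 R).toReal)
    (b₁ := (boundaryDeriv κ 1 R).toReal)
    (cg := fun n => (-1 : ℂ) ^ n * ((boundaryDeriv κ n R).toReal : ℂ) / (Nat.factorial n : ℂ))
    hκ hNA hR hη hφ hφ' hgκ hgκ' hgθ' hgθR hf' hmg hmf hcf (by simp) (by simp)
    (by linarith) hδ hβ hδ' hexp hfexp hq hqs hqβ
  have ha₁' : (a₁ : ℂ) = if q = s then (a : ℂ) else 0 := by rw [ha₁]; split_ifs <;> simp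
  have hc₁' : (c₁ : ℂ) = if q - 1 = β then (c : ℂ) else 0 := by rw [hc₁]; split_ifs <;> simp
  rw [← ha₁', ← hc₁'] at h
  exact h.eventually_norm_coeffAt_sub_le hR hη hφ hφ' hgκ' hgθ' hf'
    (eq_toReal_boundaryDeriv_zero hR hgθ hgθR.continuousAt) hv₁ hd₀ hd hε

end Transfer

/-! ### From normalised limits to the stated closed forms. -/

theorem UnifEquiv.of_eventually {K : Set ℝ} (hK : IsCompact K) {g : ℝ → ℝ}
    (hg : ContinuousOn g K) (hg0 : ∀ v ∈ K, g v ≠ 0) {A : ℕ → ℝ → ℂ} {B S : ℕ → ℝ → ℝ}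
    (hS : ∀ᶠ N in atTop, ∀ v ∈ K, 0 < S N v)
    (hB : ∀ᶠ N in atTop, ∀ v ∈ K, B N v = S N v * g v)
    (hA : ∀ ε : ℝ, 0 < ε → ∀ᶠ N in atTop, ∀ v ∈ K,
      ‖A N v - ((S N v * g v : ℝ) : ℂ)‖ ≤ ε * S N v) : UnifEquiv K A B := by
  intro ε hε
  filter_upwards [hB, eventually_norm_le_mul_abs hK hg hg0 hS hA hε] with N h1 h2 v hv
  rw [h1 v hv]
  exact h2 v hv

theorem UnifEquiv.mono {K L : Set ℝ} (h : K ⊆ L) {A : ℕ → ℝ → ℂ} {B : ℕ → ℝ → ℝ}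
    (hL : UnifEquiv L A B) : UnifEquiv K A B := fun ε hε =>
  (hL ε hε).mono fun _ hN v hv => hN v (h hv)

/-- For `s` not an integer, `Γ(-s) ≠ 0`. -/
theorem Gamma_neg_ne_zero {s : ℝ} (hs : ∀ m : ℕ, s ≠ m) : Real.Gamma (-s) ≠ 0 :=
  Real.Gamma_ne_zero fun m h => hs m (by linarith)

theorem coeffScale_mul_limitCoeff {R t b₀ q b₁ a₁ c₁ v : ℝ} (hd : 0 < 1 - v * b₁) (N : ℕ) :
    coeffScale R t b₀ q N v * limitCoeff q b₁ a₁ c₁ v =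
      Real.exp (v * (t + N * b₀)) * (N * (1 - v * b₁)) ^ (-q) / R ^ N *
      (c₁ / Real.Gamma (1 - q) + v * a₁ / (Real.Gamma (-q) * (1 - v * b₁))) := by
  rw [limitCoeff, coeffScale, Real.rpow_sub_one hd.ne', Real.mul_rpow N.cast_nonneg hd.le]
  field_simp

theorem limitCoeff_ne_zero_iff {q b₁ a₁ c₁ v : ℝ} (hd : 0 < 1 - v * b₁) :
    limitCoeff q b₁ a₁ c₁ v ≠ 0 ↔
      c₁ / Real.Gamma (1 - q) + v * a₁ / (Real.Gamma (-q) * (1 - v * b₁)) ≠ 0 := by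
  have h : limitCoeff q b₁ a₁ c₁ v = (1 - v * b₁) ^ (-q) *
      (c₁ / Real.Gamma (1 - q) + v * a₁ / (Real.Gamma (-q) * (1 - v * b₁))) := by
    rw [limitCoeff, Real.rpow_sub_one hd.ne']
    field_simp
  rw [h, mul_ne_zero_iff]
  exact and_iff_right (Real.rpow_pos_of_pos hd _).ne'

theorem toReal_lt_one {x : EReal} (hx : x < 1) : x.toReal < 1 := by
  induction x with
  | bot => simp
  | top => simp at hx
  | coe x =>
    rw [EReal.toReal_coe]
    exact_mod_cast hx

/-- For `b ≤ 0`, including the default value `1 / 0 = 0`, the right-hand bound would be at most `0`;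
hence `v > 1` forces `b > 0`. -/
theorem mul_lt_one_of_lt_one_div {b v : ℝ} (hv : 1 < v) (h : v < 1 / b) : v * b < 1 := by
  have hb : 0 < b := by
    by_contra hc
    have := one_div_nonpos.2 (not_lt.1 hc)
    linarith
  rwa [lt_div_iff₀ hb] at h

/-- A lower bound for `d(v)` that assumes nothing about the sign of `b`: the value `1` serves for `b
≤ 0`, the right endpoint for `b ≥ 0`. -/
theorem one_sub_mul_le {b v₁ v₂ v : ℝ} (hv₁ : 0 < v₁) (hv : v ∈ Set.Icc v₁ v₂) :
    min 1 (1 - v₂ * b) ≤ 1 - v * b := by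
  rcases le_total b 0 with hb | hb
  · exact (min_le_left _ _).trans (by nlinarith [hv.1])
  · exact (min_le_right _ _).trans (by nlinarith [hv.2])

end SurrogateSpatial

theorem mainTheorem11
    (θ κ : ℕ → ℝ) (hθ : ∀ j, 1 ≤ j → 0 ≤ θ j) (hκ : ∀ j, 1 ≤ j → 0 ≤ κ j)
    (hNA : SurrogateSpatial.NonArithmetic κ)
    (R η φ : ℝ) (hR : 0 < R) (hη : 0 < η) (hφ : 0 < φ) (hφ' : φ < Real.pi / 2)
    -- `g_κ` has radius of convergence `R`
    (hrad : (FormalMultilinearSeries.ofScalars ℂ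
      (fun j : ℕ => (SurrogateSpatial.genCoeff κ j : ℂ))).radius = ENNReal.ofReal R)
    -- `gκ` is the holomorphic extension of the generating function to `Δ₀`
    (gκ : ℂ → ℂ)
    (hgκ : ∀ z : ℂ, ‖z‖ < R →
      HasSum (fun j : ℕ => (SurrogateSpatial.genCoeff κ j : ℂ) * z ^ j) (gκ z))
    (hgκ' : DifferentiableOn ℂ gκ (SurrogateSpatial.Delta0 R η φ))
    -- `gθ` is the holomorphic extension of the generating function to `Δ₀`, regular at `R`
    (gθ : ℂ → ℂ)
    (hgθ : ∀ z : ℂ, ‖z‖ < R →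
      HasSum (fun j : ℕ => (SurrogateSpatial.genCoeff θ j : ℂ) * z ^ j) (gθ z))
    (hgθ' : DifferentiableOn ℂ gθ (SurrogateSpatial.Delta0 R η φ))
    (hgθR : AnalyticAt ℂ gθ (R : ℂ))
    -- supercritical case
    (hsup : SurrogateSpatial.boundaryDeriv κ 1 R < 1)
    (s : ℝ) (hs : 1 < s) (hsZ : ∀ m : ℕ, s ≠ m)
    (hfin : ∀ n : ℕ, (n : ℝ) < s → SurrogateSpatial.boundaryDeriv κ n R < ⊤)
    (hinf : ∀ n : ℕ, s < (n : ℝ) → SurrogateSpatial.boundaryDeriv κ n R = ⊤)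
    (a δ : ℝ) (ha : a ≠ 0) (hδ : 0 < δ)
    (hexp : (fun z : ℂ => gκ z -
        ((∑ n ∈ Finset.range ⌈s⌉₊,
            (-1 : ℂ) ^ n * ((SurrogateSpatial.boundaryDeriv κ n R).toReal : ℂ) /
              (Nat.factorial n : ℂ) * (1 - z / R) ^ n)
          + (a : ℂ) * (1 - z / R) ^ (s : ℂ)))
      =O[𝓝[SurrogateSpatial.Delta0 R η φ] (R : ℂ)] fun z : ℂ => ‖1 - z / R‖ ^ (s + δ)) :
    (∀ (f : ℂ → ℂ) (β c δ' : ℝ), 0 < β → 0 < c → 0 < δ' →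
      DifferentiableOn ℂ f (SurrogateSpatial.Delta0 R η φ) →
      ((fun z : ℂ => f z -
          (1 + (∑ n ∈ Finset.Ico 1 ⌈β⌉₊,
              (-1 : ℂ) ^ n * SurrogateSpatial.boundaryDerivC f n R /
                (Nat.factorial n : ℂ) * (1 - z / R) ^ n)
            + (c : ℂ) * (1 - z / R) ^ (β : ℂ)))
        =O[𝓝[SurrogateSpatial.Delta0 R η φ] (R : ℂ)] fun z : ℂ => ‖1 - z / R‖ ^ (β + δ')) →
      ∀ v₁ v₂ : ℝ, 0 < v₁ → v₁ < 1 → 1 < v₂ →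
        v₂ < 1 / (SurrogateSpatial.boundaryDeriv κ 1 R).toReal →
        -- (i)
        (s - 1 < β →
          SurrogateSpatial.UnifEquiv (Set.Icc v₁ v₂)
            (fun N v => SurrogateSpatial.coeffAt N
              (fun z => f z * Complex.exp (v * (gθ z + N * gκ z))))
            (fun N v => Real.exp (v * SurrogateSpatial.GBoundary θ κ R N) * v * a *
              (N * (1 - v * (SurrogateSpatial.boundaryDeriv κ 1 R).toReal)) ^ (-s) /
              (R ^ N * Real.Gamma (-s) *
                (1 - v * (SurrogateSpatial.boundaryDeriv κ 1 R).toReal)))) ∧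
        -- (ii)
        ((∀ m : ℕ, β ≠ m) → β < s - 1 →
          SurrogateSpatial.UnifEquiv (Set.Icc v₁ v₂)
            (fun N v => SurrogateSpatial.coeffAt N
              (fun z => f z * Complex.exp (v * (gθ z + N * gκ z))))
            (fun N v => Real.exp (v * SurrogateSpatial.GBoundary θ κ R N) * c *
              (N * (1 - v * (SurrogateSpatial.boundaryDeriv κ 1 R).toReal)) ^ (-β - 1) /
              (R ^ N * Real.Gamma (-β)))) ∧
        -- (iii): an `o(1)` in the bracket, uniformly on `[v₁, v₂]`, and genuine equivalence
        -- uniformly on each compact set of `v` where the bracket has no zero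
        (β = s - 1 →
          (∀ ε : ℝ, 0 < ε → ∀ᶠ N : ℕ in atTop, ∀ v ∈ Set.Icc v₁ v₂,
            ‖SurrogateSpatial.coeffAt N
                (fun z => f z * Complex.exp (v * (gθ z + N * gκ z))) -
              ((Real.exp (v * SurrogateSpatial.GBoundary θ κ R N) *
                (N * (1 - v * (SurrogateSpatial.boundaryDeriv κ 1 R).toReal)) ^ (-s) / R ^ N *
                (c / Real.Gamma (1 - s) + v * a / (Real.Gamma (-s) *
                  (1 - v * (SurrogateSpatial.boundaryDeriv κ 1 R).toReal))) : ℝ) : ℂ)‖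
            ≤ ε * (Real.exp (v * SurrogateSpatial.GBoundary θ κ R N) *
                (N * (1 - v * (SurrogateSpatial.boundaryDeriv κ 1 R).toReal)) ^ (-s) / R ^ N)) ∧
          (∀ K : Set ℝ, IsCompact K → K ⊆ Set.Icc v₁ v₂ →
            (∀ v ∈ K, c / Real.Gamma (1 - s) + v * a / (Real.Gamma (-s) *
              (1 - v * (SurrogateSpatial.boundaryDeriv κ 1 R).toReal)) ≠ 0) →
            SurrogateSpatial.UnifEquiv K
              (fun N v => SurrogateSpatial.coeffAt N
                (fun z => f z * Complex.exp (v * (gθ z + N * gκ z))))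
              (fun N v => Real.exp (v * SurrogateSpatial.GBoundary θ κ R N) *
                (N * (1 - v * (SurrogateSpatial.boundaryDeriv κ 1 R).toReal)) ^ (-s) / R ^ N *
                (c / Real.Gamma (1 - s) + v * a / (Real.Gamma (-s) *
                  (1 - v * (SurrogateSpatial.boundaryDeriv κ 1 R).toReal))))))) ∧
    -- asymptotics of `H_N`
    (fun N : ℕ => SurrogateSpatial.H θ κ N) ~[atTop]
      (fun N : ℕ => Real.exp (SurrogateSpatial.GBoundary θ κ R N) * a *
        (N * (1 - (SurrogateSpatial.boundaryDeriv κ 1 R).toReal)) ^ (-s) /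
        (R ^ N * Real.Gamma (-s) *
          (1 - (SurrogateSpatial.boundaryDeriv κ 1 R).toReal))) := by
  have key := fun (f : ℂ → ℂ) => SurrogateSpatial.eventually_norm_coeffAt_sub_le (f := f) hκ hNA
    hR hη hφ hφ' hgκ hgκ' hgθ hgθ' hgθR hs hδ hexp
  set b₀ := (SurrogateSpatial.boundaryDeriv κ 0 R).toReal with hb₀
  set b₁ := (SurrogateSpatial.boundaryDeriv κ 1 R).toReal with hb₁
  set t := (SurrogateSpatial.boundaryDeriv θ 0 R).toReal with ht
  have hG : ∀ N, SurrogateSpatial.GBoundary θ κ R N = t + N * b₀ := fun N => rfl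
  have hΓ := SurrogateSpatial.Gamma_neg_ne_zero hsZ
  have hscale : ∀ (q : ℝ) (K : Set ℝ), ∀ᶠ N : ℕ in atTop, ∀ v ∈ K,
      0 < SurrogateSpatial.coeffScale R t b₀ q N v := fun q K =>
    (eventually_gt_atTop 0).mono fun N hN v _ => SurrogateSpatial.coeffScale_pos hR hN v
  -- the case in which the singularity of `g_κ` dominates
  have main : ∀ (f : ℂ → ℂ) (cf : ℕ → ℂ) (mf : ℕ) (β c δ' : ℝ), 0 < mf → cf 0 = 1 → 0 < δ' →
      DifferentiableOn ℂ f (SurrogateSpatial.Delta0 R η φ) →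
      ((fun z : ℂ => f z - ((∑ n ∈ Finset.range mf, cf n * (1 - z / R) ^ n) +
        (c : ℂ) * (1 - z / R) ^ (β : ℂ)))
        =O[𝓝[SurrogateSpatial.Delta0 R η φ] (R : ℂ)] fun z : ℂ => ‖1 - z / R‖ ^ (β + δ')) →
      ∀ v₁ v₂ : ℝ, 0 < v₁ → v₂ * b₁ < 1 → s - 1 < β →
      SurrogateSpatial.UnifEquiv (Set.Icc v₁ v₂)
        (fun N v => SurrogateSpatial.coeffAt N
          (fun z => f z * Complex.exp (v * (gθ z + N * gκ z))))
        (fun N v => Real.exp (v * SurrogateSpatial.GBoundary θ κ R N) * v * a *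
          (N * (1 - v * b₁)) ^ (-s) / (R ^ N * Real.Gamma (-s) * (1 - v * b₁))) := by
    intro f cf mf β c δ' hmf hcf hδ' hf hfexp v₁ v₂ hv₁ hv₂ hβs
    have hd := fun v (hv : v ∈ Set.Icc v₁ v₂) => SurrogateSpatial.one_sub_mul_le (b := b₁) hv₁ hv
    have hd₀ : 0 < min 1 (1 - v₂ * b₁) := lt_min one_pos (by linarith)
    have hd' := fun v (hv : v ∈ Set.Icc v₁ v₂) => hd₀.trans_le (hd v hv)
    -- Here `q = s`, and since `s - 1 < β` the singular term of `f` enters with coefficient `0`.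
    refine SurrogateSpatial.UnifEquiv.of_eventually isCompact_Icc
      (g := SurrogateSpatial.limitCoeff s b₁ a 0) (SurrogateSpatial.continuousOn_limitCoeff hd')
      (fun v hv => ?_) (hscale s _) (Eventually.of_forall fun N v hv => ?_)
      (fun ε hε => key f hf hmf hcf (by linarith) hδ' hfexp hs le_rfl hβs.le
        (if_pos rfl).symm (if_neg hβs.ne).symm hv₁ hd₀ hd hε)
    · rw [SurrogateSpatial.limitCoeff_ne_zero_iff (hd' v hv), zero_div, zero_add]
      exact div_ne_zero (mul_ne_zero (hv₁.trans_le hv.1).ne' ha) (mul_ne_zero hΓ (hd' v hv).ne')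
    · rw [SurrogateSpatial.coeffScale_mul_limitCoeff (hd' v hv), hG]
      generalize ((N : ℝ) * (1 - v * b₁)) ^ (-s) = X
      generalize 1 - v * b₁ = d
      ring
  constructor
  · intro f β c δ' hβ hc hδ' hf hfexp v₁ v₂ hv₁ hv₁' hv₂ hv₂'
    have hv₂b := SurrogateSpatial.mul_lt_one_of_lt_one_div hv₂ hv₂'
    -- The leading `1` of the expansion is merged into the sum as its term of index `0`.
    set cf : ℕ → ℂ := fun n => if n = 0 then 1 else
      (-1 : ℂ) ^ n * SurrogateSpatial.boundaryDerivC f n R / (Nat.factorial n : ℂ) with hcf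
    have hmf : 0 < ⌈β⌉₊ := Nat.ceil_pos.2 hβ
    have hfexp' : (fun z : ℂ => f z - ((∑ n ∈ Finset.range ⌈β⌉₊, cf n * (1 - z / R) ^ n) +
        (c : ℂ) * (1 - z / R) ^ (β : ℂ)))
        =O[𝓝[SurrogateSpatial.Delta0 R η φ] (R : ℂ)] fun z : ℂ => ‖1 - z / R‖ ^ (β + δ') := by
      refine hfexp.congr_left fun z => ?_
      rw [Finset.range_eq_Ico, Finset.sum_eq_sum_Ico_succ_bot hmf, hcf]
      simp only [if_true, pow_zero, mul_one, zero_add]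
      congr 3
      refine Finset.sum_congr rfl fun n hn => ?_
      rw [if_neg (by have := (Finset.mem_Ico.1 hn).1; omega : n ≠ 0)]
    have hd := fun v (hv : v ∈ Set.Icc v₁ v₂) => SurrogateSpatial.one_sub_mul_le (b := b₁) hv₁ hv
    have hd₀ : 0 < min 1 (1 - v₂ * b₁) := lt_min one_pos (by linarith)
    have hd' := fun v (hv : v ∈ Set.Icc v₁ v₂) => hd₀.trans_le (hd v hv)
    refine ⟨main f cf _ β c δ' hmf (if_pos rfl) hδ' hf hfexp' v₁ v₂ hv₁ hv₂b, ?_, ?_⟩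
    · intro hβZ hβs
      -- Here `q = β + 1 < s`, so the singular term of `g_κ` enters with coefficient `0`.
      refine SurrogateSpatial.UnifEquiv.of_eventually isCompact_Icc
        (g := SurrogateSpatial.limitCoeff (β + 1) b₁ 0 c)
        (SurrogateSpatial.continuousOn_limitCoeff hd')
        (fun v hv => ?_) (hscale (β + 1) _) (Eventually.of_forall fun N v hv => ?_)
        (fun ε hε => key f hf hmf (if_pos rfl) hβ hδ' hfexp' (by linarith) (by linarith)
          (by linarith) (if_neg (by linarith)).symm (if_pos (by ring)).symm hv₁ hd₀ hd hε)
      · rw [SurrogateSpatial.limitCoeff_ne_zero_iff (hd' v hv), mul_zero, zero_div, add_zero,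
          show 1 - (β + 1) = -β by ring]
        exact div_ne_zero hc.ne' (SurrogateSpatial.Gamma_neg_ne_zero hβZ)
      · rw [SurrogateSpatial.coeffScale_mul_limitCoeff (hd' v hv), hG,
          show 1 - (β + 1) = -β by ring, show -(β + 1) = -β - 1 by ring]
        ring
    · intro hβs
      -- Now `q = s = β + 1`, and both singular terms are retained.
      have hkey := fun {ε : ℝ} (hε : 0 < ε) => key f hf hmf (if_pos rfl) hβ hδ' hfexp' hs le_rfl
        hβs.ge (if_pos rfl).symm (if_pos hβs.symm).symm hv₁ hd₀ hd hε
      constructor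
      · intro ε hε
        -- The error is known relative to `N^(-s)`; as `d(v)^(-s)` is continuous and positive on the
        -- compact interval, it is also small relative to `(N d(v))^(-s)`.
        have hg : ContinuousOn (fun v : ℝ => (1 - v * b₁) ^ (-s)) (Set.Icc v₁ v₂) :=
          ContinuousOn.rpow_const (by fun_prop) fun v hv => Or.inl (hd' v hv).ne'
        filter_upwards [SurrogateSpatial.eventually_norm_le_mul_abs isCompact_Icc hg
          (fun v hv => (Real.rpow_pos_of_pos (hd' v hv) _).ne') (hscale s _)
          (fun ε hε => hkey hε) hε, hscale s (Set.Icc v₁ v₂)] with N h1 h2 v hv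
        have h3 := h1 v hv
        have h4 := Real.rpow_pos_of_pos (hd' v hv) (-s)
        rw [SurrogateSpatial.coeffScale_mul_limitCoeff (hd' v hv),
          abs_of_pos (mul_pos (h2 v hv) h4)] at h3
        rw [hG, Real.mul_rpow N.cast_nonneg (hd' v hv).le] at *
        refine h3.trans_eq ?_
        rw [SurrogateSpatial.coeffScale]
        ring
      · intro K hK hKsub hK0
        refine SurrogateSpatial.UnifEquiv.of_eventually hK
          (g := SurrogateSpatial.limitCoeff s b₁ a c)
          (SurrogateSpatial.continuousOn_limitCoeff fun v hv => hd' v (hKsub hv))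
          (fun v hv => ?_) (hscale s _) (Eventually.of_forall fun N v hv => ?_)
          (fun ε hε => (hkey hε).mono fun N hN v hv => hN v (hKsub hv))
        · rw [SurrogateSpatial.limitCoeff_ne_zero_iff (hd' v (hKsub hv))]
          exact hK0 v hv
        · rw [SurrogateSpatial.coeffScale_mul_limitCoeff (hd' v (hKsub hv)), hG]
  · have hb₁lt : b₁ < 1 := SurrogateSpatial.toReal_lt_one hsup
    -- The constant function `1` has an expansion with zero singular coefficient and exponent `β = s
    -- > s - 1`; the interval of parameters is the single point `v = 1`.
    have hone := main (fun _ => 1) (fun n => if n = 0 then 1 else 0) 1 s 0 1 one_pos (if_pos rfl)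
      one_pos (differentiableOn_const _) (by simpa using isBigO_zero _ _) 1 1 one_pos
      (by linarith) (by linarith)
    rw [IsEquivalent, isLittleO_iff]
    intro ε hε
    filter_upwards [hone ε hε] with N hN
    have h := hN 1 (by simp)
    simp only [one_mul, mul_one, Complex.ofReal_one] at h
    rw [← SurrogateSpatial.H_eq_coeffAt hR hgθ hgκ, ← Complex.ofReal_sub, Complex.norm_real] at h
    exact h
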